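/- **Setting.** Let $\mathsf N\ge 0$, let $2s_1,\dots,2s_{\mathsf N}$ be positive integers, let $\eta\in\mathbb C\setminus\{0\}$ and $\xi=(\xi_1,\dots,\xi_{\mathsf N})\in\mathbb C^{\mathsf N}$. On $\mathcal H=\bigotimes_{n}\mathbb C^{2s_n+1}$ let $S^z_n=\mathrm{diag}(s_n,s_n-1,\dots,-s_n)$, let $S_n^+$ have the entries $\sqrt{j(2s_n+1-j)}$ ($j=1,\dots,2s_n$) above the diagonal, $S_n^-=(S_n^+)^t$, and $$L_n(\lambda)=\begin{pmatrix}\lambda+\eta(\tfrac12+S^z_n)&\eta S^-_n\\ \eta S^+_n&\lambda+\eta(\tfrac12-S^z_n)\end{pmatrix}.$$ For a $2\times2$ matrix $K$ put $M^{(K)}(\lambda)=K L_{\mathsf N}(\lambda-\xi_{\mathsf N})\cdots L_1(\lambda-\xi_1)=\begin{pmatrix}A^{(K)}&B^{(K)}\\ C^{(K)}&D^{(K)}\end{pmatrix}(\lambda)$. Let $T^{(K|l)}(\lambda)$ be the trace, over the symmetric part of the auxiliary space $(\mathbb C^2)^{\otimes l}$, of $P^+M_1^{(K)}(\lambda+(l-1)\eta)\cdots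 M_l^{(K)}(\lambda)P^+$, where $P^+$ is the symmetrizer, and $T^{(K|0)}=1$. Put $$\xi_n^{(k)}=\xi_n-\tfrac\eta2+(s_n-k)\eta,\qquad a(\lambda)=\prod_n(\lambda-\xi_n+\tfrac\eta2+s_n\eta),\qquad d(\lambda)=\prod_n(\lambda-\xi_n+\tfrac\eta2-s_n\eta).$$ Assume throughout that $K$ has eigenvalues $\mathsf k_1\ne\mathsf k_2$, both nonzero, and that $$(\ast)\qquad \xi_a^{(h)}\neq\xi_b^{(k)}\quad\text{for } a\ne b,\ 0\le h\le 2s_a,\ 0\le k\le 2s_b .$$ **The $Q$-operator.** Fix $\zeta\in\mathbb C$. Indices $(c,k)$ in products run over $1\le c\le \mathsf N$, $1\le k\le 2s_c$. For $0\le h\le 2s_a$ put $$\mathsf Q_a^{(h)}=\frac{T^{(K|2s_a-h)}(\xi_a^{(2s_a)})}{\mathsf k_2^{2s_a-h}\prod_{k=0}^{2s_a-h-1}d(\xi_a^{(2s_a-k)})},\qquad c_b(\lambda)=\sum_{h=1}^{2s_b}\frac{\lambda-\zeta}{\xi_b^{(h)}-\zeta}\prod_{(c,k)\ne(b,h)}\frac{\lambda-\xi_c^{(k)}}{\xi_b^{(h)}-\xi_c^{(k)}}\,\mathsf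 Q_b^{(h)},\qquad g(\lambda)=\prod_{(c,k)}\frac{\lambda-\xi_c^{(k)}}{\zeta-\xi_c^{(k)}},$$ let $C_\zeta$ be the $\mathsf N\times\mathsf N$ matrix of operators $[C_\zeta]_{ab}=-\delta_{ab}\mathsf Q_a^{(0)}+c_b(\xi_a^{(0)})$, let $C_\zeta(j)$ be $C_\zeta$ with its column $j$ replaced by $(-g(\xi_a^{(0)}))_a$, and define the polynomial operator family $$\mathsf Q(\lambda)=g(\lambda)+\sum_{b=1}^{\mathsf N}c_b(\lambda)\,\frac{\det C_\zeta(b)}{\det C_\zeta}.$$ Say that *$\mathsf Q$ is defined* if $\zeta\ne\xi_c^{(k)}$ for all $c$ and all $1\le k\le 2s_c$, $\det C_\zeta$ is an invertible operator, and $\mathsf Q(\xi_n^{(2s_n)})$ is an invertible operator for every $n$. **The covectors.** Let $\langle0|=\bigotimes_n(1,0,\dots,0)$ and $\textsc n=\prod_{b<a}(\xi_a^{(0)}-\xi_b^{(0)})^{1/2}$. For a matrix $W\in GL_2(\mathbb C)$ let $\mathcal W$ be the product over $n$ of the symmetric powers $W^{(2s_n)}$ acting on $\mathcal H$, let $\bar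 K=W^{-1}KW$ and $$\tilde A^{(K)}(\lambda)=\mathrm{tr}_0\big[W\begin{pmatrix}1&0\\0&0\end{pmatrix}W^{-1}M^{(K)}(\lambda)\big],\qquad \tilde B^{(K)}(\lambda)=\mathrm{tr}_0\big[W\begin{pmatrix}0&0\\1&0\end{pmatrix}W^{-1}M^{(K)}(\lambda)\big].$$ For $\mathbf h=(h_1,\dots,h_{\mathsf N})$, $0\le h_n\le 2s_n$, put $$\langle\mathbf h|_{Sk}=\frac1{\textsc n}\langle0|\prod_n\prod_{k=0}^{h_n-1}\frac{A^{(K)}(\xi_n^{(k)})}{\mathsf k_1a(\xi_n^{(k)})},\qquad \underline{\langle\mathbf h|}_{Sk}=\frac1{\textsc n}\langle0|\prod_n\prod_{k=0}^{h_n-1}\frac{A^{(\bar K)}(\xi_n^{(k)})}{\mathsf k_1a(\xi_n^{(k)})}\;\mathcal W^{-1}.$$ **Statement.** (i) For all $\mathsf N$, $s_n$, $\eta$, $\zeta$ as above there is a nonzero polynomial $P$ in $(\xi_1,\dots,\xi_{\mathsf N},\mathsf k_1,\mathsf k_2)$ such that, for every $\xi\in\mathbb C^{\mathsf N}$ and every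 $K$ with eigenvalues $\mathsf k_1\ne\mathsf k_2$, both nonzero, $P(\xi,\mathsf k_1,\mathsf k_2)\ne0$ implies that $(\ast)$ holds and that $\mathsf Q$ is defined. (That is, this is so for almost all values of the parameters.) (ii) Whenever $K$ is as above, $(\ast)$ holds and $\mathsf Q$ is defined, one has for all $\lambda\notin\{\xi_c^{(k)}:1\le k\le 2s_c\}$ $$\mathsf Q(\lambda)=\frac{\det[C_\zeta+\Delta_\zeta(\lambda)]}{\det C_\zeta}\,g(\lambda),\qquad [\Delta_\zeta(\lambda)]_{ab}=\sum_{h=1}^{2s_b}\frac{\lambda-\zeta}{\xi_b^{(h)}-\lambda}\,\frac{\prod_{(c,k)}(\xi_a^{(0)}-\xi_c^{(k)})}{(\xi_b^{(h)}-\zeta)\prod_{(c,k)\ne(b,h)}(\xi_b^{(h)}-\xi_c^{(k)})}\,\mathsf Q_b^{(h)},$$ and the following hold. a) If $b=K_{12}\neq0$, then with $$\langle L|=\frac1{\textsc n}\langle0|\prod_{n}\prod_{k=0}^{2s_n-1}\frac{A^{(K)}(\xi_n^{(k)})}{\mathsf k_1a(\xi_n^{(k)})}\prod_{n}\mathsf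 Q^{-1}(\xi_n^{(2s_n)})$$ one has $\langle L|\prod_{a}\mathsf Q(\xi_a^{(h_a)})=\langle\mathbf h|_{Sk}$ for all $\mathbf h$, and these covectors are a $B^{(K)}$-eigenbasis: they form a basis of the dual of $\mathcal H$, $\langle\mathbf h|_{Sk}B^{(K)}(\lambda)=b\prod_n(\lambda-\xi_n^{(h_n)})\langle\mathbf h|_{Sk}$ for all $\lambda$, and these eigenvalues are pairwise distinct functions of $\lambda$. b) If $K_{12}=0$, then there are $W\in GL_2(\mathbb C)$ for which both off-diagonal entries of $\bar K=W^{-1}KW$ are nonzero, and for every such $W$, with $$\langle L|=\frac1{\textsc n}\langle0|\,\mathcal W^{-1}\prod_{n}\prod_{k=0}^{2s_n-1}\frac{\tilde A^{(K)}(\xi_n^{(k)})}{\mathsf k_1a(\xi_n^{(k)})}\prod_{n}\mathsf Q^{-1}(\xi_n^{(2s_n)}),$$ one has $\langle L|\prod_{a}\mathsf Q(\xi_a^{(h_a)})=\underline{\langle\mathbf h|}_{Sk}$ for all $\mathbf h$, and these covectors are a $\tilde B^{(K)}$-eigenbasis, in the same sense, with the pairwise distinct eigenvalues $\bar K_{12}\prod_n(\lambda-\xi_n^{(h_n)})$.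 -/

import Mathlib

open Matrix

namespace HigherSpin

/-! A chain has `N` sites. Site `n` carries the spin `s n = p n / 2`, where `p n` is a positive
integer, with the space `ℂ ^ (p n + 1)`. The quantum space is the tensor product of these spaces,
with its product basis. Operators are matrices in this basis, covectors are row vectors. -/

/-- Labels of the product basis, `h n ∈ {0, …, p n}` (`0` is the highest weight vector). -/
abbrev Idx {N : ℕ} (p : Fin N → ℕ) : Type := (n : Fin N) → Fin (p n + 1)

/-- Operators on the quantum space. -/
abbrev Op {N : ℕ} (p : Fin N → ℕ) : Type := Matrix (Idx p) (Idx p) ℂ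

/-- Covectors on the quantum space; an operator `X` acts on `v` by `v ᵥ* X`. -/
abbrev Covector {N : ℕ} (p : Fin N → ℕ) : Type := Idx p → ℂ

noncomputable section

/-! ### Local spin operators and the Lax operator -/

/-- `S^z = diag (s, s - 1, …, -s)`, where `s = q / 2`. -/
def spinZ (q : ℕ) : Matrix (Fin (q + 1)) (Fin (q + 1)) ℂ :=
  Matrix.diagonal fun j => (q : ℂ) / 2 - (j : ℕ)

/-- `S^+`, with the entries `√(j (2 s + 1 - j))`, `j = 1, …, 2 s`, above the diagonal. -/
def spinPlus (q : ℕ) : Matrix (Fin (q + 1)) (Fin (q + 1)) ℂ :=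
  Matrix.of fun i j =>
    if (i : ℕ) + 1 = (j : ℕ) then
      ((Real.sqrt (((j : ℕ) : ℝ) * ((q : ℝ) + 1 - ((j : ℕ) : ℝ))) : ℝ) : ℂ)
    else 0

/-- `S^-`, the transpose of `S^+`. -/
def spinMinus (q : ℕ) : Matrix (Fin (q + 1)) (Fin (q + 1)) ℂ := (spinPlus q)ᵀ

/-- The Lax operator, as a `2 × 2` matrix of operators on the local space. -/
def lax (η : ℂ) (q : ℕ) (x : ℂ) :
    Matrix (Fin 2) (Fin 2) (Matrix (Fin (q + 1)) (Fin (q + 1)) ℂ) :=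
  !![(x + η / 2) • 1 + η • spinZ q, η • spinMinus q;
     η • spinPlus q, (x + η / 2) • 1 - η • spinZ q]

section Chain

variable {N : ℕ} (p : Fin N → ℕ) (η : ℂ) (ξ : Fin N → ℂ)

/-- The operator that acts as `X` on the site `n` and as the identity on the other sites. -/
def siteOp (n : Fin N) (X : Matrix (Fin (p n + 1)) (Fin (p n + 1)) ℂ) : Op p :=
  Matrix.of fun h h' => if ∀ m, m ≠ n → h m = h' m then X (h n) (h' n) else 0

/-- A `2 × 2` matrix of numbers as a matrix of scalar operators. -/
def auxMat (A : Matrix (Fin 2) (Fin 2) ℂ) : Matrix (Fin 2) (Fin 2) (Op p) :=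
  A.map (algebraMap ℂ (Op p))

/-- The monodromy matrix `K L_N(x - ξ_N) ⋯ L_1(x - ξ_1)`; its entries `(0,0)`, `(0,1)`, `(1,0)`,
`(1,1)` are the operators `A^{(K)}`, `B^{(K)}`, `C^{(K)}`, `D^{(K)}` at `x`. -/
def monodromy (K : Matrix (Fin 2) (Fin 2) ℂ) (x : ℂ) : Matrix (Fin 2) (Fin 2) (Op p) :=
  auxMat p K *
    (List.ofFn fun i : Fin N =>
      (lax η (p i.rev) (x - ξ i.rev)).map (siteOp p i.rev)).prod

/-- The operator family `A^{(K)}`. -/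
def opA (K : Matrix (Fin 2) (Fin 2) ℂ) (x : ℂ) : Op p := monodromy p η ξ K x 0 0

/-- The operator family `B^{(K)}`. -/
def opB (K : Matrix (Fin 2) (Fin 2) ℂ) (x : ℂ) : Op p := monodromy p η ξ K x 0 1

/-- `tr_a [W_a E_11 W_a⁻¹ M_a^{(K)}(x)]`. -/
def opATilde (K W : Matrix (Fin 2) (Fin 2) ℂ) (x : ℂ) : Op p :=
  Matrix.trace (auxMat p (W * !![1, 0; 0, 0] * W⁻¹) * monodromy p η ξ K x)

/-- `tr_a [W_a E_21 W_a⁻¹ M_a^{(K)}(x)]`. -/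
def opBTilde (K W : Matrix (Fin 2) (Fin 2) ℂ) (x : ℂ) : Op p :=
  Matrix.trace (auxMat p (W * !![0, 0; 1, 0] * W⁻¹) * monodromy p η ξ K x)

/-! ### Fused transfer matrices -/

end Chain

/-- The symmetrizer on `(ℂ²)^{⊗ l}`. The permutation operator of `π` maps the basis vector `e_g`
to `e_{g ∘ π}`. -/
def symProj (l : ℕ) : Matrix (Fin l → Fin 2) (Fin l → Fin 2) ℂ :=
  ((l.factorial : ℂ))⁻¹ •
    ∑ π : Equiv.Perm (Fin l), Matrix.of fun f g => if f = g ∘ π then (1 : ℂ) else 0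

section Chain

variable {N : ℕ} (p : Fin N → ℕ) (η : ℂ) (ξ : Fin N → ℂ)

/-- `M_1(x + (l - 1) η) ⋯ M_{l-1}(x + η) M_l(x)` on `(ℂ²)^{⊗ l}` times the quantum space. -/
def monodromyWord (K : Matrix (Fin 2) (Fin 2) ℂ) (l : ℕ) (x : ℂ) :
    Matrix (Fin l → Fin 2) (Fin l → Fin 2) (Op p) :=
  Matrix.of fun f g =>
    (List.ofFn fun i : Fin l =>
      monodromy p η ξ K (x + ((l : ℂ) - 1 - ((i : ℕ) : ℂ)) * η) (f i) (g i)).prod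

/-- The fused monodromy matrix: the product above between two symmetrizers. -/
def fusedMonodromy (K : Matrix (Fin 2) (Fin 2) ℂ) (l : ℕ) (x : ℂ) :
    Matrix (Fin l → Fin 2) (Fin l → Fin 2) (Op p) :=
  (symProj l).map (algebraMap ℂ (Op p)) * monodromyWord p η ξ K l x *
    (symProj l).map (algebraMap ℂ (Op p))

/-- The fused transfer matrix `T^{(K|l)}(x)`, the trace of the fused monodromy matrix over the
symmetric tensors (the symmetrizers make it vanish on a complement). -/
def fusedTransfer (K : Matrix (Fin 2) (Fin 2) ℂ) (l : ℕ) (x : ℂ) : Op p :=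
  Matrix.trace (fusedMonodromy p η ξ K l x)

/-! ### The action of `GL_2` on the quantum space -/

end Chain

/-- The symmetric power `W^{(q)}` of a `2 × 2` matrix: the restriction of `W ⊗ ⋯ ⊗ W` (`q`
factors) to the symmetric tensors, in the orthonormal basis `u_j = (q choose j)^{-1/2} ∑ e_f`, the
sum over the words `f` with `j` letters `1` and `q - j` letters `0`. In this basis the spin
operators of `(ℂ²)^{⊗ q}` act by `spinZ`, `spinPlus` and `spinMinus`. -/
def symPower (q : ℕ) (W : Matrix (Fin 2) (Fin 2) ℂ) :
    Matrix (Fin (q + 1)) (Fin (q + 1)) ℂ :=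
  Matrix.of fun j k =>
    ((Real.sqrt ((q.choose j : ℝ) * (q.choose k : ℝ)) : ℝ) : ℂ)⁻¹ *
      ∑ f : Fin q → Fin 2, ∑ g : Fin q → Fin 2,
        if ∑ i, ((f i : Fin 2) : ℕ) = (j : ℕ) ∧ ∑ i, ((g i : Fin 2) : ℕ) = (k : ℕ) then
          ∏ i, W (f i) (g i)
        else 0

section Chain

variable {N : ℕ} (p : Fin N → ℕ) (η : ℂ) (ξ : Fin N → ℂ)

/-- `𝒲 = ⊗_n W^{(p n)}`. -/
def globalPower (W : Matrix (Fin 2) (Fin 2) ℂ) : Op p :=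
  Matrix.of fun h h' => ∏ n, symPower (p n) W (h n) (h' n)

/-! ### The covectors of the Sklyanin type -/

/-- The points `ξ_n^{(k)} = ξ_n - η / 2 + (s_n - k) η`. -/
def pt (n : Fin N) (k : ℕ) : ℂ := ξ n - η / 2 + ((p n : ℂ) / 2 - (k : ℂ)) * η

/-- `a(x) = ∏_n (x - (ξ_n - η / 2) + s_n η)`. -/
def fa (x : ℂ) : ℂ := ∏ n, (x - (ξ n - η / 2) + (p n : ℂ) / 2 * η)

/-- `d(x) = ∏_n (x - (ξ_n - η / 2) - s_n η)`. -/
def fd (x : ℂ) : ℂ := ∏ n, (x - (ξ n - η / 2) - (p n : ℂ) / 2 * η)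

/-- The normalization `∏_{b < a} (ξ_a^{(0)} - ξ_b^{(0)})^{1/2}` (principal square roots). -/
def normConst : ℂ := ∏ a, ∏ b ∈ Finset.Iio a, (pt p η ξ a 0 - pt p η ξ b 0) ^ (1 / 2 : ℂ)

/-- The reference covector `⟨0| = ⊗_n (1, 0, …, 0)`. -/
def refCovector : Covector p := Pi.single (fun _ => 0) 1

/-- The label `(2 s_1, …, 2 s_N)`. -/
def topIdx : Idx p := fun n => Fin.last (p n)

/-- `∏_n ∏_{k = 0}^{h_n - 1} X(ξ_n^{(k)}) / (k₁ a(ξ_n^{(k)}))`, for a family `X` of operators. -/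
def raising (X : ℂ → Op p) (k₁ : ℂ) (h : Idx p) : Op p :=
  (List.ofFn fun n : Fin N =>
    ((List.range (h n)).map fun k =>
      (k₁ * fa p η ξ (pt p η ξ n k))⁻¹ • X (pt p η ξ n k)).prod).prod

/-- The covectors `⟨h|_Sk` for a twist matrix `K` with `K 0 1 ≠ 0`. -/
def skCovector (K : Matrix (Fin 2) (Fin 2) ℂ) (k₁ : ℂ) (h : Idx p) : Covector p :=
  (normConst p η ξ)⁻¹ • (refCovector p ᵥ* raising p η ξ (opA p η ξ K) k₁ h)

/-- The covectors `⟨h|_Sk` for a twist matrix `K` with `K 0 1 = 0`, built from the conjugate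
`W⁻¹ K W` of `K`. -/
def skCovectorTilde (K W : Matrix (Fin 2) (Fin 2) ℂ) (k₁ : ℂ) (h : Idx p) : Covector p :=
  (normConst p η ξ)⁻¹ •
    (refCovector p ᵥ* (raising p η ξ (opA p η ξ (W⁻¹ * K * W)) k₁ h * (globalPower p W)⁻¹))

/-! ### The `Q`-operator -/

/-- Determinant of a matrix of operators, by the Leibniz formula. It is used only for matrices
whose entries commute with one another. -/
def opDet (M : Matrix (Fin N) (Fin N) (Op p)) : Op p :=
  ∑ σ : Equiv.Perm (Fin N),
    ((Equiv.Perm.sign σ : ℤˣ) : ℤ) • (List.ofFn fun i : Fin N => M (σ i) i).prod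

/-- `Q_{T,a}^{(h)} = T^{(K|2 s_a - h)}(ξ_a^{(2 s_a)}) /
(k₂ ^ (2 s_a - h) ∏_{k = 0}^{2 s_a - h - 1} d(ξ_a^{(2 s_a - k)}))`, for `0 ≤ h ≤ 2 s_a`. -/
def qVal (K : Matrix (Fin 2) (Fin 2) ℂ) (k₂ : ℂ) (a : Fin N) (h : ℕ) : Op p :=
  (k₂ ^ (p a - h) * ∏ k ∈ Finset.range (p a - h), fd p η ξ (pt p η ξ a (p a - k)))⁻¹ •
    fusedTransfer p η ξ K (p a - h) (pt p η ξ a (p a))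

/-- `∏_{(c, k) ≠ (b, h)} (x - ξ_c^{(k)})`, over all sites `c` and all `1 ≤ k ≤ 2 s_c`. -/
def nodeProdErase (b : Fin N) (h : ℕ) (x : ℂ) : ℂ :=
  ∏ c, ∏ k ∈ Finset.Icc 1 (p c), if c = b ∧ k = h then 1 else x - pt p η ξ c k

/-- `∏_{(c, k)} (x - ξ_c^{(k)})`, over all sites `c` and all `1 ≤ k ≤ 2 s_c`. -/
def nodeProd (x : ℂ) : ℂ := ∏ c, ∏ k ∈ Finset.Icc 1 (p c), (x - pt p η ξ c k)

/-- The coefficient of the unknown `q_b` in the interpolation formula for `Q(x)` from the points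
`ζ` and `ξ_c^{(k)}`, `1 ≤ k ≤ 2 s_c`. -/
def interpCoeff (K : Matrix (Fin 2) (Fin 2) ℂ) (k₂ ζ : ℂ) (b : Fin N) (x : ℂ) : Op p :=
  ∑ h ∈ Finset.Icc 1 (p b),
    ((x - ζ) / (pt p η ξ b h - ζ) *
      (nodeProdErase p η ξ b h x / nodeProdErase p η ξ b h (pt p η ξ b h))) •
        qVal p η ξ K k₂ b h

/-- The matrix `C_ζ`, with entries
`-δ_{ab} Q_{T,a}^{(0)} + ∑_h (ξ_a^{(0)} - ζ) / (ξ_b^{(h)} - ζ) ∏ … Q_{T,b}^{(h)}`. -/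
def matC (K : Matrix (Fin 2) (Fin 2) ℂ) (k₂ ζ : ℂ) : Matrix (Fin N) (Fin N) (Op p) :=
  Matrix.of fun a b =>
    (if a = b then -qVal p η ξ K k₂ a 0 else 0) + interpCoeff p η ξ K k₂ ζ b (pt p η ξ a 0)

/-- The matrix `C_ζ` with its column `j` replaced by
`-∏_{(c, k)} (ξ_a^{(0)} - ξ_c^{(k)}) / (ζ - ξ_c^{(k)})`. -/
def matCRepl (K : Matrix (Fin 2) (Fin 2) ℂ) (k₂ ζ : ℂ) (j : Fin N) :
    Matrix (Fin N) (Fin N) (Op p) :=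
  (matC p η ξ K k₂ ζ).updateCol j fun a =>
    -((nodeProd p η ξ (pt p η ξ a 0) / nodeProd p η ξ ζ) • (1 : Op p))

/-- The `Q`-operator `Q(x)`, a polynomial in `x`, with `Q(ζ) = 1`: the interpolation formula, with
the values `q_b = det C_ζ(b) / det C_ζ` at the points `ξ_b^{(2 s_b)}`. -/
def opQ (K : Matrix (Fin 2) (Fin 2) ℂ) (k₂ ζ x : ℂ) : Op p :=
  (∑ b, interpCoeff p η ξ K k₂ ζ b x *
      (opDet p (matCRepl p η ξ K k₂ ζ b) * (opDet p (matC p η ξ K k₂ ζ))⁻¹)) +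
    (nodeProd p η ξ x / nodeProd p η ξ ζ) • (1 : Op p)

/-- The matrix `Δ_ζ(x)` of the determinant formula for the `Q`-operator. -/
def matDelta (K : Matrix (Fin 2) (Fin 2) ℂ) (k₂ ζ x : ℂ) : Matrix (Fin N) (Fin N) (Op p) :=
  Matrix.of fun a b =>
    ∑ h ∈ Finset.Icc 1 (p b),
      ((x - ζ) / (pt p η ξ b h - x) *
        (nodeProd p η ξ (pt p η ξ a 0) /
          ((pt p η ξ b h - ζ) * nodeProdErase p η ξ b h (pt p η ξ b h)))) •
        qVal p η ξ K k₂ b h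

/-- `det (C_ζ + Δ_ζ(x)) / det C_ζ * ∏_{(c, k)} (x - ξ_c^{(k)}) / (ζ - ξ_c^{(k)})`, a rational
function of `x` with apparent poles at the points `ξ_c^{(k)}`. -/
def opQDet (K : Matrix (Fin 2) (Fin 2) ℂ) (k₂ ζ x : ℂ) : Op p :=
  (nodeProd p η ξ x / nodeProd p η ξ ζ) •
    (opDet p (matC p η ξ K k₂ ζ + matDelta p η ξ K k₂ ζ x) *
      (opDet p (matC p η ξ K k₂ ζ))⁻¹)

/-- The strings of points `ξ_a^{(0)}, …, ξ_a^{(2 s_a)}` of different sites do not meet. -/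
def SovCondition : Prop :=
  ∀ a b, a ≠ b → ∀ h ≤ p a, ∀ k ≤ p b, pt p η ξ a h ≠ pt p η ξ b k

/-- The definition of the `Q`-operator with the base point `ζ` makes sense, and the operators
`Q(ξ_n^{(2 s_n)})` are invertible. -/
def QDefined (K : Matrix (Fin 2) (Fin 2) ℂ) (k₂ ζ : ℂ) : Prop :=
  (∀ n, ∀ k, 1 ≤ k → k ≤ p n → ζ ≠ pt p η ξ n k) ∧
  IsUnit (opDet p (matC p η ξ K k₂ ζ)) ∧
  ∀ n, IsUnit (opQ p η ξ K k₂ ζ (pt p η ξ n (p n)))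

/-- `∏_n Q(ξ_n^{(h_n)})`. -/
def qProd (K : Matrix (Fin 2) (Fin 2) ℂ) (k₂ ζ : ℂ) (h : Idx p) : Op p :=
  (List.ofFn fun n : Fin N => opQ p η ξ K k₂ ζ (pt p η ξ n (h n))).prod

/-- `∏_n Q⁻¹(ξ_n^{(2 s_n)})`. -/
def qInvProd (K : Matrix (Fin 2) (Fin 2) ℂ) (k₂ ζ : ℂ) : Op p :=
  (List.ofFn fun n : Fin N => (opQ p η ξ K k₂ ζ (pt p η ξ n (p n)))⁻¹).prod

/-- The generating covector `⟨L|` for `K 0 1 ≠ 0`. -/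
def covL (K : Matrix (Fin 2) (Fin 2) ℂ) (k₁ k₂ ζ : ℂ) : Covector p :=
  (normConst p η ξ)⁻¹ •
    (refCovector p ᵥ*
      (raising p η ξ (opA p η ξ K) k₁ (topIdx p) * qInvProd p η ξ K k₂ ζ))

/-- The generating covector `⟨L|` for `K 0 1 = 0`. -/
def covLTilde (K W : Matrix (Fin 2) (Fin 2) ℂ) (k₁ k₂ ζ : ℂ) : Covector p :=
  (normConst p η ξ)⁻¹ •
    (refCovector p ᵥ*
      ((globalPower p W)⁻¹ * raising p η ξ (opATilde p η ξ K W) k₁ (topIdx p) *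
        qInvProd p η ξ K k₂ ζ))

/-- `v` is a basis of the covectors, `v h` is an eigencovector of every `B(x)` with the eigenvalue
`d_h(x) = b ∏_n (x - ξ_n^{(h_n)})`, and the functions `d_h` are pairwise distinct. -/
def IsSovEigenbasis (v : Idx p → Covector p) (B : ℂ → Op p) (b : ℂ) : Prop :=
  LinearIndependent ℂ v ∧ Submodule.span ℂ (Set.range v) = ⊤ ∧
  (∀ h x, v h ᵥ* B x = (b * ∏ n, (x - pt p η ξ n (h n))) • v h) ∧
  Function.Injective fun (h : Idx p) (x : ℂ) => b * ∏ n, (x - pt p η ξ n (h n))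

end Chain

/-- `W` is an admissible change of basis for the twist matrix `K`: it is invertible and both
off-diagonal entries of `W⁻¹ K W` are nonzero. -/
def IsDressing (K W : Matrix (Fin 2) (Fin 2) ℂ) : Prop :=
  IsUnit W ∧ (W⁻¹ * K * W) 0 1 ≠ 0 ∧ (W⁻¹ * K * W) 1 0 ≠ 0

/-- `k₁` and `k₂` are the eigenvalues of `K`; they are distinct and nonzero. -/
def IsRegularTwist (K : Matrix (Fin 2) (Fin 2) ℂ) (k₁ k₂ : ℂ) : Prop :=
  K.charpoly = (Polynomial.X - Polynomial.C k₁) * (Polynomial.X - Polynomial.C k₂) ∧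
    k₁ ≠ k₂ ∧ k₁ ≠ 0 ∧ k₂ ≠ 0

end

end HigherSpin

/-! The reference covector is a left eigencovector of `B`. Applying `A` at a zero of the current
`B`-eigenvalue moves that zero one step along its string (`eigen_shift`), and the quantum
determinant, whose term with `B` vanishes there, makes `D` undo the step (`skVec_opD`). Hence the
covectors with labels in range do not vanish; their eigenvalues separate the labels, and counting
gives a basis. A step past the end of a string would produce an eigenvalue outside the spectrum, so
it gives zero (`eq_zero_of_eigen`).

On this basis the transfer matrix at the point marked by the label acts as a two-term ladder
operator. The fusion recursion (`fusedTransfer_succ_succ`) has the same shape, and its quantum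
determinant term cancels the raising term. By induction the fused transfer matrices at the end of
the string `n` move the label `p n` down to any value (`skVec_fusedTransfer`), so products of the
`qVal` carry the top covector to all the others.

The Q-operator is built so that its value at the point `h` of the string `n` is `qVal n h` times its
value at the last point: at the interpolation nodes by construction, at the first point by the
linear system that Cramer's rule solves. The values at the last points therefore cancel
(`qInvProd_mul_qProd`), which gives the generating property. The determinant formula holds because
the added matrix has rank one (`interpDelta_eq`). Such computations are made in a commutative
algebra mapping to the operators (`exists_lift`). When the upper off-diagonal entry of the twist is
zero, simultaneous `GL_2` covariance in the auxiliary and quantum spaces (`conj_monodromy`) reduces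
the claim to a conjugate twist.

For generic existence, the twist is diagonalized; the conditions then say that certain rational
functions of the parameters do not vanish, and one point where they do not is enough. It is taken at
the degenerate twist with eigenvalues 0 and 1. There fusion is a plain product, all operators are
triangular, and each diagonal entry is a scalar functional equation with the explicit solution
`lowerProd`, whose uniqueness is `IsString.unique`. -/

namespace HigherSpin

/-! ### Sums of words of fixed content. -/

section WordSum

variable {R : Type*} [Ring R]

/-- The sums of the words of given content in the letters `M`. -/
def wordSum (η : ℂ) (M : ℂ → Matrix (Fin 2) (Fin 2) R) (x : ℂ) : ℕ → ℤ → ℕ → R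
  | 0, j, _ => if j = 0 then 1 else 0
  | l + 1, j, k =>
    -- For contents `k ≤ l + 1` the column word is the zeros followed by the `k` ones, so its
    -- leading letter is 1 only if all letters are. The row content is an integer so that `j - 1`
    -- does not truncate.
    if k ≤ l then
      M (x + l * η) 0 0 * wordSum η M x l j k + M (x + l * η) 1 0 * wordSum η M x l (j - 1) k
    else
      M (x + l * η) 0 1 * wordSum η M x l j (k - 1) +
        M (x + l * η) 1 1 * wordSum η M x l (j - 1) (k - 1)

theorem wordSum_eq_zero (η : ℂ) (M : ℂ → Matrix (Fin 2) (Fin 2) R) (x : ℂ) (l : ℕ) (j : ℤ)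
    (k : ℕ) (hj : j < 0 ∨ (l : ℤ) < j) : wordSum η M x l j k = 0 := by
  induction l generalizing j k with
  | zero => rw [wordSum, if_neg]; rintro rfl; simp at hj
  | succ l ih =>
    push_cast at hj
    rw [wordSum]
    split_ifs <;> rw [ih _ _ (by omega), ih _ _ (by omega)] <;> simp

theorem wordSum_succ_of_le (η : ℂ) (M : ℂ → Matrix (Fin 2) (Fin 2) R) (x : ℂ) {l k : ℕ}
    (h : k ≤ l) (j : ℤ) : wordSum η M x (l + 1) j k =
      M (x + l * η) 0 0 * wordSum η M x l j k + M (x + l * η) 1 0 * wordSum η M x l (j - 1) k := by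
  rw [wordSum, if_pos h]

/-- The sum of the diagonal word sums; it is the trace of the fused monodromy matrix. -/
def diagWordSum (η : ℂ) (M : ℂ → Matrix (Fin 2) (Fin 2) R) (l : ℕ) (x : ℂ) : R :=
  ∑ j ∈ Finset.range (l + 1), wordSum η M x l j j

theorem diagWordSum_zero (η : ℂ) (M : ℂ → Matrix (Fin 2) (Fin 2) R) (x : ℂ) :
    diagWordSum η M 0 x = 1 := by
  simp [diagWordSum, wordSum]

theorem diagWordSum_one (η : ℂ) (M : ℂ → Matrix (Fin 2) (Fin 2) R) (x : ℂ) :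
    diagWordSum η M 1 x = (M x).trace := by
  simp [diagWordSum, wordSum, Finset.sum_range_succ, Matrix.trace_fin_two]

end WordSum

/-! ### Exchange relations, quantum determinant and fusion. -/

section Yangian

variable {R : Type*} [Ring R] [Algebra ℂ R]

/-- The entries of `M` satisfy the exchange relations of the rational `R`-matrix `x + η P`, and the
quantum determinant of `M` is the scalar function `δ`. -/
structure IsYangian (η : ℂ) (M : ℂ → Matrix (Fin 2) (Fin 2) R) (δ : ℂ → ℂ) : Prop where
  rtt : ∀ x y i j k l,
    (x - y) • (M x i j * M y k l) + η • (M x k j * M y i l) =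
      (x - y) • (M y k l * M x i j) + η • (M y k j * M x i l)
  qdet : ∀ x, M x 0 0 * M (x - η) 1 1 - M x 0 1 * M (x - η) 1 0 = algebraMap ℂ R (δ x)

namespace IsYangian

variable {η : ℂ} {M X Y : ℂ → Matrix (Fin 2) (Fin 2) R} {δ δ₁ δ₂ : ℂ → ℂ}

theorem const (η : ℂ) (A : Matrix (Fin 2) (Fin 2) ℂ) :
    IsYangian η (fun _ => A.map (algebraMap ℂ R)) (fun _ => A.det) where
  rtt x y i j k l := by
    simp only [Matrix.map_apply, ← map_mul]
    rw [mul_comm (A i j), mul_comm (A k j)]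
  qdet x := by
    simp only [Matrix.map_apply, ← map_mul, ← map_sub, Matrix.det_fin_two]

/-- At distance `η` the R-matrix degenerates: both coefficients of the exchange relation equal `η`
and can be cancelled. In the opposite order (`shift'`) they are opposite, which gives the
antisymmetric form. -/
theorem shift (h : IsYangian η M δ) (hη : η ≠ 0) (x : ℂ) (i j k l : Fin 2) :
    M x i j * M (x - η) k l + M x k j * M (x - η) i l =
      M (x - η) k l * M x i j + M (x - η) k j * M x i l := by
  have := h.rtt x (x - η) i j k l
  rw [sub_sub_cancel, ← smul_add, ← smul_add] at this
  exact smul_right_injective _ hη this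

theorem shift' (h : IsYangian η M δ) (hη : η ≠ 0) (x : ℂ) (i j k l : Fin 2) :
    M (x - η) k j * M x i l - M (x - η) i j * M x k l =
      M x k j * M (x - η) i l - M x k l * M (x - η) i j := by
  have := h.rtt (x - η) x i j k l
  rw [sub_sub_cancel_left, neg_smul, neg_smul, neg_add_eq_sub, neg_add_eq_sub, ← smul_sub,
    ← smul_sub] at this
  exact smul_right_injective _ hη this

/-- For equal row indices one side of the antisymmetric relation is zero. -/
theorem row_comm (h : IsYangian η M δ) (hη : η ≠ 0) (x : ℂ) (i : Fin 2) :
    M x i 0 * M (x - η) i 1 = M x i 1 * M (x - η) i 0 := by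
  have := h.shift' hη x i 0 i 1
  rw [sub_self] at this
  exact sub_eq_zero.1 this.symm

/-- Two instances of the symmetric relation turn one expansion of the quantum determinant into the
other; products and fusion need both. -/
theorem qdet_right (h : IsYangian η M δ) (hη : η ≠ 0) (x : ℂ) :
    M x 1 1 * M (x - η) 0 0 - M x 1 0 * M (x - η) 0 1 = algebraMap ℂ R (δ x) := by
  have h1 := h.shift hη x 0 0 1 1
  have h2 := h.shift hη x 0 1 1 0
  rw [← h.qdet x, sub_eq_sub_iff_add_eq_add]
  rw [add_comm (M (x - η) 1 0 * _), ← h1] at h2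
  rw [add_comm, add_comm (M x 0 0 * _), add_comm (M x 1 0 * _), ← h2]

theorem diag_comm (h : IsYangian η M δ) (hη : η ≠ 0) (x y : ℂ) (i : Fin 2) :
    Commute (M x i i) (M y i i) := by
  have h1 := h.rtt x y i i i i
  have h2 := h.rtt y x i i i i
  rw [← add_smul, ← add_smul] at h1 h2
  -- The relation is `x - y + η` times a commutator; where this factor vanishes, exchanging `x` and
  -- `y` turns it into `2 η`.
  by_cases h0 : x - y + η = 0
  · have : y - x + η ≠ 0 := fun h' => hη (by linear_combination (h0 + h') / 2)
    exact (smul_right_injective _ this h2).symm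
  · exact smul_right_injective _ h0 h1

/-- In the sum of the four exchange relations between different diagonal entries all off-diagonal
products cancel; what remains is `2 (x - y)` times the mixed commutators. -/
theorem trace_comm (h : IsYangian η M δ) (hη : η ≠ 0) (x y : ℂ) :
    Commute (M x).trace (M y).trace := by
  rcases eq_or_ne x y with rfl | hxy
  · exact Commute.refl _
  have h1 := h.rtt x y 0 0 1 1
  have h2 := h.rtt x y 1 1 0 0
  have h3 := h.rtt y x 0 0 1 1
  have h4 := h.rtt y x 1 1 0 0
  rw [← neg_sub x y, neg_smul, neg_smul] at h3 h4
  set u := M x 0 0 * M y 1 1 - M y 1 1 * M x 0 0 + (M x 1 1 * M y 0 0 - M y 0 0 * M x 1 1)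
    with hu
  have hu2 : (2 * (x - y)) • u = 0 := by
    rw [two_mul, add_smul, hu, smul_add, smul_sub, smul_sub]
    rw [← sub_eq_zero] at h1 h2 h3 h4
    calc _ = _ := by abel
      _ = _ := congrArg₂ (· + ·) (congrArg₂ (· + ·) h1 h2) (congrArg₂ (· + ·) h3 h4)
      _ = 0 := by simp
  have hu0 : u = 0 := (smul_eq_zero_iff_right (mul_ne_zero two_ne_zero (sub_ne_zero.2 hxy))).1 hu2
  have e0 := (h.diag_comm hη x y 0).eq
  have e1 := (h.diag_comm hη x y 1).eq
  simp only [Matrix.trace_fin_two]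
  rw [Commute, SemiconjBy, ← sub_eq_zero, ← hu0, hu]
  simp only [add_mul, mul_add]
  rw [e0, e1]
  abel

/-- Since entries of different factors commute, the exchange relation is applied to the `X`-pair,
the summation indices are interchanged where the pair was permuted, and the relation is applied to
the `Y`-pair. In the quantum determinant the terms with equal inner indices vanish by `row_comm`,
and the other two carry the factors `δ₂` and `-δ₂`. -/
theorem mul (hX : IsYangian η X δ₁) (hY : IsYangian η Y δ₂) (hη : η ≠ 0)
    (hc : ∀ x y i j k l, Commute (X x i j) (Y y k l)) :
    IsYangian η (fun x => X x * Y x) (fun x => δ₁ x * δ₂ x) where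
  rtt x y i j k l := by
    have key : ∀ u v i j k l, (X u * Y u) i j * (X v * Y v) k l =
        ∑ a, ∑ c, X u i a * X v k c * (Y u a j * Y v c l) := by
      intro u v i j k l
      simp only [Matrix.mul_apply, Finset.sum_mul_sum]
      refine Finset.sum_congr rfl fun a _ => Finset.sum_congr rfl fun c _ => ?_
      rw [mul_assoc, ← mul_assoc (Y u a j), ← (hc v u k c a j).eq]
      simp only [mul_assoc]
    simp only [key]
    have e1 : ∀ a c, (x - y) • (X x i a * X y k c * (Y x a j * Y y c l)) +
        η • (X x k a * X y i c * (Y x a j * Y y c l)) =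
        (x - y) • (X y k c * X x i a * (Y x a j * Y y c l)) +
        η • (X y k a * X x i c * (Y x a j * Y y c l)) := by
      intro a c
      simpa only [add_mul, smul_mul_assoc] using
        congrArg (· * (Y x a j * Y y c l)) (hX.rtt x y i a k c)
    have e2 : ∀ a c, (x - y) • (X y k c * X x i a * (Y x a j * Y y c l)) +
        η • (X y k c * X x i a * (Y x c j * Y y a l)) =
        (x - y) • (X y k c * X x i a * (Y y c l * Y x a j)) +
        η • (X y k c * X x i a * (Y y c j * Y x a l)) := by
      intro a c
      simpa only [mul_add, mul_smul_comm] using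
        congrArg (X y k c * X x i a * ·) (hY.rtt x y a j c l)
    calc _ = ∑ a, ∑ c, ((x - y) • (X y k c * X x i a * (Y x a j * Y y c l)) +
        η • (X y k a * X x i c * (Y x a j * Y y c l))) := by
          simp only [← e1, Finset.sum_add_distrib, Finset.smul_sum]
      _ = ∑ a, ∑ c, ((x - y) • (X y k c * X x i a * (Y x a j * Y y c l)) +
        η • (X y k c * X x i a * (Y x c j * Y y a l))) := by
          simp only [Finset.sum_add_distrib]
          congr 1
          rw [Finset.sum_comm]
      _ = _ := by
          simp only [e2, Finset.sum_add_distrib, Finset.smul_sum]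
          congr 1 <;> rw [Finset.sum_comm]
  qdet x := by
    have key : ∀ u v i j k l, (X u * Y u) i j * (X v * Y v) k l =
        ∑ a, ∑ c, X u i a * X v k c * (Y u a j * Y v c l) := by
      intro u v i j k l
      simp only [Matrix.mul_apply, Finset.sum_mul_sum]
      refine Finset.sum_congr rfl fun a _ => Finset.sum_congr rfl fun c _ => ?_
      rw [mul_assoc, ← mul_assoc (Y u a j), ← (hc v u k c a j).eq]
      simp only [mul_assoc]
    rw [key, key, map_mul, ← hX.qdet, sub_mul]
    nth_rw 1 [← hY.qdet]
    rw [← hY.qdet_right hη]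
    simp only [Fin.sum_univ_two, hY.row_comm hη]
    noncomm_ring

end IsYangian

/-- Summed over rows of fixed content, a word does not depend on the order of its column letters, so
a 1 may be brought to the front. Exchanging the first two letters is `row_comm` when the row letters
agree, and the equality of the two quantum determinants when they differ. -/
theorem IsYangian.wordSum_succ_succ {η : ℂ} {M : ℂ → Matrix (Fin 2) (Fin 2) R} {δ : ℂ → ℂ}
    (h : IsYangian η M δ) (hη : η ≠ 0) (x : ℂ) {l k : ℕ} (hk : k ≤ l) (j : ℤ) :
    wordSum η M x (l + 1) j (k + 1) =
      M (x + l * η) 0 1 * wordSum η M x l j k + M (x + l * η) 1 1 * wordSum η M x l (j - 1) k := by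
  induction l generalizing j k with
  | zero =>
    obtain rfl : k = 0 := by omega
    simp [wordSum]
  | succ l ih =>
    rcases hk.eq_or_lt with rfl | hk
    · rw [wordSum, if_neg (by omega), Nat.add_sub_cancel]
    have hk' : k ≤ l := by omega
    rw [wordSum_succ_of_le η M x (l := l + 1) (by omega), ih hk', ih hk',
      wordSum_succ_of_le η M x hk', wordSum_succ_of_le η M x hk']
    have hx : x + (l : ℂ) * η = x + ((l + 1 : ℕ) : ℂ) * η - η := by push_cast; ring
    rw [hx]
    set y := x + ((l + 1 : ℕ) : ℂ) * η
    have r0 := h.row_comm hη y 0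
    have r1 := h.row_comm hη y 1
    have q : M y 0 0 * M (y - η) 1 1 + M y 1 0 * M (y - η) 0 1 =
        M y 0 1 * M (y - η) 1 0 + M y 1 1 * M (y - η) 0 0 := by
      have := (h.qdet y).trans (h.qdet_right hη y).symm
      rw [sub_eq_sub_iff_add_eq_add] at this
      rw [this, add_comm]
    generalize wordSum η M x l j k = a
    generalize wordSum η M x l (j - 1) k = b
    generalize wordSum η M x l (j - 1 - 1) k = c
    calc _ = M y 0 0 * M (y - η) 0 1 * a + (M y 0 0 * M (y - η) 1 1 + M y 1 0 * M (y - η) 0 1) * b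
          + M y 1 0 * M (y - η) 1 1 * c := by noncomm_ring
      _ = _ := by rw [r0, r1, q]; noncomm_ring

/-- The fusion relation. Splitting off the leading letter gives the trace times the shorter diagonal
sum, up to a defect; splitting off one more letter in the defect isolates the quantum determinant.
-/
theorem IsYangian.diagWordSum_succ_succ {η : ℂ} {M : ℂ → Matrix (Fin 2) (Fin 2) R} {δ : ℂ → ℂ}
    (h : IsYangian η M δ) (hη : η ≠ 0) (l : ℕ) (x : ℂ) :
    diagWordSum η M (l + 2) x =
      (M (x + (l + 1 : ℕ) * η)).trace * diagWordSum η M (l + 1) x -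
        δ (x + (l + 1 : ℕ) * η) • diagWordSum η M l x := by
  have hx : x + (l : ℂ) * η = x + ((l + 1 : ℕ) : ℂ) * η - η := by push_cast; ring
  set y := x + ((l + 1 : ℕ) : ℂ) * η with hy
  -- The two leading letters combine to the second form of the quantum determinant; the contribution
  -- of row content `j - 1` cancels by `row_comm`.
  have key : ∀ j ∈ Finset.range (l + 1),
      M y 1 1 * wordSum η M x (l + 1) j j - M y 1 0 * wordSum η M x (l + 1) j (j + 1) =
        δ y • wordSum η M x l j j := by
    intro j hj
    have hj' : j ≤ l := by simpa [Nat.lt_succ_iff] using hj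
    rw [wordSum_succ_of_le η M x hj', h.wordSum_succ_succ hη x hj', hx, Algebra.smul_def,
      ← h.qdet_right hη]
    have r1 := h.row_comm hη y 1
    generalize wordSum η M x l j j = a
    generalize wordSum η M x l (j - 1) j = b
    calc _ = (M y 1 1 * M (y - η) 0 0 - M y 1 0 * M (y - η) 0 1) * a +
          (M y 1 1 * M (y - η) 1 0 - M y 1 0 * M (y - η) 1 1) * b := by noncomm_ring
      _ = _ := by rw [r1]; noncomm_ring
  have e1 : diagWordSum η M (l + 2) x = M y 0 0 * diagWordSum η M (l + 1) x +
      M y 1 0 * (∑ j ∈ Finset.range (l + 1), wordSum η M x (l + 1) j (j + 1)) +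
      M y 1 1 * wordSum η M x (l + 1) (l + 1 : ℕ) (l + 1) := by
    rw [diagWordSum, Finset.sum_range_succ, h.wordSum_succ_succ hη x le_rfl,
      wordSum_eq_zero η M x (l + 1) ((l + 1 + 1 : ℕ) : ℤ) (l + 1) (by right; push_cast; omega),
      mul_zero, zero_add, Finset.sum_congr rfl (g := fun j : ℕ =>
        M y 0 0 * wordSum η M x (l + 1) j j + M y 1 0 * wordSum η M x (l + 1) (j - 1) j)
        (fun j hj => wordSum_succ_of_le η M x (by simpa [Nat.lt_succ_iff] using hj) _),
      Finset.sum_add_distrib, ← Finset.mul_sum, ← Finset.mul_sum, ← diagWordSum,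
      Finset.sum_range_succ' (fun j : ℕ => wordSum η M x (l + 1) (j - 1) j),
      wordSum_eq_zero η M x (l + 1) (((0 : ℕ) : ℤ) - 1) 0 (by left; simp), add_zero]
    have e2 : ((l + 1 + 1 : ℕ) : ℤ) - 1 = (l + 1 : ℕ) := by push_cast; ring
    have e3 : ∀ j : ℕ, ((j + 1 : ℕ) : ℤ) - 1 = j := fun j => by push_cast; ring
    simp only [hy, e2, e3]
  have e4 : δ y • diagWordSum η M l x =
      M y 1 1 * (∑ j ∈ Finset.range (l + 1), wordSum η M x (l + 1) j j) -
        M y 1 0 * (∑ j ∈ Finset.range (l + 1), wordSum η M x (l + 1) j (j + 1)) := by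
    rw [diagWordSum, Finset.smul_sum, Finset.mul_sum, Finset.mul_sum, ← Finset.sum_sub_distrib]
    exact (Finset.sum_congr rfl key).symm
  rw [e1, e4, Matrix.trace_fin_two, add_mul]
  nth_rw 3 [diagWordSum]
  rw [Finset.sum_range_succ _ (l + 1), mul_add]
  abel

end Yangian

/-! ### Words and the symmetrizer -/

section Words

theorem content_le {l : ℕ} (g : Fin l → Fin 2) : ∑ i, (g i : ℕ) ≤ l := by
  calc ∑ i, (g i : ℕ) ≤ ∑ _i : Fin l, 1 := Finset.sum_le_sum fun i _ => by omega
    _ = l := by simp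

theorem exists_content {l j : ℕ} (h : j ≤ l) : ∃ g : Fin l → Fin 2, ∑ i, (g i : ℕ) = j := by
  refine ⟨fun i => if (i : ℕ) < j then 1 else 0, ?_⟩
  have : ∀ i : Fin l, (((if (i : ℕ) < j then 1 else 0 : Fin 2)) : ℕ) = if (i : ℕ) < j then 1 else 0 := by
    intro i; split_ifs <;> rfl
  simp only [this]
  rw [Finset.sum_boole, Fin.card_filter_val_lt]
  simp [h]

theorem exists_perm_of_content_eq {l : ℕ} {f g : Fin l → Fin 2}
    (h : ∑ i, (f i : ℕ) = ∑ i, (g i : ℕ)) : ∃ σ : Equiv.Perm (Fin l), f = g ∘ σ := by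
  have hc : ∀ f : Fin l → Fin 2, ∑ i, (f i : ℕ) = Fintype.card {i // f i = 1} := by
    intro f
    rw [Fintype.card_subtype, Finset.card_filter]
    refine Finset.sum_congr rfl fun i _ => ?_
    generalize f i = a
    fin_cases a <;> simp
  rw [hc, hc] at h
  let e := Fintype.equivOfCardEq h
  refine ⟨e.extendSubtype, funext fun i => ?_⟩
  by_cases hi : f i = 1
  · rw [hi, Function.comp_apply, e.extendSubtype_mem i hi]
  · have := e.extendSubtype_not_mem i hi
    rw [Function.comp_apply]
    omega

theorem symProj_apply {l : ℕ} (f g : Fin l → Fin 2) :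
    symProj l f g = ((l.factorial : ℂ))⁻¹ * ∑ π : Equiv.Perm (Fin l), if f = g ∘ π then 1 else 0 := by
  simp [symProj, Matrix.sum_apply]

/-- Words of equal content are permutations of each other, and the average over the symmetric group
absorbs the permutation. -/
theorem symProj_eq_ite {l : ℕ} (f g : Fin l → Fin 2) :
    symProj l f g = if ∑ i, (f i : ℕ) = ∑ i, (g i : ℕ) then symProj l f f else 0 := by
  split_ifs with h
  · obtain ⟨σ, hσ⟩ := exists_perm_of_content_eq h
    rw [symProj_apply, symProj_apply]
    congr 1
    refine Fintype.sum_equiv (Equiv.mulLeft σ⁻¹) _ _ fun π => ?_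
    have : f ∘ ⇑(σ⁻¹ * π) = g ∘ π := by
      conv_lhs => rw [hσ]
      ext i; simp
    rw [Equiv.coe_mulLeft, this]
  · rw [symProj_apply, Finset.sum_eq_zero, mul_zero]
    intro π _
    rw [if_neg]
    rintro rfl
    exact h (Equiv.sum_comp π fun i => (g i : ℕ))

theorem sum_symProj_left {l : ℕ} (g : Fin l → Fin 2) : ∑ f, symProj l f g = 1 := by
  simp only [symProj_apply, ← Finset.mul_sum]
  rw [Finset.sum_comm]
  simp [Fintype.card_perm, Nat.factorial_ne_zero]

/-- Within a content class the entries along a row are constant and the columns sum to 1, so the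
block has trace 1: each content carries one symmetric tensor. -/
theorem sum_symProj_diag {l j : ℕ} (h : j ≤ l) :
    ∑ f : Fin l → Fin 2, (if ∑ i, (f i : ℕ) = j then symProj l f f else 0) = 1 := by
  obtain ⟨g, rfl⟩ := exists_content h
  simp only [← symProj_eq_ite]
  exact sum_symProj_left g

variable {R : Type*} [Ring R]

/-- The matrix of the words of length `l` in the letters `M`. -/
def wordMat (η : ℂ) (M : ℂ → Matrix (Fin 2) (Fin 2) R) (l : ℕ) (x : ℂ) :
    Matrix (Fin l → Fin 2) (Fin l → Fin 2) R :=
  Matrix.of fun f g =>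
    (List.ofFn fun i : Fin l => M (x + ((l : ℂ) - 1 - ((i : ℕ) : ℂ)) * η) (f i) (g i)).prod

theorem wordMat_cons (η : ℂ) (M : ℂ → Matrix (Fin 2) (Fin 2) R) (l : ℕ) (x : ℂ) (a b : Fin 2)
    (f g : Fin l → Fin 2) :
    wordMat η M (l + 1) x (Fin.cons a f) (Fin.cons b g) =
      M (x + l * η) a b * wordMat η M l x f g := by
  simp only [wordMat, Matrix.of_apply, List.ofFn_succ, List.prod_cons, Fin.cons_zero, Fin.cons_succ]
  congr 3
  · simp
  · funext i
    congr 2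
    rw [Fin.val_succ]; push_cast; ring

variable [Algebra ℂ R]

/-- Here the exchange relations enter: a column word matters only through its content, although
`wordSum` was defined with one particular order. -/
theorem IsYangian.sum_wordMat {η : ℂ} {M : ℂ → Matrix (Fin 2) (Fin 2) R} {δ : ℂ → ℂ}
    (h : IsYangian η M δ) (hη : η ≠ 0) (x : ℂ) {l : ℕ} (j : ℤ) (g : Fin l → Fin 2) :
    ∑ f : Fin l → Fin 2, (if ((∑ i, (f i : ℕ) : ℕ) : ℤ) = j then wordMat η M l x f g else 0) =
      wordSum η M x l j (∑ i, (g i : ℕ)) := by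
  induction l generalizing j with
  | zero => simp [wordSum, wordMat, eq_comm]
  | succ l ih =>
    rw [← (Fin.consEquiv fun _ => Fin 2).sum_comp, Fintype.sum_prod_type]
    obtain ⟨b, g, rfl⟩ : ∃ b g', g = Fin.cons b g' := ⟨g 0, Fin.tail g, (Fin.cons_self_tail g).symm⟩
    have e : ∀ (a : Fin 2), ∑ f : Fin l → Fin 2,
        (if ((∑ i, ((Fin.cons a f : Fin (l + 1) → Fin 2) i : ℕ) : ℕ) : ℤ) = j then
          wordMat η M (l + 1) x (Fin.cons a f) (Fin.cons b g) else 0) =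
        M (x + l * η) a b * wordSum η M x l (j - (a : ℕ)) (∑ i, (g i : ℕ)) := by
      intro a
      rw [← ih, Finset.mul_sum]
      refine Finset.sum_congr rfl fun f _ => ?_
      rw [wordMat_cons, Fin.sum_univ_succ, mul_ite, mul_zero]
      refine if_congr ?_ rfl rfl
      simp only [Fin.cons_zero, Fin.cons_succ]
      push_cast
      constructor <;> intro h <;> linarith
    have hl := content_le g
    rw [Fin.sum_univ_two]
    refine (congrArg₂ (· + ·) (e 0) (e 1)).trans ?_
    rw [Fin.sum_univ_succ]
    simp only [Fin.cons_zero, Fin.cons_succ]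
    fin_cases b
    · simpa using (wordSum_succ_of_le η M x hl j).symm
    · simpa [add_comm 1] using (h.wordSum_succ_succ hη x hl j).symm

/-- The left symmetrizer replaces a row by the sum over its content class, after which columns enter
only through their content; the right one then contributes a column sum equal to 1. -/
theorem IsYangian.trace_fused {η : ℂ} {M : ℂ → Matrix (Fin 2) (Fin 2) R} {δ : ℂ → ℂ}
    (h : IsYangian η M δ) (hη : η ≠ 0) (l : ℕ) (x : ℂ) :
    Matrix.trace ((symProj l).map (algebraMap ℂ R) * wordMat η M l x *
      (symProj l).map (algebraMap ℂ R)) = diagWordSum η M l x := by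
  have e1 : ∀ f b, ((symProj l).map (algebraMap ℂ R) * wordMat η M l x) f b =
      symProj l f f • wordSum η M x l (∑ i, (f i : ℕ) : ℕ) (∑ i, (b i : ℕ)) := by
    intro f b
    rw [Matrix.mul_apply, ← h.sum_wordMat hη, Finset.smul_sum]
    refine Finset.sum_congr rfl fun a _ => ?_
    rw [Matrix.map_apply, symProj_eq_ite, ← Algebra.smul_def]
    by_cases hh : ∑ i, (f i : ℕ) = ∑ i, (a i : ℕ)
    · rw [if_pos hh, if_pos (by rw [hh])]
    · rw [if_neg hh, if_neg (by intro h; exact hh (by exact_mod_cast h.symm)), zero_smul, smul_zero]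
  have e2 : ∀ f, ((symProj l).map (algebraMap ℂ R) * wordMat η M l x *
      (symProj l).map (algebraMap ℂ R)) f f =
      symProj l f f • wordSum η M x l (∑ i, (f i : ℕ) : ℕ) (∑ i, (f i : ℕ)) := by
    intro f
    rw [Matrix.mul_apply, ← one_smul ℂ (symProj l f f • _), ← sum_symProj_left f, Finset.sum_smul]
    refine Finset.sum_congr rfl fun b _ => ?_
    rw [e1, Matrix.map_apply, ← Algebra.commutes, ← Algebra.smul_def]
    by_cases hh : ∑ i, (b i : ℕ) = ∑ i, (f i : ℕ)
    · rw [hh]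
    · rw [symProj_eq_ite b, if_neg hh, zero_smul, zero_smul]
  rw [Matrix.trace, diagWordSum]
  simp only [Matrix.diag_apply, e2]
  have e3 : ∀ j ∈ Finset.range (l + 1), wordSum η M x l j j =
      ∑ f : Fin l → Fin 2, if ∑ i, (f i : ℕ) = j then symProj l f f • wordSum η M x l j j else 0 := by
    intro j hj
    conv_lhs => rw [← one_smul ℂ (wordSum η M x l j j),
      ← sum_symProj_diag (l := l) (j := j) (by simpa [Nat.lt_succ_iff] using hj), Finset.sum_smul]
    refine Finset.sum_congr rfl fun f _ => ?_
    rw [ite_smul, zero_smul]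
  rw [Finset.sum_congr rfl e3, Finset.sum_comm]
  refine Finset.sum_congr rfl fun f _ => ?_
  rw [Finset.sum_ite_eq, if_pos]
  simpa [Nat.lt_succ_iff] using content_le f

end Words
end HigherSpin

namespace HigherSpin

/-! ### Operators on one site of the tensor product. -/

section Site

variable {N : ℕ} (p : Fin N → ℕ)

theorem siteOp_apply (n : Fin N) (X : Matrix (Fin (p n + 1)) (Fin (p n + 1)) ℂ) (h h' : Idx p) :
    siteOp p n X h h' = if ∀ m, m ≠ n → h m = h' m then X (h n) (h' n) else 0 := rfl

theorem siteOp_mul_apply (n : Fin N) (X : Matrix (Fin (p n + 1)) (Fin (p n + 1)) ℂ) (Y : Op p)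
    (h h' : Idx p) :
    (siteOp p n X * Y) h h' = ∑ j, X (h n) j * Y (Function.update h n j) h' := by
  rw [Matrix.mul_apply]
  symm
  refine Finset.sum_of_injOn (fun j => Function.update h n j)
    (fun a _ b _ hab => by simpa using congrFun hab n) (by simp) ?_ ?_
  · intro i _ hi
    rw [siteOp_apply, if_neg, zero_mul]
    intro hm
    refine hi ⟨i n, by simp, funext fun m => ?_⟩
    by_cases hmn : m = n
    · subst hmn; simp
    · simp [hmn, hm m hmn]
  · intro j _
    rw [siteOp_apply, if_pos]
    · simp
    · intro m hm; simp [hm]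

theorem siteOp_mul (n : Fin N) (X Y : Matrix (Fin (p n + 1)) (Fin (p n + 1)) ℂ) :
    siteOp p n (X * Y) = siteOp p n X * siteOp p n Y := by
  ext h h'
  rw [siteOp_mul_apply, siteOp_apply, Matrix.mul_apply]
  have e : ∀ j, (∀ m, m ≠ n → Function.update h n j m = h' m) ↔ ∀ m, m ≠ n → h m = h' m := by
    intro j
    refine forall_congr' fun m => imp_congr_right fun hm => by simp [hm]
  simp only [siteOp_apply, e, Function.update_self]
  split_ifs <;> simp

theorem siteOp_comm {n m : Fin N} (hnm : n ≠ m) (X : Matrix (Fin (p n + 1)) (Fin (p n + 1)) ℂ)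
    (Y : Matrix (Fin (p m + 1)) (Fin (p m + 1)) ℂ) : Commute (siteOp p n X) (siteOp p m Y) := by
  have key : ∀ {n m : Fin N} (_ : n ≠ m) (X : Matrix (Fin (p n + 1)) (Fin (p n + 1)) ℂ)
      (Y : Matrix (Fin (p m + 1)) (Fin (p m + 1)) ℂ) (h h' : Idx p),
      (siteOp p n X * siteOp p m Y) h h' =
        if ∀ i, i ≠ n → i ≠ m → h i = h' i then X (h n) (h' n) * Y (h m) (h' m) else 0 := by
    intro n m hnm X Y h h'
    rw [siteOp_mul_apply, Finset.sum_eq_single (h' n)]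
    · rw [siteOp_apply, Function.update_of_ne hnm.symm, mul_ite, mul_zero]
      refine if_congr (forall_congr' fun i => ?_) rfl rfl
      by_cases hi : i = n
      · subst hi; simp
      · simp [hi]
    · intro j _ hj
      rw [siteOp_apply, if_neg, mul_zero]
      intro hm
      exact hj (by simpa using hm n hnm)
    · simp
  ext h h'
  rw [key hnm, key hnm.symm, mul_comm]
  exact if_congr (forall_congr' fun i => by tauto) rfl rfl

/-- `siteOp` as a homomorphism of algebras. -/
noncomputable def siteHom (n : Fin N) : Matrix (Fin (p n + 1)) (Fin (p n + 1)) ℂ →ₐ[ℂ] Op p :=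
  AlgHom.ofLinearMap
    { toFun := siteOp p n
      map_add' := fun X Y => by
        ext h h'
        simp only [siteOp_apply, Matrix.add_apply]
        split_ifs <;> simp
      map_smul' := fun c X => by
        ext h h'
        simp only [siteOp_apply, Matrix.smul_apply, RingHom.id_apply]
        split_ifs <;> simp }
    (by
      ext h h'
      simp only [LinearMap.coe_mk, AddHom.coe_mk, siteOp_apply, Matrix.one_apply]
      by_cases hh : h = h'
      · subst hh; simp
      · rw [if_neg hh]
        split_ifs with h1 h2
        · exact absurd (funext fun m => if hm : m = n then hm ▸ h2 else h1 m hm) hh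
        · rfl
        · rfl)
    (siteOp_mul p n)

theorem siteHom_apply (n : Fin N) (X : Matrix (Fin (p n + 1)) (Fin (p n + 1)) ℂ) :
    siteHom p n X = siteOp p n X := rfl

end Site

/-! ### The spin representation and the Lax operator. -/

section Lax

theorem sqrt_mul_self_complex {q : ℕ} (j : Fin (q + 1)) :
    ((Real.sqrt (((j : ℕ) : ℝ) * ((q : ℝ) + 1 - ((j : ℕ) : ℝ))) : ℝ) : ℂ) *
      ((Real.sqrt (((j : ℕ) : ℝ) * ((q : ℝ) + 1 - ((j : ℕ) : ℝ))) : ℝ) : ℂ) =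
      ((j : ℕ) : ℂ) * ((q : ℂ) + 1 - (j : ℕ)) := by
  rw [← Complex.ofReal_mul, Real.mul_self_sqrt]
  · push_cast; ring
  · have : ((j : ℕ) : ℝ) ≤ q := by exact_mod_cast Nat.lt_succ_iff.1 j.2
    exact mul_nonneg (by positivity) (by linarith)

theorem spinPlus_mul_spinMinus (q : ℕ) :
    spinPlus q * spinMinus q =
      Matrix.diagonal fun j : Fin (q + 1) => (((j : ℕ) : ℂ) + 1) * ((q : ℂ) - (j : ℕ)) := by
  ext i k
  rw [Matrix.mul_apply]
  simp only [spinMinus, Matrix.transpose_apply, spinPlus, Matrix.of_apply]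
  by_cases hik : i = k
  · subst hik
    rw [Matrix.diagonal_apply_eq]
    rcases Nat.lt_or_ge (i : ℕ) q with hi | hi
    · rw [Finset.sum_eq_single ⟨i + 1, by omega⟩]
      · rw [if_pos rfl]
        refine (sqrt_mul_self_complex (⟨(i : ℕ) + 1, by omega⟩ : Fin (q + 1))).trans ?_
        push_cast; ring
      · intro j _ hj
        rw [if_neg, zero_mul]
        intro h
        exact hj (Fin.ext h.symm)
      · simp
    · have : (i : ℕ) = q := by omega
      rw [this, sub_self, mul_zero, Finset.sum_eq_zero]
      intro j _
      rw [if_neg (by omega), zero_mul]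
  · rw [Matrix.diagonal_apply_ne _ hik, Finset.sum_eq_zero]
    intro j _
    split_ifs with h1 h2
    · exact absurd (Fin.ext (by omega)) hik
    all_goals simp

theorem spinMinus_mul_spinPlus (q : ℕ) :
    spinMinus q * spinPlus q =
      Matrix.diagonal fun j : Fin (q + 1) => ((j : ℕ) : ℂ) * ((q : ℂ) + 1 - (j : ℕ)) := by
  ext i k
  rw [Matrix.mul_apply]
  simp only [spinMinus, Matrix.transpose_apply, spinPlus, Matrix.of_apply]
  by_cases hik : i = k
  · subst hik
    rw [Matrix.diagonal_apply_eq]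
    rcases Nat.eq_zero_or_pos (i : ℕ) with hi | hi
    · simp [hi]
    · rw [Finset.sum_eq_single ⟨i - 1, by omega⟩]
      · rw [if_pos (by simp; omega)]
        exact sqrt_mul_self_complex i
      · intro j _ hj
        rw [if_neg, zero_mul]
        intro h
        exact hj (Fin.ext (by simp; omega))
      · simp
  · rw [Matrix.diagonal_apply_ne _ hik, Finset.sum_eq_zero]
    intro j _
    split_ifs with h1 h2
    · exact absurd (Fin.ext (by omega)) hik
    all_goals simp

theorem spinZ_mul_spinPlus (q : ℕ) :
    spinZ q * spinPlus q = spinPlus q * spinZ q + spinPlus q := by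
  ext i k
  rw [spinZ, Matrix.add_apply, Matrix.diagonal_mul, Matrix.mul_diagonal, spinPlus, Matrix.of_apply]
  split_ifs with h
  · rw [← h]; push_cast; ring
  · simp

theorem spinZ_mul_spinMinus (q : ℕ) :
    spinZ q * spinMinus q = spinMinus q * spinZ q - spinMinus q := by
  ext i k
  rw [spinZ, Matrix.sub_apply, Matrix.diagonal_mul, Matrix.mul_diagonal, spinMinus,
    Matrix.transpose_apply, spinPlus, Matrix.of_apply]
  split_ifs with h
  · rw [← h]; push_cast; ring
  · simp

theorem spinPlus_comm_spinMinus (q : ℕ) :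
    spinPlus q * spinMinus q = spinMinus q * spinPlus q + (2 : ℂ) • spinZ q := by
  rw [spinPlus_mul_spinMinus, spinMinus_mul_spinPlus, spinZ, ← Matrix.diagonal_smul,
    Matrix.diagonal_add]
  congr 1
  funext j
  simp
  ring

/-- The matrix of the generators of `gl_2` acting on the spin representation. -/
noncomputable def spinMat (q : ℕ) :
    Matrix (Fin 2) (Fin 2) (Matrix (Fin (q + 1)) (Fin (q + 1)) ℂ) :=
  !![spinZ q, spinMinus q; spinPlus q, -spinZ q]

theorem lax_apply (η : ℂ) (q : ℕ) (x : ℂ) (i j : Fin 2) :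
    lax η q x i j = ((x + η / 2) * (if i = j then 1 else 0)) • 1 + η • spinMat q i j := by
  fin_cases i <;> fin_cases j <;> simp [lax, spinMat, sub_eq_add_neg]

theorem spinMat_comm (q : ℕ) (i j k l : Fin 2) :
    spinMat q i j * spinMat q k l = spinMat q k l * spinMat q i j +
      ((if i = l then (1 : ℂ) else 0) • spinMat q k j -
        (if k = j then (1 : ℂ) else 0) • spinMat q i l) := by
  have h1 := spinZ_mul_spinPlus q
  have h2 := spinZ_mul_spinMinus q
  have h3 := spinPlus_comm_spinMinus q
  rw [two_smul] at h3
  fin_cases i <;> fin_cases j <;> fin_cases k <;> fin_cases l <;>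
    simp [spinMat, h1, h2, h3] <;> abel

/-- The Lax operator is a scalar plus `η` times the spin matrix, so the exchange relation reduces to
the commutators in `spinMat_comm`. The quantum determinant is scalar because the product of the
off-diagonal entries is diagonal and completes the diagonal one to the Casimir element. -/
theorem lax_isYangian (η : ℂ) (q : ℕ) (u : ℂ) :
    IsYangian η (fun x => lax η q (x - u))
      (fun x => (x - (u - η / 2) + q / 2 * η) * (x - η - (u - η / 2) - q / 2 * η)) where
  rtt x y i j k l := by
    simp only [lax_apply]
    simp only [add_mul, mul_add, smul_mul_assoc, mul_smul_comm, one_mul, mul_one, spinMat_comm q i j k l]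
    rw [spinMat_comm q k j i l]
    module
  qdet x := by
    have h3 := spinMinus_mul_spinPlus q
    have e : ∀ z : ℂ, lax η q z 0 0 = Matrix.diagonal fun j : Fin (q + 1) => z + η / 2 + η * (q / 2 - (j : ℕ)) := by
      intro z; ext a b
      by_cases hab : a = b
      · subst hab; simp [lax, spinZ]
      · simp [lax, spinZ, hab]
    have e' : ∀ z : ℂ, lax η q z 1 1 = Matrix.diagonal fun j : Fin (q + 1) => z + η / 2 - η * (q / 2 - (j : ℕ)) := by
      intro z; ext a b
      by_cases hab : a = b
      · subst hab; simp [lax, spinZ]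
      · simp [lax, spinZ, hab]
    have e1 : lax η q (x - u) 0 1 * lax η q (x - η - u) 1 0 =
        Matrix.diagonal fun j : Fin (q + 1) => η ^ 2 * (((j : ℕ) : ℂ) * ((q : ℂ) + 1 - (j : ℕ))) := by
      simp only [lax, Matrix.of_apply, Matrix.cons_val_zero, Matrix.cons_val_one]
      simp only [smul_mul_smul_comm, h3, ← Matrix.diagonal_smul]
      congr 1; funext j; simp only [Pi.smul_apply, smul_eq_mul]; ring
    rw [e, e', e1, Matrix.diagonal_mul_diagonal, Matrix.diagonal_sub, Algebra.algebraMap_eq_smul_one,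
      ← Matrix.diagonal_one, ← Matrix.diagonal_smul]
    congr 1; funext j; simp; ring
end Lax

/-! ### The monodromy matrix as a product over distinct sites. -/

section Monodromy

variable {N : ℕ} (p : Fin N → ℕ) (η : ℂ) (ξ : Fin N → ℂ)

/-- The Lax operator at the site `n` as a matrix of operators on the whole space. -/
noncomputable def siteLax (n : Fin N) (x : ℂ) : Matrix (Fin 2) (Fin 2) (Op p) :=
  (lax η (p n) (x - ξ n)).map (siteOp p n)

theorem IsYangian.map {R S : Type*} [Ring R] [Algebra ℂ R] [Ring S] [Algebra ℂ S] (φ : R →ₐ[ℂ] S)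
    {η : ℂ} {M : ℂ → Matrix (Fin 2) (Fin 2) R} {δ : ℂ → ℂ} (h : IsYangian η M δ) :
    IsYangian η (fun x => (M x).map φ) δ where
  rtt x y i j k l := by
    simpa only [map_add, map_smul, map_mul, Matrix.map_apply] using congrArg φ (h.rtt x y i j k l)
  qdet x := by
    simpa only [map_sub, map_mul, AlgHom.commutes, Matrix.map_apply] using congrArg φ (h.qdet x)

/-- The quantum determinant of the Lax operator at the site `n`. -/
noncomputable def siteDet (n : Fin N) (x : ℂ) : ℂ :=
  (x - (ξ n - η / 2) + (p n : ℂ) / 2 * η) * (x - η - (ξ n - η / 2) - (p n : ℂ) / 2 * η)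

theorem siteLax_isYangian (n : Fin N) : IsYangian η (siteLax p η ξ n) (siteDet p η ξ n) :=
  (lax_isYangian η (p n) (ξ n)).map (siteHom p n)

theorem siteLax_comm {n m : Fin N} (hnm : n ≠ m) (x y : ℂ) (i j k l : Fin 2) :
    Commute (siteLax p η ξ n x i j) (siteLax p η ξ m y k l) :=
  siteOp_comm p hnm _ _

theorem prod_commute_of_forall {R : Type*} [Ring R] {L : List (Matrix (Fin 2) (Fin 2) R)} {a : R}
    (h : ∀ X ∈ L, ∀ k l, Commute a (X k l)) (k l : Fin 2) : Commute a (L.prod k l) := by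
  induction L generalizing k l with
  | nil =>
    rw [List.prod_nil, Matrix.one_apply]
    split_ifs <;> simp
  | cons X L ih =>
    rw [List.prod_cons, Matrix.mul_apply]
    refine Commute.sum_right _ _ _ fun c _ => ?_
    exact (h X (by simp) _ _).mul_right (ih (fun Y hY => h Y (by simp [hY])) _ _)

theorem siteLax_prod_isYangian (hη : η ≠ 0) (L : List (Fin N)) (hL : L.Nodup) :
    IsYangian η (fun x => (L.map fun n => siteLax p η ξ n x).prod)
      (fun x => (L.map fun n => siteDet p η ξ n x).prod) := by
  induction L with
  | nil =>
    convert IsYangian.const (R := Op p) η 1 using 2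
    · simp
    · simp
  | cons n L ih =>
    rw [List.nodup_cons] at hL
    simp only [List.map_cons, List.prod_cons]
    refine (siteLax_isYangian p η ξ n).mul (ih hL.2) hη fun x y i j k l => ?_
    refine prod_commute_of_forall (fun X hX k l => ?_) k l
    obtain ⟨m, hm, rfl⟩ := List.mem_map.1 hX
    exact siteLax_comm p η ξ (by rintro rfl; exact hL.1 hm) _ _ _ _ _ _

/-- The sites in the order in which they enter the monodromy matrix. -/
def sites (N : ℕ) : List (Fin N) := List.ofFn fun i : Fin N => i.rev

theorem sites_nodup : (sites N).Nodup := List.nodup_ofFn.2 Fin.rev_injective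

theorem monodromy_eq (K : Matrix (Fin 2) (Fin 2) ℂ) (x : ℂ) :
    monodromy p η ξ K x = auxMat p K * ((sites N).map fun n => siteLax p η ξ n x).prod := by
  rw [monodromy, sites, List.map_ofFn]
  rfl

theorem prod_sites {M : Type*} [CommMonoid M] (f : Fin N → M) :
    ((sites N).map f).prod = ∏ n, f n := by
  rw [sites, List.map_ofFn, List.prod_ofFn]
  exact Equiv.prod_comp Fin.revPerm f

theorem monodromy_isYangian (hη : η ≠ 0) (K : Matrix (Fin 2) (Fin 2) ℂ) :
    IsYangian η (monodromy p η ξ K) (fun x => K.det * (fa p η ξ x * fd p η ξ (x - η))) := by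
  have h := (IsYangian.const (R := Op p) η K).mul
    (siteLax_prod_isYangian p η ξ hη (sites N) sites_nodup) hη
    (by
      intro x y i j k l
      rw [Matrix.map_apply]
      exact Algebra.commutes _ _)
  have e1 : monodromy p η ξ K = fun x => K.map (algebraMap ℂ (Op p)) *
    ((sites N).map fun n => siteLax p η ξ n x).prod := funext fun x => monodromy_eq p η ξ K x
  have e2 : (fun x => K.det * (fa p η ξ x * fd p η ξ (x - η))) = fun x =>
      K.det * ((sites N).map fun n => siteDet p η ξ n x).prod := by
    funext x
    rw [prod_sites, fa, fd, ← Finset.prod_mul_distrib]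
    rfl
  rw [e1, e2]
  exact h

/-! ### The transfer matrices -/

/-- The transfer matrix. -/
noncomputable def transfer (K : Matrix (Fin 2) (Fin 2) ℂ) (x : ℂ) : Op p :=
  (monodromy p η ξ K x).trace

theorem fusedTransfer_eq (hη : η ≠ 0) (K : Matrix (Fin 2) (Fin 2) ℂ) (l : ℕ) (x : ℂ) :
    fusedTransfer p η ξ K l x = diagWordSum η (monodromy p η ξ K) l x := by
  have e : monodromyWord p η ξ K l x = wordMat η (monodromy p η ξ K) l x := by
    ext1 f g
    rw [monodromyWord, wordMat]
  rw [fusedTransfer, fusedMonodromy, e]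
  exact (monodromy_isYangian p η ξ hη K).trace_fused hη l x

theorem fusedTransfer_zero (hη : η ≠ 0) (K : Matrix (Fin 2) (Fin 2) ℂ) (x : ℂ) :
    fusedTransfer p η ξ K 0 x = 1 := by
  rw [fusedTransfer_eq p η ξ hη, diagWordSum_zero]

theorem fusedTransfer_one (hη : η ≠ 0) (K : Matrix (Fin 2) (Fin 2) ℂ) (x : ℂ) :
    fusedTransfer p η ξ K 1 x = transfer p η ξ K x := by
  rw [fusedTransfer_eq p η ξ hη, diagWordSum_one, transfer]

theorem fusedTransfer_succ_succ (hη : η ≠ 0) (K : Matrix (Fin 2) (Fin 2) ℂ) (l : ℕ) (x : ℂ) :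
    fusedTransfer p η ξ K (l + 2) x =
      transfer p η ξ K (x + (l + 1 : ℕ) * η) * fusedTransfer p η ξ K (l + 1) x -
        (K.det * (fa p η ξ (x + (l + 1 : ℕ) * η) * fd p η ξ (x + l * η))) •
          fusedTransfer p η ξ K l x := by
  simp only [fusedTransfer_eq p η ξ hη]
  rw [(monodromy_isYangian p η ξ hη K).diagWordSum_succ_succ hη, transfer]
  congr 5
  push_cast; ring

theorem transfer_comm (hη : η ≠ 0) (K : Matrix (Fin 2) (Fin 2) ℂ) (x y : ℂ) :
    Commute (transfer p η ξ K x) (transfer p η ξ K y) :=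
  (monodromy_isYangian p η ξ hη K).trace_comm hη x y

/-! ### The reference covector -/

theorem refCovector_siteOp (n : Fin N) (X : Matrix (Fin (p n + 1)) (Fin (p n + 1)) ℂ) (c : ℂ)
    (hX : ∀ j, X 0 j = if j = 0 then c else 0) :
    refCovector p ᵥ* siteOp p n X = c • refCovector p := by
  rw [refCovector, Matrix.single_one_vecMul]
  funext h
  rw [Matrix.row_apply, siteOp_apply, hX, Pi.smul_apply, Pi.single_apply, smul_eq_mul, mul_ite,
    mul_one, mul_zero, ← ite_and]
  refine if_congr ⟨fun hh => funext fun m => ?_, ?_⟩ rfl rfl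
  · by_cases hm : m = n
    · subst hm; exact hh.2
    · exact (hh.1 m hm).symm
  · rintro rfl
    simp

theorem lax_zero_row (q : ℕ) (x : ℂ) (j : Fin (q + 1)) :
    lax η q x 0 1 0 j = if j = 0 then 0 else 0 := by
  simp [lax, spinMinus, spinPlus]

theorem lax_zero_row' (q : ℕ) (x : ℂ) (j : Fin (q + 1)) :
    lax η q x 1 1 0 j = if j = 0 then x + η / 2 - q / 2 * η else 0 := by
  by_cases h : j = 0
  · subst h; simp [lax, spinZ]; ring
  · simp [lax, spinZ, h, Ne.symm h]

theorem lax_zero_row'' (q : ℕ) (x : ℂ) (j : Fin (q + 1)) :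
    lax η q x 0 0 0 j = if j = 0 then x + η / 2 + q / 2 * η else 0 := by
  by_cases h : j = 0
  · subst h; simp [lax, spinZ]; ring
  · simp [lax, spinZ, h, Ne.symm h]

/-- The row of the highest weight vector vanishes in the upper off-diagonal Lax entry and is a
multiple of that vector in the diagonal ones; both properties pass along the chain. -/
theorem refCovector_prod (L : List (Fin N)) (hL : L.Nodup) (x : ℂ) :
    refCovector p ᵥ* (L.map fun n => siteLax p η ξ n x).prod 0 1 = 0 ∧
    refCovector p ᵥ* (L.map fun n => siteLax p η ξ n x).prod 1 1 =
      (L.map fun n => x - (ξ n - η / 2) - (p n : ℂ) / 2 * η).prod • refCovector p := by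
  induction L with
  | nil => simp
  | cons n L ih =>
    rw [List.nodup_cons] at hL
    obtain ⟨h0, h1⟩ := ih hL.2
    have s01 := refCovector_siteOp p n _ _ (lax_zero_row η (p n) (x - ξ n))
    have s11 := refCovector_siteOp p n _ _ (lax_zero_row' η (p n) (x - ξ n))
    have s00 := refCovector_siteOp p n _ _ (lax_zero_row'' η (p n) (x - ξ n))
    have hc : Commute (siteLax p η ξ n x 1 0) ((L.map fun n => siteLax p η ξ n x).prod 0 1) := by
      refine prod_commute_of_forall (fun X hX k l => ?_) _ _
      obtain ⟨m, hm, rfl⟩ := List.mem_map.1 hX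
      exact siteLax_comm p η ξ (by rintro rfl; exact hL.1 hm) _ _ _ _ _ _
    simp only [List.map_cons, List.prod_cons, Matrix.mul_apply, Fin.sum_univ_two, Matrix.vecMul_add]
    -- The lower off-diagonal entry at `n` is moved behind the rest of the chain, which annihilates
    -- the reference covector.
    rw [hc.eq]
    simp only [siteLax, Matrix.map_apply, ← Matrix.vecMul_vecMul] at *
    rw [s00, s01, s11, h0, zero_smul, Matrix.zero_vecMul, Matrix.zero_vecMul, Matrix.smul_vecMul,
      Matrix.smul_vecMul, h0, h1, smul_smul]
    refine ⟨by simp, ?_⟩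
    rw [zero_add]
    congr 2
    ring

theorem refCovector_opB (K : Matrix (Fin 2) (Fin 2) ℂ) (x : ℂ) :
    refCovector p ᵥ* opB p η ξ K x = (K 0 1 * fd p η ξ x) • refCovector p := by
  obtain ⟨h0, h1⟩ := refCovector_prod p η ξ (sites N) sites_nodup x
  rw [prod_sites] at h1
  rw [opB, monodromy_eq, Matrix.mul_apply, Fin.sum_univ_two, Matrix.vecMul_add]
  simp only [auxMat, Matrix.map_apply, ← Algebra.smul_def, Matrix.vecMul_smul, h0, h1, smul_zero,
    zero_add, smul_smul, fd]

end Monodromy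
end HigherSpin

namespace HigherSpin

/-! ### The twist, the strings of points and two auxiliary principles. -/

section Twist

theorem IsRegularTwist.det_eq {K : Matrix (Fin 2) (Fin 2) ℂ} {k₁ k₂ : ℂ}
    (h : IsRegularTwist K k₁ k₂) : K.det = k₁ * k₂ := by
  have := congrArg (Polynomial.eval 0) h.1
  rw [Matrix.charpoly_fin_two] at this
  simpa using this

end Twist

section Generic

variable {N : ℕ} (p : Fin N → ℕ) (η : ℂ) (ξ : Fin N → ℂ)

/-- The zeros of `fd` are the first points of the strings, those of `fa` the last ones; inside the
strings the ladder coefficients are therefore nonzero. -/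
theorem fd_eq (x : ℂ) : fd p η ξ x = ∏ n, (x - pt p η ξ n 0) := by
  rw [fd]
  refine Finset.prod_congr rfl fun n _ => ?_
  rw [pt]; push_cast; ring

theorem fa_eq (x : ℂ) : fa p η ξ x = ∏ n, (x - pt p η ξ n (p n)) := by
  rw [fa]
  refine Finset.prod_congr rfl fun n _ => ?_
  rw [pt]; ring

theorem pt_sub (n : Fin N) (k : ℕ) : pt p η ξ n k - η = pt p η ξ n (k + 1) := by
  rw [pt, pt]; push_cast; ring

theorem pt_add (n : Fin N) {l k : ℕ} (h : l ≤ k) :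
    pt p η ξ n k + l * η = pt p η ξ n (k - l) := by
  rw [pt, pt]; push_cast [h]; ring

variable {p η ξ}

theorem pt_injective (hη : η ≠ 0) (n : Fin N) {k l : ℕ} (h : pt p η ξ n k = pt p η ξ n l) :
    k = l := by
  rw [pt, pt, add_right_inj] at h
  have := mul_right_cancel₀ hη h
  exact_mod_cast (sub_right_inj.1 this)

theorem SovCondition.pt_ne (hs : SovCondition p η ξ) (hη : η ≠ 0) {a b : Fin N} {h k : ℕ}
    (hh : h ≤ p a) (hk : k ≤ p b) (hne : a ≠ b ∨ h ≠ k) : pt p η ξ a h - pt p η ξ b k ≠ 0 := by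
  rw [sub_ne_zero]
  by_cases hab : a = b
  · subst hab
    intro e
    exact (hne.resolve_left (not_not.2 rfl)) (pt_injective hη _ e)
  · exact hs a b hab h hh k hk

theorem SovCondition.fa_ne (hs : SovCondition p η ξ) (hη : η ≠ 0) {n : Fin N} {k : ℕ}
    (hk : k < p n) : fa p η ξ (pt p η ξ n k) ≠ 0 := by
  rw [fa_eq]
  refine Finset.prod_ne_zero_iff.2 fun m _ => hs.pt_ne hη hk.le le_rfl ?_
  by_cases h : n = m
  · subst h; exact Or.inr hk.ne
  · exact Or.inl h

theorem SovCondition.fd_ne (hs : SovCondition p η ξ) (hη : η ≠ 0) {n : Fin N} {k : ℕ}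
    (hk : k ≤ p n) (hk0 : 1 ≤ k) : fd p η ξ (pt p η ξ n k) ≠ 0 := by
  rw [fd_eq]
  exact Finset.prod_ne_zero_iff.2 fun m _ => hs.pt_ne hη hk (Nat.zero_le _) (Or.inr (by omega))

variable (p η ξ) in
theorem fa_top (n : Fin N) : fa p η ξ (pt p η ξ n (p n)) = 0 := by
  rw [fa_eq]
  exact Finset.prod_eq_zero (Finset.mem_univ n) (sub_self _)

theorem SovCondition.normConst_ne (hs : SovCondition p η ξ) : normConst p η ξ ≠ 0 := by
  rw [normConst]
  refine Finset.prod_ne_zero_iff.2 fun a _ => Finset.prod_ne_zero_iff.2 fun b hb => ?_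
  rw [Ne, Complex.cpow_eq_zero_iff, not_and_or]
  left
  exact sub_ne_zero.2 (hs a b (Finset.mem_Iio.1 hb).ne' 0 (Nat.zero_le _) 0 (Nat.zero_le _))

end Generic

/-- The elements of a commuting family are the images of elements of a commutative algebra that
contains the inverses of its elements. -/
theorem exists_comm_lift {ι R : Type} [Ring R] [Algebra ℂ R] (F : ι → R)
    (h : ∀ i j, Commute (F i) (F j)) :
    ∃ (A : Type) (_ : CommRing A) (_ : Algebra ℂ A) (φ : A →ₐ[ℂ] R) (a : ι → A),
      (∀ i, φ (a i) = F i) ∧ ∀ x, IsUnit (φ x) → IsUnit x := by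
  -- The double centralizer is commutative because the family is, and an inverse of one of its
  -- elements commutes with whatever that element commutes with.
  let S : Subalgebra ℂ R := Subalgebra.centralizer ℂ (Set.centralizer (Set.range F))
  have hS : ∀ x ∈ S, ∀ y ∈ S, x * y = y * x := Set.centralizer_centralizer_comm_of_comm (by
    rintro _ ⟨i, rfl⟩ _ ⟨j, rfl⟩
    exact h i j)
  let _ : CommRing S :=
    { S.toRing with mul_comm := fun x y => Subtype.ext (hS x x.2 y y.2) }
  refine ⟨S, inferInstance, inferInstance, S.val,
    fun i => ⟨F i, Set.subset_centralizer_centralizer ⟨i, rfl⟩⟩, fun i => rfl, fun x hx => ?_⟩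
  obtain ⟨u, hu⟩ := hx
  have hu' : (u : R) = x := hu
  have hinv : (↑u⁻¹ : R) ∈ S := by
    rw [Subalgebra.mem_centralizer_iff]
    intro g hg
    have : Commute g (u : R) := by
      rw [hu']
      exact (Subalgebra.mem_centralizer_iff ℂ).1 x.2 g hg
    exact this.units_inv_right
  exact IsUnit.of_mul_eq_one ⟨_, hinv⟩ (Subtype.ext (by
    change (x : R) * ↑u⁻¹ = 1
    rw [← hu', Units.mul_inv]))

/-- Induction over labels by raising one component at a time. -/
theorem label_induction {N : ℕ} {P : (Fin N → ℕ) → Prop} (h0 : P 0)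
    (hs : ∀ g n, P g → P (Function.update g n (g n + 1))) (g : Fin N → ℕ) : P g := by
  obtain ⟨s, hs'⟩ : ∃ s, ∑ n, g n = s := ⟨_, rfl⟩
  induction s generalizing g with
  | zero =>
    have : g = 0 := funext fun n => (Finset.sum_eq_zero_iff.1 hs') n (Finset.mem_univ n)
    rwa [this]
  | succ s ih =>
    obtain ⟨n, hn⟩ : ∃ n, g n ≠ 0 := by
      by_contra hc
      push Not at hc
      simp [hc] at hs'
    have e := Finset.sum_update_of_mem (Finset.mem_univ n) g (g n - 1)
    have e' := Finset.add_sum_erase Finset.univ g (Finset.mem_univ n)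
    rw [Finset.sdiff_singleton_eq_erase] at e
    have := hs (Function.update g n (g n - 1)) n (ih _ (by omega))
    rwa [Function.update_self, Function.update_idem, Nat.sub_add_cancel (by omega),
      Function.update_eq_self] at this

/-! ### Eigencovectors of `B` and the ladder action of the transfer matrices. -/

section Sklyanin

variable {N : ℕ} (p : Fin N → ℕ) (η : ℂ) (ξ : Fin N → ℂ)

/-- Serves to fill in the one spectral value at which the relation in `eigen_shift` cannot be
divided. -/
theorem continuous_monodromy (K : Matrix (Fin 2) (Fin 2) ℂ) (i j : Fin 2) :
    Continuous fun x => monodromy p η ξ K x i j := by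
  have h1 : ∀ n i j, Continuous fun x => siteLax p η ξ n x i j := by
    intro n i j
    simp only [siteLax, Matrix.map_apply, lax_apply]
    refine continuous_matrix fun h h' => ?_
    simp only [siteOp_apply]
    by_cases hh : ∀ m, m ≠ n → h m = h' m
    · simp only [if_pos hh]
      simp only [Matrix.add_apply, Matrix.smul_apply]
      fun_prop
    · simp only [if_neg hh]
      exact continuous_const
  have h2 : ∀ (L : List (Fin N)) (i j), Continuous fun x =>
      (L.map fun n => siteLax p η ξ n x).prod i j := by
    intro L
    induction L with
    | nil => intro i j; exact continuous_const
    | cons n L ih =>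
      intro i j
      simp only [List.map_cons, List.prod_cons, Matrix.mul_apply]
      exact continuous_finsetSum _ fun c _ => (h1 n i c).mul (ih c j)
  simp only [monodromy_eq, Matrix.mul_apply]
  exact continuous_finsetSum _ fun c _ => continuous_const.mul (h2 _ c j)

/-- The product of the normalized operators `X (ξ_n^{(k)})`, `k < g n`. -/
noncomputable def raisingNat (X : ℂ → Op p) (k₁ : ℂ) (g : Fin N → ℕ) : Op p :=
  (List.ofFn fun n : Fin N =>
    ((List.range (g n)).map fun k =>
      (k₁ * fa p η ξ (pt p η ξ n k))⁻¹ • X (pt p η ξ n k)).prod).prod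

theorem raisingNat_zero (X : ℂ → Op p) (k₁ : ℂ) : raisingNat p η ξ X k₁ 0 = 1 := by
  rw [raisingNat]
  simp

/-- The factors commute, so the new one can be moved to the end; the rearrangement takes place in a
commutative lift of the family. -/
theorem raisingNat_succ {X : ℂ → Op p} (hX : ∀ x y, Commute (X x) (X y)) (k₁ : ℂ) (g : Fin N → ℕ)
    (n : Fin N) :
    raisingNat p η ξ X k₁ (Function.update g n (g n + 1)) =
      raisingNat p η ξ X k₁ g *
        ((k₁ * fa p η ξ (pt p η ξ n (g n)))⁻¹ • X (pt p η ξ n (g n))) := by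
  obtain ⟨A, _, _, φ, a, ha, -⟩ := exists_comm_lift X hX
  have key : ∀ g, raisingNat p η ξ X k₁ g = φ (∏ n, ∏ k ∈ Finset.range (g n),
      (k₁ * fa p η ξ (pt p η ξ n k))⁻¹ • a (pt p η ξ n k)) := by
    intro g
    rw [raisingNat, ← List.prod_ofFn, map_list_prod, List.map_ofFn]
    congr 2
    funext n
    rw [Function.comp_apply, ← List.toFinset_range, List.prod_toFinset _ List.nodup_range,
      map_list_prod, List.map_map]
    simp [Function.comp_def, ha]
  rw [key, key, ← ha, ← map_smul, ← map_mul]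
  congr 1
  rw [← Finset.mul_prod_erase _ _ (Finset.mem_univ n),
    ← Finset.mul_prod_erase _ (fun n => ∏ k ∈ Finset.range (g n), _) (Finset.mem_univ n),
    Function.update_self, Finset.prod_range_succ]
  rw [Finset.prod_congr rfl (g := fun m => ∏ k ∈ Finset.range (g m),
      (k₁ * fa p η ξ (pt p η ξ m k))⁻¹ • a (pt p η ξ m k))
      (fun m hm => by rw [Function.update_of_ne (Finset.ne_of_mem_erase hm)])]
  ring

/-- The covectors `⟨g|` without the common normalization. -/
noncomputable def skVec (K : Matrix (Fin 2) (Fin 2) ℂ) (k₁ : ℂ) (g : Fin N → ℕ) : Covector p :=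
  refCovector p ᵥ* raisingNat p η ξ (opA p η ξ K) k₁ g

/-- The eigenvalue of `B(x)` on `⟨g|`. -/
noncomputable def bEig (b : ℂ) (g : Fin N → ℕ) (x : ℂ) : ℂ := b * ∏ n, (x - pt p η ξ n (g n))

variable {p η ξ}

/-- The exchange relation of `B(x)` with `A(y)` has an unwanted term with `B(y)`, which vanishes
since `y` is a zero of the eigenvalue. The remaining coefficients multiply the eigenvalue by `(x - y
+ η) / (x - y)`, and the zero moves from `y` to `y - η`. -/
theorem eigen_shift (hη : η ≠ 0) {K : Matrix (Fin 2) (Fin 2) ℂ} {b : ℂ} {g : Fin N → ℕ}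
    {v : Covector p} (hv : ∀ x, v ᵥ* opB p η ξ K x = bEig p η ξ b g x • v) (n : Fin N) (x : ℂ) :
    (v ᵥ* opA p η ξ K (pt p η ξ n (g n))) ᵥ* opB p η ξ K x =
      bEig p η ξ b (Function.update g n (g n + 1)) x • (v ᵥ* opA p η ξ K (pt p η ξ n (g n))) := by
  set y := pt p η ξ n (g n) with hy
  set β : ℂ → ℂ := fun x => b * ∏ m ∈ Finset.univ.erase n, (x - pt p η ξ m (g m)) with hβ
  have e1 : ∀ x, bEig p η ξ b g x = (x - y) * β x := by
    intro x
    rw [bEig, ← Finset.mul_prod_erase _ _ (Finset.mem_univ n)]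
    ring
  have e2 : ∀ x, bEig p η ξ b (Function.update g n (g n + 1)) x = (x - y + η) * β x := by
    intro x
    rw [bEig, ← Finset.mul_prod_erase _ _ (Finset.mem_univ n), Function.update_self, ← pt_sub,
      Finset.prod_congr rfl (g := fun m => x - pt p η ξ m (g m))
      (fun m hm => by rw [Function.update_of_ne (Finset.ne_of_mem_erase hm)])]
    simp only [hβ]
    ring
  have hy0 : v ᵥ* opB p η ξ K y = 0 := by rw [hv, e1, sub_self, zero_mul, zero_smul]
  have hc : ∀ i j, Continuous fun x => monodromy p η ξ K x i j := continuous_monodromy p η ξ K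
  have hcont : Continuous fun x => (v ᵥ* opA p η ξ K y) ᵥ* opB p η ξ K x :=
    Continuous.matrix_vecMul continuous_const (hc 0 1)
  have hcont2 : Continuous fun x => bEig p η ξ b (Function.update g n (g n + 1)) x •
      (v ᵥ* opA p η ξ K y) := by
    unfold bEig
    fun_prop
  -- Division by `x - y` is possible only off `y`; both sides are continuous, so the identity
  -- extends.
  refine congrFun (hcont.ext_on (dense_compl_singleton y) hcont2 fun x hx => ?_) x
  have hx' : x - y ≠ 0 := sub_ne_zero.2 hx
  have hr := (monodromy_isYangian p η ξ hη K).rtt x y 0 1 0 0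
  have hr' := congrArg (v ᵥ* ·) hr
  simp only [Matrix.vecMul_add, Matrix.vecMul_smul, ← Matrix.vecMul_vecMul] at hr'
  change (x - y) • v ᵥ* opB p η ξ K x ᵥ* opA p η ξ K y + η • v ᵥ* opB p η ξ K x ᵥ* opA p η ξ K y =
    (x - y) • v ᵥ* opA p η ξ K y ᵥ* opB p η ξ K x + η • v ᵥ* opB p η ξ K y ᵥ* opA p η ξ K x at hr'
  rw [hy0, Matrix.zero_vecMul, smul_zero, add_zero, ← add_smul, hv, Matrix.smul_vecMul, e1] at hr'
  refine smul_right_injective _ hx' ?_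
  simp only
  rw [← hr', e2, smul_smul, smul_smul]
  congr 1
  ring

variable {K : Matrix (Fin 2) (Fin 2) ℂ} {k₁ k₂ : ℂ}

theorem opA_comm (hη : η ≠ 0) (x y : ℂ) : Commute (opA p η ξ K x) (opA p η ξ K y) :=
  (monodromy_isYangian p η ξ hη K).diag_comm hη x y 0

theorem skVec_succ (hη : η ≠ 0) (g : Fin N → ℕ) (n : Fin N) :
    skVec p η ξ K k₁ (Function.update g n (g n + 1)) =
      (k₁ * fa p η ξ (pt p η ξ n (g n)))⁻¹ •
        (skVec p η ξ K k₁ g ᵥ* opA p η ξ K (pt p η ξ n (g n))) := by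
  rw [skVec, raisingNat_succ p η ξ (opA_comm hη), ← Matrix.vecMul_vecMul, Matrix.vecMul_smul, skVec]

theorem skVec_opB (hη : η ≠ 0) (g : Fin N → ℕ) (x : ℂ) :
    skVec p η ξ K k₁ g ᵥ* opB p η ξ K x = bEig p η ξ (K 0 1) g x • skVec p η ξ K k₁ g := by
  induction g using label_induction generalizing x with
  | h0 =>
    rw [skVec, raisingNat_zero, Matrix.vecMul_one, refCovector_opB, fd_eq, bEig]
    rfl
  | hs g n ih =>
    rw [skVec_succ hη, Matrix.smul_vecMul, eigen_shift hη ih, smul_comm]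

/-- At a zero of the `B`-eigenvalue the quantum determinant loses its off-diagonal term and becomes
`A` followed by `D`. -/
theorem skVec_opA_opD (hη : η ≠ 0) (hK : K.det = k₁ * k₂) (g : Fin N → ℕ) (n : Fin N) :
    skVec p η ξ K k₁ g ᵥ* opA p η ξ K (pt p η ξ n (g n)) ᵥ*
        monodromy p η ξ K (pt p η ξ n (g n + 1)) 1 1 =
      (k₁ * k₂ * (fa p η ξ (pt p η ξ n (g n)) * fd p η ξ (pt p η ξ n (g n + 1)))) •
        skVec p η ξ K k₁ g := by
  have h := (monodromy_isYangian p η ξ hη K).qdet (pt p η ξ n (g n))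
  rw [hK, pt_sub, Algebra.algebraMap_eq_smul_one] at h
  have h' := congrArg (skVec p η ξ K k₁ g ᵥ* ·) h
  simp only [Matrix.vecMul_sub, Matrix.vecMul_smul, Matrix.vecMul_one, ← Matrix.vecMul_vecMul] at h'
  have h0 : skVec p η ξ K k₁ g ᵥ* monodromy p η ξ K (pt p η ξ n (g n)) 0 1 = 0 := by
    refine (skVec_opB hη g _).trans ?_
    rw [bEig, Finset.prod_eq_zero (Finset.mem_univ n) (sub_self _), mul_zero, zero_smul]
  rw [h0, Matrix.zero_vecMul, sub_zero] at h'
  exact h'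

theorem skVec_opD (hη : η ≠ 0) (hK : IsRegularTwist K k₁ k₂) (hs : SovCondition p η ξ)
    (g : Fin N → ℕ) (n : Fin N) (hg : g n < p n) :
    skVec p η ξ K k₁ (Function.update g n (g n + 1)) ᵥ*
        monodromy p η ξ K (pt p η ξ n (g n + 1)) 1 1 =
      (k₂ * fd p η ξ (pt p η ξ n (g n + 1))) • skVec p η ξ K k₁ g := by
  rw [skVec_succ hη, Matrix.smul_vecMul, skVec_opA_opD hη hK.det_eq, smul_smul]
  congr 1
  have := hK.2.2.1
  have := hs.fa_ne hη hg
  field_simp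

theorem refCovector_ne_zero : refCovector p ≠ 0 := by
  intro h
  have := congrFun h (fun _ => 0)
  simp [refCovector] at this

/-- If a raised covector were zero, `D` would send it to a nonzero multiple of the previous one,
which would then be zero as well. -/
theorem skVec_ne_zero (hη : η ≠ 0) (hK : IsRegularTwist K k₁ k₂) (hs : SovCondition p η ξ)
    (g : Fin N → ℕ) (hg : ∀ n, g n ≤ p n) : skVec p η ξ K k₁ g ≠ 0 := by
  induction g using label_induction with
  | h0 => rw [skVec, raisingNat_zero, Matrix.vecMul_one]; exact refCovector_ne_zero
  | hs g n ih =>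
    have hn : g n < p n := by
      have := hg n
      rwa [Function.update_self] at this
    have hg' : ∀ m, g m ≤ p m := by
      intro m
      by_cases hm : m = n
      · subst hm; exact hn.le
      · simpa [hm] using hg m
    intro h0
    have h := skVec_opD hη hK hs g n hn
    rw [h0, Matrix.zero_vecMul, eq_comm, smul_eq_zero] at h
    refine h.elim (fun h => ?_) (ih hg')
    exact mul_ne_zero hK.2.2.2 (hs.fd_ne hη hn (by omega)) h

/-- Evaluation at the zero of the second label on the site `n` separates the two. The first label is
not bounded at `n` itself, so that it may run past the end of the string; this case is used in
`eq_zero_of_eigen`. -/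
theorem bEig_ne (hη : η ≠ 0) (hs : SovCondition p η ξ) {b : ℂ} (hb : b ≠ 0) {g g' : Fin N → ℕ}
    {n : Fin N} (hg : ∀ m, m ≠ n → g m ≤ p m) (hg' : g' n ≤ p n) (hne : g n ≠ g' n) :
    bEig p η ξ b g' (pt p η ξ n (g' n)) = 0 ∧ bEig p η ξ b g (pt p η ξ n (g' n)) ≠ 0 := by
  constructor
  · rw [bEig, Finset.prod_eq_zero (Finset.mem_univ n) (sub_self _), mul_zero]
  · rw [bEig]
    refine mul_ne_zero hb (Finset.prod_ne_zero_iff.2 fun m _ => ?_)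
    by_cases hm : m = n
    · subst hm
      exact sub_ne_zero.2 fun h => hne (pt_injective hη _ h).symm
    · exact hs.pt_ne hη hg' (hg m hm) (Or.inl (Ne.symm hm))

theorem bEig_injective (hη : η ≠ 0) (hs : SovCondition p η ξ) {b : ℂ} (hb : b ≠ 0) :
    Function.Injective fun (h : Idx p) (x : ℂ) => b * ∏ n, (x - pt p η ξ n (h n)) := by
  intro h h' he
  by_contra hne
  obtain ⟨n, hn⟩ := Function.ne_iff.1 hne
  have := bEig_ne (g := fun n => (h n : ℕ)) (g' := fun n => (h' n : ℕ)) (n := n) hη hs hb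
    (fun m _ => Nat.lt_succ_iff.1 (h m).2) (Nat.lt_succ_iff.1 (h' n).2)
    (fun e => hn (Fin.ext e))
  refine this.2 ?_
  rw [← this.1]
  exact congrFun he _

/-- The function `bEig` as a polynomial. -/
theorem exists_separating_point (hη : η ≠ 0) (hs : SovCondition p η ξ) {b : ℂ} (hb : b ≠ 0) :
    ∃ x, Function.Injective fun h : Idx p => bEig p η ξ b (fun n => (h n : ℕ)) x := by
  let P : Idx p → Polynomial ℂ := fun h =>
    Polynomial.C b * ∏ n, (Polynomial.X - Polynomial.C (pt p η ξ n (h n)))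
  have hP : ∀ h x, (P h).eval x = bEig p η ξ b (fun n => (h n : ℕ)) x := by
    intro h x
    simp [P, bEig, Polynomial.eval_prod]
  -- The product of all differences of eigenvalues is a nonzero polynomial; any point where it does
  -- not vanish separates all labels at once.
  let Q : Polynomial ℂ := ∏ h : Idx p, ∏ h' ∈ Finset.univ.erase h, (P h - P h')
  have hQ : Q ≠ 0 := by
    refine Finset.prod_ne_zero_iff.2 fun h _ => Finset.prod_ne_zero_iff.2 fun h' hh' => ?_
    rw [sub_ne_zero]
    intro e
    refine (Finset.ne_of_mem_erase hh').symm (bEig_injective hη hs hb (funext fun x => ?_))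
    have := congrArg (Polynomial.eval x) e
    rwa [hP, hP] at this
  obtain ⟨x, hx⟩ : ∃ x, Q.eval x ≠ 0 := by
    by_contra hc
    push Not at hc
    exact hQ (Polynomial.funext fun x => by simp [hc x])
  refine ⟨x, fun h h' e => ?_⟩
  by_contra hne
  refine hx ?_
  simp only [Q, Polynomial.eval_prod]
  refine Finset.prod_eq_zero (Finset.mem_univ h) (Finset.prod_eq_zero
    (Finset.mem_erase.2 ⟨Ne.symm hne, Finset.mem_univ h'⟩) ?_)
  rw [Polynomial.eval_sub, hP, hP]
  exact sub_eq_zero.2 e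

theorem linearIndependent_of_eigen (hη : η ≠ 0) (hs : SovCondition p η ξ) {b : ℂ} (hb : b ≠ 0)
    {B : ℂ → Op p} {v : Idx p → Covector p} (hv0 : ∀ h, v h ≠ 0)
    (hv : ∀ h x, v h ᵥ* B x = bEig p η ξ b (fun n => (h n : ℕ)) x • v h) :
    LinearIndependent ℂ v := by
  obtain ⟨x, hx⟩ := exists_separating_point hη hs hb
  refine Module.End.eigenvectors_linearIndependent' (Matrix.vecMulLinear (B x)) _ hx v fun h => ?_
  refine ⟨Module.End.mem_eigenspace_iff.2 ?_, hv0 h⟩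
  exact hv h x

theorem isSovEigenbasis_of_eigen (hη : η ≠ 0) (hs : SovCondition p η ξ) {b : ℂ} (hb : b ≠ 0)
    {B : ℂ → Op p} {v : Idx p → Covector p} (hv0 : ∀ h, v h ≠ 0)
    (hv : ∀ h x, v h ᵥ* B x = bEig p η ξ b (fun n => (h n : ℕ)) x • v h) :
    IsSovEigenbasis p η ξ v B b := by
  have hl := linearIndependent_of_eigen hη hs hb hv0 hv
  refine ⟨hl, ?_, hv, bEig_injective hη hs hb⟩
  exact hl.span_eq_top_of_card_eq_finrank' (by simp)

/-- A label past the end of a string gives an eigenvalue outside the spectrum. In the expansion of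
the covector in the eigenbasis, each coefficient is killed by evaluating at a zero of the
corresponding basis eigenvalue. -/
theorem eq_zero_of_eigen (hη : η ≠ 0) (hs : SovCondition p η ξ) {b : ℂ} (hb : b ≠ 0)
    {B : ℂ → Op p} {v : Idx p → Covector p} (hB : IsSovEigenbasis p η ξ v B b) {w : Covector p}
    {g : Fin N → ℕ} {n : Fin N} (hg : ∀ m, m ≠ n → g m ≤ p m) (hgn : p n < g n)
    (hw : ∀ x, w ᵥ* B x = bEig p η ξ b g x • w) : w = 0 := by
  let bas := Module.Basis.mk hB.1 hB.2.1.ge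
  have hbas : ∀ h, bas h = v h := fun h => Module.Basis.mk_apply _ _ _
  have hrep := bas.sum_repr w
  have h1 : ∀ h, bas.repr w h = 0 := by
    intro h
    obtain ⟨e0, e1⟩ := bEig_ne (g := g) (g' := fun n => (h n : ℕ)) (n := n) hη hs hb hg
      (Nat.lt_succ_iff.1 (h n).2) (by have := (h n).2; omega)
    set x := pt p η ξ n (h n)
    have e2 : bas.repr (w ᵥ* B x) h = bEig p η ξ b (fun n => (h n : ℕ)) x * bas.repr w h := by
      conv_lhs => rw [← hrep]
      rw [Matrix.sum_vecMul, map_sum, Finsupp.finsetSum_apply, Finset.sum_eq_single h]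
      · rw [Matrix.smul_vecMul, hbas, hB.2.2.1, map_smul, map_smul, ← hbas, bas.repr_self]
        simp [bEig, mul_comm]
      · intro h' _ hne
        rw [Matrix.smul_vecMul, hbas, hB.2.2.1, map_smul, map_smul, ← hbas, bas.repr_self]
        simp [hne]
      · simp
    rw [hw, map_smul, Finsupp.smul_apply, smul_eq_mul, e0, zero_mul] at e2
    exact (mul_eq_zero.1 e2).resolve_left e1
  rw [← hrep]
  simp [h1]

theorem skVec_isSovEigenbasis (hη : η ≠ 0) (hK : IsRegularTwist K k₁ k₂) (hs : SovCondition p η ξ)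
    (hb : K 0 1 ≠ 0) :
    IsSovEigenbasis p η ξ (fun h : Idx p => skVec p η ξ K k₁ fun n => (h n : ℕ)) (opB p η ξ K)
      (K 0 1) :=
  isSovEigenbasis_of_eigen hη hs hb
    (fun h => skVec_ne_zero hη hK hs _ fun n => Nat.lt_succ_iff.1 (h n).2)
    (fun _ x => skVec_opB hη _ x)

/-- Inside a string this is the definition read backwards. At the end both sides vanish: the left
one would carry a label past the end, and on the right `fa` is zero. -/
theorem skVec_opA (hη : η ≠ 0) (hK : IsRegularTwist K k₁ k₂) (hs : SovCondition p η ξ)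
    (hb : K 0 1 ≠ 0) (g : Fin N → ℕ) (hg : ∀ n, g n ≤ p n) (n : Fin N) :
    skVec p η ξ K k₁ g ᵥ* opA p η ξ K (pt p η ξ n (g n)) =
      (k₁ * fa p η ξ (pt p η ξ n (g n))) •
        skVec p η ξ K k₁ (Function.update g n (g n + 1)) := by
  rcases (hg n).eq_or_lt with hn | hn
  · rw [hn, fa_top, mul_zero, zero_smul, ← hn]
    refine eq_zero_of_eigen hη hs hb (skVec_isSovEigenbasis hη hK hs hb)
      (g := Function.update g n (g n + 1)) (n := n) (fun m hm => ?_) ?_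
      (eigen_shift hη (skVec_opB hη g) n)
    · simpa [hm] using hg m
    · simp [hn]
  · rw [skVec_succ hη, smul_inv_smul₀ (mul_ne_zero hK.2.2.1 (hs.fa_ne hη hn))]

/-- At the point marked by the label, `A` raises and `D` lowers it: the discrete form of Baxter's
equation on covectors. -/
theorem skVec_transfer (hη : η ≠ 0) (hK : IsRegularTwist K k₁ k₂) (hs : SovCondition p η ξ)
    (hb : K 0 1 ≠ 0) (g : Fin N → ℕ) (hg : ∀ n, g n ≤ p n) (n : Fin N) {k : ℕ} (hk : g n = k + 1) :
    skVec p η ξ K k₁ g ᵥ* transfer p η ξ K (pt p η ξ n (k + 1)) =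
      (k₁ * fa p η ξ (pt p η ξ n (k + 1))) • skVec p η ξ K k₁ (Function.update g n (k + 2)) +
      (k₂ * fd p η ξ (pt p η ξ n (k + 1))) • skVec p η ξ K k₁ (Function.update g n k) := by
  have hA := skVec_opA hη hK hs hb g hg n
  have hD := skVec_opD hη hK hs (Function.update g n k) n (by
    rw [Function.update_self]; have := hg n; omega)
  rw [Function.update_self, Function.update_idem, ← hk, Function.update_eq_self] at hD
  rw [opA, hk] at hA
  rw [hk] at hD
  rw [transfer, Matrix.trace_fin_two, Matrix.vecMul_add, hD, hA]

theorem fusedTransfer_comm_transfer (hη : η ≠ 0) (l : ℕ) (x y : ℂ) :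
    Commute (fusedTransfer p η ξ K l x) (transfer p η ξ K y) := by
  induction l using Nat.twoStepInduction with
  | zero => rw [fusedTransfer_zero p η ξ hη]; exact Commute.one_left _
  | one => rw [fusedTransfer_one p η ξ hη]; exact transfer_comm p η ξ hη K _ _
  | more l h0 h1 =>
    rw [fusedTransfer_succ_succ p η ξ hη]
    exact ((transfer_comm p η ξ hη K _ _).mul_left h1).sub_left (h0.smul_left _)

/-- The denominator of `qVal`. -/
noncomputable def qDen (p : Fin N → ℕ) (η : ℂ) (ξ : Fin N → ℂ) (k₂ : ℂ) (n : Fin N) (l : ℕ) : ℂ :=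
  k₂ ^ l * ∏ k ∈ Finset.range l, fd p η ξ (pt p η ξ n (p n - k))

theorem qDen_succ (k₂ : ℂ) (n : Fin N) (l : ℕ) :
    qDen p η ξ k₂ n (l + 1) = qDen p η ξ k₂ n l * (k₂ * fd p η ξ (pt p η ξ n (p n - l))) := by
  rw [qDen, qDen, Finset.prod_range_succ]
  ring

theorem SovCondition.qDen_ne (hs : SovCondition p η ξ) (hη : η ≠ 0) (hk : k₂ ≠ 0) {n : Fin N}
    {l : ℕ} (hl : l ≤ p n) : qDen p η ξ k₂ n l ≠ 0 := by
  refine mul_ne_zero (pow_ne_zero _ hk) (Finset.prod_ne_zero_iff.2 fun k hk => ?_)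
  rw [Finset.mem_range] at hk
  exact hs.fd_ne hη (Nat.sub_le _ _) (by omega)

/-- The first step only lowers, since `fa` vanishes at the end of the string. Afterwards the quantum
determinant term of the fusion relation cancels the raising term of the transfer matrix exactly. -/
theorem skVec_fusedTransfer (hη : η ≠ 0) (hK : IsRegularTwist K k₁ k₂) (hs : SovCondition p η ξ)
    (hb : K 0 1 ≠ 0) (g : Fin N → ℕ) (hg : ∀ n, g n ≤ p n) (n : Fin N) (hn : g n = p n) (l : ℕ)
    (hl : l ≤ p n) :
    skVec p η ξ K k₁ g ᵥ* fusedTransfer p η ξ K l (pt p η ξ n (p n)) =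
      qDen p η ξ k₂ n l • skVec p η ξ K k₁ (Function.update g n (p n - l)) := by
  induction l using Nat.twoStepInduction with
  | zero =>
    rw [fusedTransfer_zero p η ξ hη, Matrix.vecMul_one, Nat.sub_zero, ← hn,
      Function.update_eq_self]
    simp [qDen]
  | one =>
    rw [fusedTransfer_one p η ξ hη]
    have h := skVec_transfer hη hK hs hb g hg n (k := p n - 1) (by omega)
    rw [Nat.sub_add_cancel hl, fa_top, mul_zero, zero_smul, zero_add] at h
    rw [h]
    simp [qDen]
  | more l h0 h1 =>
    have hg' : ∀ m, Function.update g n (p n - (l + 1)) m ≤ p m := by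
      intro m
      by_cases hm : m = n
      · subst hm; simp
      · simpa [hm] using hg m
    have h := skVec_transfer hη hK hs hb _ hg' n (k := p n - (l + 2))
      (by rw [Function.update_self]; omega)
    rw [Function.update_idem, Function.update_idem, show p n - (l + 2) + 1 = p n - (l + 1) by omega,
      show p n - (l + 2) + 2 = p n - l by omega] at h
    -- The fused factor is made to act first, so that the transfer matrix meets a covector whose
    -- label marks its spectral point.
    rw [fusedTransfer_succ_succ p η ξ hη, ← (fusedTransfer_comm_transfer hη _ _ _).eq,
      Matrix.vecMul_sub, ← Matrix.vecMul_vecMul, h1 (by omega), Matrix.vecMul_smul, h0 (by omega),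
      pt_add _ _ _ _ (by omega), pt_add _ _ _ _ (by omega), Matrix.smul_vecMul, h, hK.det_eq,
      qDen_succ k₂ n (l + 1), qDen_succ k₂ n l]
    module

theorem skVec_qVal (hη : η ≠ 0) (hK : IsRegularTwist K k₁ k₂) (hs : SovCondition p η ξ)
    (hb : K 0 1 ≠ 0) (g : Fin N → ℕ) (hg : ∀ n, g n ≤ p n) (n : Fin N) (hn : g n = p n) (h : ℕ)
    (hh : h ≤ p n) :
    skVec p η ξ K k₁ g ᵥ* qVal p η ξ K k₂ n h =
      skVec p η ξ K k₁ (Function.update g n h) := by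
  rw [qVal, Matrix.vecMul_smul, skVec_fusedTransfer hη hK hs hb g hg n hn _ (Nat.sub_le _ _),
    Nat.sub_sub_self hh]
  exact inv_smul_smul₀ (hs.qDen_ne hη hK.2.2.2 (Nat.sub_le _ _)) _

/-- Each factor changes its own site only, so the sites still to come in the list remain at the ends
of their strings. -/
theorem skVec_qVal_prod (hη : η ≠ 0) (hK : IsRegularTwist K k₁ k₂) (hs : SovCondition p η ξ)
    (hb : K 0 1 ≠ 0) (h : Idx p) (L : List (Fin N)) (hL : L.Nodup) (g : Fin N → ℕ)
    (hg : ∀ n, g n ≤ p n) (hgL : ∀ n ∈ L, g n = p n) :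
    skVec p η ξ K k₁ g ᵥ* (L.map fun n => qVal p η ξ K k₂ n (h n)).prod =
      skVec p η ξ K k₁ fun n => if n ∈ L then (h n : ℕ) else g n := by
  induction L generalizing g with
  | nil => simp
  | cons n L ih =>
    rw [List.nodup_cons] at hL
    rw [List.map_cons, List.prod_cons, ← Matrix.vecMul_vecMul,
      skVec_qVal hη hK hs hb g hg n (hgL n (by simp)) _ (Nat.lt_succ_iff.1 (h n).2), ih hL.2]
    · congr 1
      funext m
      by_cases hm : m = n
      · subst hm; simp [hL.1]
      · simp [hm]
    · intro m
      by_cases hm : m = n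
      · subst hm; simp [Nat.lt_succ_iff.1 (h m).2]
      · simpa [hm] using hg m
    · intro m hm
      have : m ≠ n := by rintro rfl; exact hL.1 hm
      simpa [this] using hgL m (by simp [hm])

theorem skCovector_eq (K : Matrix (Fin 2) (Fin 2) ℂ) (k₁ : ℂ) (h : Idx p) :
    skCovector p η ξ K k₁ h = (normConst p η ξ)⁻¹ • skVec p η ξ K k₁ fun n => (h n : ℕ) := rfl

theorem skCovector_top_qVal (hη : η ≠ 0) (hK : IsRegularTwist K k₁ k₂) (hs : SovCondition p η ξ)
    (hb : K 0 1 ≠ 0) (h : Idx p) :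
    skCovector p η ξ K k₁ (topIdx p) ᵥ*
        (List.ofFn fun n : Fin N => qVal p η ξ K k₂ n (h n)).prod =
      skCovector p η ξ K k₁ h := by
  have := skVec_qVal_prod hη hK hs hb h (List.finRange N) (List.nodup_finRange N)
    (fun n => (topIdx p n : ℕ)) (fun n => by simp [topIdx]) (fun n _ => by simp [topIdx])
  rw [skCovector_eq, skCovector_eq, Matrix.smul_vecMul, List.ofFn_eq_map, this]
  simp

theorem skCovector_isSovEigenbasis (hη : η ≠ 0) (hK : IsRegularTwist K k₁ k₂)
    (hs : SovCondition p η ξ) (hb : K 0 1 ≠ 0) :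
    IsSovEigenbasis p η ξ (skCovector p η ξ K k₁) (opB p η ξ K) (K 0 1) := by
  refine isSovEigenbasis_of_eigen hη hs hb (fun h => ?_) (fun h x => ?_)
  · exact smul_ne_zero (inv_ne_zero hs.normConst_ne)
      (skVec_ne_zero hη hK hs _ fun n => Nat.lt_succ_iff.1 (h n).2)
  · rw [skCovector_eq, Matrix.smul_vecMul, skVec_opB hη, smul_comm]

end Sklyanin
end HigherSpin

namespace HigherSpin

/-! ### Cramer's rule and rank-one perturbations. -/

section RankOne

variable {N : ℕ} {A : Type*} [CommRing A]

theorem mulVec_cramer_div {C : Matrix (Fin N) (Fin N) A} {u : Fin N → A} {e : A}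
    (he : C.det * e = 1) : (C *ᵥ fun b => C.cramer u b * e) = u := by
  have : (fun b => C.cramer u b * e) = e • C.cramer u := by
    funext b; simp [mul_comm]
  rw [this, Matrix.mulVec_smul, Matrix.mulVec_cramer, smul_smul, mul_comm e, he, one_smul]

/-- The matrix determinant lemma, with the adjugate applied to `u` written as Cramer's vector. -/
theorem det_add_rankOne {C : Matrix (Fin N) (Fin N) A} (hC : IsUnit C.det) (u v : Fin N → A) :
    (C + Matrix.of fun a b => u a * v b).det = C.det + ∑ b, v b * C.cramer u b := by
  have e : (Matrix.of fun a b => u a * v b) =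
      Matrix.replicateCol Unit u * Matrix.replicateRow Unit v := by
    ext a b
    simp [Matrix.mul_apply]
  rw [e, Matrix.det_add_replicateCol_mul_replicateRow hC, Matrix.det_unique (n := Unit), Matrix.add_apply,
    mul_add, Matrix.one_apply_eq, mul_one, add_right_inj, ← Matrix.det_smul_inv_mulVec_eq_cramer _ _ hC,
    Matrix.mul_assoc, Matrix.mul_apply, Finset.mul_sum]
  refine Finset.sum_congr rfl fun b _ => ?_
  simp only [Matrix.replicateRow_apply, Pi.smul_apply, smul_eq_mul, Matrix.mul_apply,
    Matrix.replicateCol_apply, Matrix.mulVec, dotProduct]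
  ring

end RankOne

/-! ### Interpolation along the strings over a commutative algebra. -/

section Interpolation

variable {N : ℕ} (p : Fin N → ℕ) (η : ℂ) (ξ : Fin N → ℂ) (ζ : ℂ)
variable {A : Type*} [CommRing A] [Algebra ℂ A] (q : Fin N → ℕ → A)

/-- The coefficients of the interpolation formula for values in a commutative algebra. -/
noncomputable def interp (b : Fin N) (x : ℂ) : A :=
  ∑ h ∈ Finset.Icc 1 (p b),
    ((x - ζ) / (pt p η ξ b h - ζ) *
      (nodeProdErase p η ξ b h x / nodeProdErase p η ξ b h (pt p η ξ b h))) • q b h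

/-- The matrix of the linear system for the values at the last points of the strings. -/
noncomputable def interpMat : Matrix (Fin N) (Fin N) A :=
  Matrix.of fun a b =>
    (if a = b then -q a 0 else 0) + interp p η ξ ζ q b (pt p η ξ a 0)

variable (A) in
/-- The right-hand side of the linear system. -/
noncomputable def interpRhs (a : Fin N) : A :=
  -((nodeProd p η ξ (pt p η ξ a 0) / nodeProd p η ξ ζ) • (1 : A))

/-- The interpolation formula with the values `d b` at the last points of the strings. -/
noncomputable def interpQ (d : Fin N → A) (x : ℂ) : A :=
  (∑ b, interp p η ξ ζ q b x * d b) + (nodeProd p η ξ x / nodeProd p η ξ ζ) • (1 : A)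

/-- The matrix of the determinant formula. -/
noncomputable def interpDelta (x : ℂ) : Matrix (Fin N) (Fin N) A :=
  Matrix.of fun a b =>
    ∑ h ∈ Finset.Icc 1 (p b),
      ((x - ζ) / (pt p η ξ b h - x) *
        (nodeProd p η ξ (pt p η ξ a 0) /
          ((pt p η ξ b h - ζ) * nodeProdErase p η ξ b h (pt p η ξ b h)))) • q b h

variable {p η ξ ζ}

theorem nodeProdErase_eq_zero {a b : Fin N} {h k : ℕ} (hk1 : 1 ≤ k) (hk : k ≤ p a)
    (hne : ¬(a = b ∧ k = h)) : nodeProdErase p η ξ b h (pt p η ξ a k) = 0 := by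
  rw [nodeProdErase]
  refine Finset.prod_eq_zero (Finset.mem_univ a) (Finset.prod_eq_zero
    (Finset.mem_Icc.2 ⟨hk1, hk⟩) ?_)
  rw [if_neg hne, sub_self]

theorem nodeProd_eq_zero {a : Fin N} {k : ℕ} (hk1 : 1 ≤ k) (hk : k ≤ p a) :
    nodeProd p η ξ (pt p η ξ a k) = 0 :=
  Finset.prod_eq_zero (Finset.mem_univ a) (Finset.prod_eq_zero
    (Finset.mem_Icc.2 ⟨hk1, hk⟩) (sub_self _))

theorem nodeProd_ne_zero {x : ℂ} (hx : ∀ n, ∀ k, 1 ≤ k → k ≤ p n → x ≠ pt p η ξ n k) :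
    nodeProd p η ξ x ≠ 0 :=
  Finset.prod_ne_zero_iff.2 fun n _ => Finset.prod_ne_zero_iff.2 fun k hk =>
    sub_ne_zero.2 (hx n k (Finset.mem_Icc.1 hk).1 (Finset.mem_Icc.1 hk).2)

theorem SovCondition.nodeProdErase_ne (hs : SovCondition p η ξ) (hη : η ≠ 0) {b : Fin N} {h : ℕ}
    (hh : h ≤ p b) : nodeProdErase p η ξ b h (pt p η ξ b h) ≠ 0 := by
  refine Finset.prod_ne_zero_iff.2 fun n _ => Finset.prod_ne_zero_iff.2 fun k hk => ?_
  split_ifs with h0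
  · exact one_ne_zero
  · refine hs.pt_ne hη hh (Finset.mem_Icc.1 hk).2 ?_
    rw [not_and_or] at h0
    exact h0.imp Ne.symm Ne.symm

theorem nodeProd_eq_mul {b : Fin N} {h : ℕ} (h1 : 1 ≤ h) (hh : h ≤ p b) (x : ℂ) :
    nodeProd p η ξ x = (x - pt p η ξ b h) * nodeProdErase p η ξ b h x := by
  rw [nodeProd, nodeProdErase, ← Finset.mul_prod_erase _ _ (Finset.mem_univ b),
    ← Finset.mul_prod_erase (a := b) _ _ (Finset.mem_univ b),
    ← Finset.mul_prod_erase _ _ (Finset.mem_Icc.2 ⟨h1, hh⟩),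
    ← Finset.mul_prod_erase (a := h) _ (fun k => if b = b ∧ k = h then _ else _)
      (Finset.mem_Icc.2 ⟨h1, hh⟩), if_pos ⟨rfl, rfl⟩, one_mul, mul_assoc]
  congr 2
  · refine Finset.prod_congr rfl fun k hk => ?_
    rw [if_neg fun h0 => Finset.ne_of_mem_erase hk h0.2]
  · refine Finset.prod_congr rfl fun c hc => Finset.prod_congr rfl fun k hk => ?_
    rw [if_neg fun h0 => Finset.ne_of_mem_erase hc h0.1]

theorem interp_node (hη : η ≠ 0) (hs : SovCondition p η ξ)
    (hζ : ∀ n, ∀ k, 1 ≤ k → k ≤ p n → ζ ≠ pt p η ξ n k) (b : Fin N) {a : Fin N} {h : ℕ}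
    (h1 : 1 ≤ h) (hh : h ≤ p a) :
    interp p η ξ ζ q b (pt p η ξ a h) = if b = a then q b h else 0 := by
  rw [interp]
  split_ifs with hb
  · subst hb
    rw [Finset.sum_eq_single h]
    · rw [div_self (sub_ne_zero.2 (hζ b h h1 hh).symm), div_self (hs.nodeProdErase_ne hη hh), one_mul,
        one_smul]
    · intro k _ hk
      rw [nodeProdErase_eq_zero h1 hh fun h0 => hk h0.2.symm, zero_div, mul_zero, zero_smul]
    · intro h0
      exact absurd (Finset.mem_Icc.2 ⟨h1, hh⟩) h0
  · refine Finset.sum_eq_zero fun k _ => ?_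
    rw [nodeProdErase_eq_zero h1 hh fun h0 => hb h0.1.symm, zero_div, mul_zero, zero_smul]

theorem interpQ_node (hη : η ≠ 0) (hs : SovCondition p η ξ)
    (hζ : ∀ n, ∀ k, 1 ≤ k → k ≤ p n → ζ ≠ pt p η ξ n k) (d : Fin N → A) {a : Fin N} {h : ℕ}
    (h1 : 1 ≤ h) (hh : h ≤ p a) :
    interpQ p η ξ ζ q d (pt p η ξ a h) = q a h * d a := by
  rw [interpQ, nodeProd_eq_zero h1 hh, zero_div, zero_smul, add_zero]
  simp [interp_node q hη hs hζ _ h1 hh]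

/-- Row `a` of the linear system says precisely that the proportionality to `q`, automatic at the
nodes, continues to the first point of the string, where there is no node. -/
theorem interpQ_first {d : Fin N → A}
    (hd : interpMat p η ξ ζ q *ᵥ d = interpRhs p η ξ ζ A) (a : Fin N) :
    interpQ p η ξ ζ q d (pt p η ξ a 0) = q a 0 * d a := by
  have h := congrFun hd a
  rw [Matrix.mulVec, dotProduct] at h
  simp only [interpMat, Matrix.of_apply, add_mul, Finset.sum_add_distrib, ite_mul, zero_mul,
    Finset.sum_ite_eq, Finset.mem_univ, if_true, interpRhs] at h
  rw [interpQ]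
  linear_combination h

/-- Dividing the full node product by one linear factor gives the reduced one, so every summand
separates into a factor depending on `a` and one depending on `b`: the matrix has rank one, with the
right-hand side of the linear system as its column. -/
theorem interpDelta_eq {x : ℂ} (hx : ∀ n, ∀ k, 1 ≤ k → k ≤ p n → x ≠ pt p η ξ n k)
    (hζ : ∀ n, ∀ k, 1 ≤ k → k ≤ p n → ζ ≠ pt p η ξ n k)  :
    interpDelta p η ξ ζ q x = Matrix.of fun a b => interpRhs p η ξ ζ A a *
      ((nodeProd p η ξ x / nodeProd p η ξ ζ)⁻¹ • interp p η ξ ζ q b x) := by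
  ext a b
  rw [interpDelta, Matrix.of_apply, Matrix.of_apply, interpRhs, interp, Finset.smul_sum,
    Finset.mul_sum]
  refine Finset.sum_congr rfl fun h hh => ?_
  obtain ⟨h1, hh⟩ := Finset.mem_Icc.1 hh
  rw [neg_mul, smul_smul, smul_mul_smul_comm, one_mul, ← neg_smul]
  congr 1
  have e1 := nodeProd_ne_zero hζ
  have e2 := nodeProd_ne_zero hx
  have e3 := nodeProd_eq_mul (p := p) (η := η) (ξ := ξ) h1 hh x
  have e4 : x - pt p η ξ b h ≠ 0 := sub_ne_zero.2 (hx b h h1 hh)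
  have e5 : nodeProdErase p η ξ b h x ≠ 0 := by
    intro h0; rw [h0, mul_zero] at e3; exact e2 e3
  have e6 : pt p η ξ b h - x ≠ 0 := by rwa [← neg_sub, neg_ne_zero]
  have e7 : pt p η ξ b h - ζ ≠ 0 := sub_ne_zero.2 (hζ b h h1 hh).symm
  rw [e3]
  rw [← neg_sub x] at e6 ⊢
  -- The strings are not assumed disjoint here; if this denominator is zero, both sides are zero by
  -- the convention for division.
  by_cases e8 : nodeProdErase p η ξ b h (pt p η ξ b h) = 0
  · simp [e8]
  field_simp

theorem interpQ_eq_det {x : ℂ} (hx : ∀ n, ∀ k, 1 ≤ k → k ≤ p n → x ≠ pt p η ξ n k)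
    (hζ : ∀ n, ∀ k, 1 ≤ k → k ≤ p n → ζ ≠ pt p η ξ n k) {e : A}
    (he : (interpMat p η ξ ζ q).det * e = 1) :
    interpQ p η ξ ζ q
        (fun b => (interpMat p η ξ ζ q).cramer (interpRhs p η ξ ζ A) b * e) x =
      (nodeProd p η ξ x / nodeProd p η ξ ζ) •
        ((interpMat p η ξ ζ q + interpDelta p η ξ ζ q x).det * e) := by
  rw [interpDelta_eq q hx hζ, det_add_rankOne (IsUnit.of_mul_eq_one _ he), add_mul, he, smul_add,
    interpQ, add_comm, Finset.sum_mul, Finset.smul_sum]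
  congr 1
  refine Finset.sum_congr rfl fun b _ => ?_
  rw [smul_mul_assoc, smul_mul_assoc, smul_inv_smul₀, mul_assoc]
  exact div_ne_zero (nodeProd_ne_zero hx) (nodeProd_ne_zero hζ)

end Interpolation

/-! ### The Q-operator in a commutative lift. -/

section Operators

variable {N : ℕ} {p : Fin N → ℕ} {η : ℂ} {ξ : Fin N → ℂ} {ζ : ℂ}
  {K : Matrix (Fin 2) (Fin 2) ℂ} {k₁ k₂ : ℂ}

theorem fusedTransfer_comm (hη : η ≠ 0) (l m : ℕ) (x y : ℂ) :
    Commute (fusedTransfer p η ξ K l x) (fusedTransfer p η ξ K m y) := by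
  induction m using Nat.twoStepInduction with
  | zero => rw [fusedTransfer_zero p η ξ hη]; exact Commute.one_right _
  | one => rw [fusedTransfer_one p η ξ hη]; exact fusedTransfer_comm_transfer hη _ _ _
  | more m h0 h1 =>
    rw [fusedTransfer_succ_succ p η ξ hη]
    exact ((fusedTransfer_comm_transfer hη _ _ _).mul_right h1).sub_right (h0.smul_right _)

theorem qVal_comm (hη : η ≠ 0) (a b : Fin N) (h k : ℕ) :
    Commute (qVal p η ξ K k₂ a h) (qVal p η ξ K k₂ b k) :=
  ((fusedTransfer_comm hη _ _ _ _).smul_left _).smul_right _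

theorem qVal_top (hη : η ≠ 0) (a : Fin N) : qVal p η ξ K k₂ a (p a) = 1 := by
  rw [qVal, Nat.sub_self, fusedTransfer_zero p η ξ hη]
  simp

/-- The ordered products of the operator Leibniz formula become ordinary products once the entries
come from a commutative ring. -/
theorem opDet_map {A : Type*} [CommRing A] [Algebra ℂ A] (φ : A →ₐ[ℂ] Op p)
    (M : Matrix (Fin N) (Fin N) A) : opDet p (M.map φ) = φ M.det := by
  rw [opDet, Matrix.det_apply, map_sum]
  refine Finset.sum_congr rfl fun σ _ => ?_
  rw [← List.prod_ofFn, Units.smul_def, map_zsmul, map_list_prod, List.map_ofFn]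
  rfl

section Lift

variable {A : Type*} [CommRing A] [Algebra ℂ A] {φ : A →ₐ[ℂ] Op p} {q : Fin N → ℕ → A}
  (hq : ∀ a h, φ (q a h) = qVal p η ξ K k₂ a h)

include hq

theorem map_interp (b : Fin N) (x : ℂ) :
    φ (interp p η ξ ζ q b x) = interpCoeff p η ξ K k₂ ζ b x := by
  simp only [interp, map_sum, map_smul, hq, interpCoeff]

theorem map_interpMat : (interpMat p η ξ ζ q).map φ = matC p η ξ K k₂ ζ := by
  ext1 a b
  rw [Matrix.map_apply, interpMat, matC, Matrix.of_apply, Matrix.of_apply, map_add, map_interp hq]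
  split_ifs <;> simp [hq]

theorem opDet_matC : opDet p (matC p η ξ K k₂ ζ) = φ (interpMat p η ξ ζ q).det := by
  rw [← map_interpMat hq, opDet_map]

theorem opDet_matCRepl (b : Fin N) : opDet p (matCRepl p η ξ K k₂ ζ b) =
    φ ((interpMat p η ξ ζ q).cramer (interpRhs p η ξ ζ A) b) := by
  rw [Matrix.cramer_apply, ← opDet_map, Matrix.map_updateCol, map_interpMat hq, matCRepl]
  congr 2
  funext a
  simp [interpRhs]

theorem map_interpDelta (x : ℂ) : (interpDelta p η ξ ζ q x).map φ = matDelta p η ξ K k₂ ζ x := by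
  ext1 a b
  simp only [Matrix.map_apply, interpDelta, matDelta, Matrix.of_apply, map_sum, map_smul, hq]

theorem opQ_eq {e : A} (he : (interpMat p η ξ ζ q).det * e = 1) (x : ℂ) :
    opQ p η ξ K k₂ ζ x = φ (interpQ p η ξ ζ q
      (fun b => (interpMat p η ξ ζ q).cramer (interpRhs p η ξ ζ A) b * e) x) := by
  have hinv : (φ (interpMat p η ξ ζ q).det)⁻¹ = φ e :=
    Matrix.inv_eq_right_inv (by rw [← map_mul, he, map_one])
  simp only [opQ, opDet_matCRepl hq, opDet_matC hq, hinv, interpQ, map_add, map_sum, map_mul,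
    map_smul, map_one, map_interp hq]

theorem opQDet_eq {e : A} (he : (interpMat p η ξ ζ q).det * e = 1) (x : ℂ) :
    opQDet p η ξ K k₂ ζ x = φ ((nodeProd p η ξ x / nodeProd p η ξ ζ) •
        ((interpMat p η ξ ζ q + interpDelta p η ξ ζ q x).det * e)) := by
  have hinv : (φ (interpMat p η ξ ζ q).det)⁻¹ = φ e :=
    Matrix.inv_eq_right_inv (by rw [← map_mul, he, map_one])
  rw [opQDet, opDet_matC hq, hinv, map_smul, map_mul, ← opDet_map, ← map_interpMat hq,
    ← map_interpDelta hq]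
  congr 4
  ext1 a b
  simp

end Lift

theorem exists_lift (hη : η ≠ 0) (p : Fin N → ℕ) (ξ : Fin N → ℂ) (K : Matrix (Fin 2) (Fin 2) ℂ)
    (k₂ : ℂ) :
    ∃ (A : Type) (_ : CommRing A) (_ : Algebra ℂ A) (φ : A →ₐ[ℂ] Op p) (q : Fin N → ℕ → A),
      (∀ a h, φ (q a h) = qVal p η ξ K k₂ a h) ∧ (∀ x, IsUnit (φ x) → IsUnit x) ∧
        ∀ a, q a (p a) = 1 := by
  obtain ⟨A, _, _, φ, q, hq, hu⟩ := exists_comm_lift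
    (fun i : Fin N × ℕ => qVal p η ξ K k₂ i.1 i.2) fun i j => qVal_comm hη _ _ _ _
  refine ⟨A, inferInstance, inferInstance, φ,
    -- The lift does not record that `φ` is injective, so the value 1 at the end of each string is
    -- put in by hand.
    fun a h => if h = p a then 1 else q (a, h), fun a h => ?_, hu, fun a => if_pos rfl⟩
  simp only
  split_ifs with hh
  · rw [hh, qVal_top hη, map_one]
  · exact hq (a, h)

theorem opQ_eq_opQDet (hη : η ≠ 0) (hQ : QDefined p η ξ K k₂ ζ) {x : ℂ}
    (hx : ∀ n, ∀ k, 1 ≤ k → k ≤ p n → x ≠ pt p η ξ n k) :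
    opQ p η ξ K k₂ ζ x = opQDet p η ξ K k₂ ζ x := by
  obtain ⟨A, _, _, φ, q, hq, hu, -⟩ := exists_lift hη p ξ K k₂
  obtain ⟨hζ, hC, -⟩ := hQ
  rw [opDet_matC hq] at hC
  obtain ⟨e, he⟩ := (hu _ hC).exists_right_inv
  rw [opQ_eq hq he, opQDet_eq hq he, interpQ_eq_det q hx hζ he]

/-- The lifted Q at the point `h` of the string `n` is `q n h * d n`, by `interpQ_node` at the nodes
and by `interpQ_first` at the first point. Since `q n (p n) = 1`, the inverse factors are those of
the `d n`, which cancel. -/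
theorem qInvProd_mul_qProd (hη : η ≠ 0) (hs : SovCondition p η ξ) (hQ : QDefined p η ξ K k₂ ζ)
    (h : Idx p) :
    qInvProd p η ξ K k₂ ζ * qProd p η ξ K k₂ ζ h =
      (List.ofFn fun n : Fin N => qVal p η ξ K k₂ n (h n)).prod := by
  obtain ⟨A, _, _, φ, q, hq, hu, htop⟩ := exists_lift hη p ξ K k₂
  obtain ⟨hζ, hC, hQ⟩ := hQ
  rw [opDet_matC hq] at hC
  obtain ⟨e, he⟩ := (hu _ hC).exists_right_inv
  set d : Fin N → A := fun b => (interpMat p η ξ ζ q).cramer (interpRhs p η ξ ζ A) b * e with hd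
  have hd' := mulVec_cramer_div (u := interpRhs p η ξ ζ A) he
  have e1 : ∀ n, ∀ k ≤ p n, opQ p η ξ K k₂ ζ (pt p η ξ n k) = φ (q n k * d n) := by
    intro n k hk
    rw [opQ_eq hq he]
    congr 1
    rcases Nat.eq_zero_or_pos k with rfl | h1
    · exact interpQ_first q hd' n
    · exact interpQ_node q hη hs hζ d h1 hk
  have e2 : ∀ n, opQ p η ξ K k₂ ζ (pt p η ξ n (p n)) = φ (d n) := by
    intro n
    rw [e1 n _ le_rfl, htop, one_mul]
  have e3 : ∀ n, ∃ f, d n * f = 1 := by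
    intro n
    have := hQ n
    rw [e2] at this
    exact (hu _ this).exists_right_inv
  choose f hf using e3
  have e4 : ∀ n, (φ (d n))⁻¹ = φ (f n) := fun n =>
    Matrix.inv_eq_right_inv (by rw [← map_mul, hf, map_one])
  have key : ∀ (F : Fin N → Op p) (G : Fin N → A), (∀ n, F n = φ (G n)) →
      (List.ofFn F).prod = φ (∏ n, G n) := by
    intro F G hFG
    rw [← List.prod_ofFn, map_list_prod, List.map_ofFn]
    congr 2
    funext n
    exact hFG n
  rw [qInvProd, qProd, key _ f fun n => by rw [e2, e4],
    key _ (fun n => q n (h n) * d n) fun n => e1 n _ (Nat.lt_succ_iff.1 (h n).2),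
    key _ (fun n => q n (h n)) fun n => (hq _ _).symm, ← map_mul, ← Finset.prod_mul_distrib]
  congr 1
  refine Finset.prod_congr rfl fun n _ => ?_
  rw [mul_left_comm, mul_comm (f n), hf, mul_one]

theorem covL_qProd (hη : η ≠ 0) (hK : IsRegularTwist K k₁ k₂) (hs : SovCondition p η ξ)
    (hQ : QDefined p η ξ K k₂ ζ) (hb : K 0 1 ≠ 0) (h : Idx p) :
    covL p η ξ K k₁ k₂ ζ ᵥ* qProd p η ξ K k₂ ζ h = skCovector p η ξ K k₁ h := by
  rw [← skCovector_top_qVal hη hK hs hb h, ← qInvProd_mul_qProd hη hs hQ, covL, skCovector,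
    Matrix.smul_vecMul, Matrix.smul_vecMul, Matrix.vecMul_vecMul, Matrix.vecMul_vecMul,
    Matrix.mul_assoc]

end Operators
end HigherSpin

namespace HigherSpin

/-! ### Symmetric powers and coherent vectors. -/

section SymPower

/-- The coherent vectors of the spin representation. -/
noncomputable def symVec (q : ℕ) (z : Fin 2 → ℂ) (k : Fin (q + 1)) : ℂ :=
  ((Real.sqrt (q.choose k : ℝ) : ℝ) : ℂ) * (z 0 ^ (q - (k : ℕ)) * z 1 ^ (k : ℕ))

/-- The partial derivatives of `symVec`. -/
noncomputable def symVecDeriv (q : ℕ) (j : Fin 2) (z : Fin 2 → ℂ) (k : Fin (q + 1)) : ℂ :=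
  ((Real.sqrt (q.choose k : ℝ) : ℝ) : ℂ) *
    if j = 0 then ((q - (k : ℕ) : ℕ) : ℂ) * z 0 ^ (q - (k : ℕ) - 1) * z 1 ^ (k : ℕ)
    else z 0 ^ (q - (k : ℕ)) * (((k : ℕ) : ℂ) * z 1 ^ ((k : ℕ) - 1))

theorem prod_word (q : ℕ) (z : Fin 2 → ℂ) (f : Fin q → Fin 2) :
    ∏ i, z (f i) = z 0 ^ (q - ∑ i, (f i : ℕ)) * z 1 ^ (∑ i, (f i : ℕ)) := by
  induction q with
  | zero => simp
  | succ q ih =>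
    have hl := content_le (Fin.tail f)
    have := ih (Fin.tail f)
    rw [Fin.prod_univ_succ, Fin.sum_univ_succ]
    change z (f 0) * ∏ i, z (Fin.tail f i) = _
    rw [this]
    change _ = z 0 ^ (q + 1 - ((f 0 : ℕ) + ∑ i, (Fin.tail f i : ℕ))) *
      z 1 ^ ((f 0 : ℕ) + ∑ i, (Fin.tail f i : ℕ))
    generalize ∑ i, (Fin.tail f i : ℕ) = s at hl
    generalize f 0 = a
    fin_cases a
    · simp only [Fin.zero_eta, Fin.isValue, zero_add]
      rw [show q + 1 - s = (q - s) + 1 by omega]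
      ring
    · simp only [Fin.mk_one, Fin.isValue]
      rw [show q + 1 - (1 + s) = q - s by omega]
      ring

/-- Comparison of coefficients in `(1 + X) ^ q`, expanded over the words. -/
theorem card_content (q j : ℕ) :
    ∑ f : Fin q → Fin 2, (if ∑ i, (f i : ℕ) = j then (1 : ℂ) else 0) = q.choose j := by
  have h : (1 + Polynomial.X : Polynomial ℂ) ^ q =
      ∑ f : Fin q → Fin 2, Polynomial.X ^ (∑ i, (f i : ℕ)) := by
    calc (1 + Polynomial.X : Polynomial ℂ) ^ q =
        ∏ _i : Fin q, ∑ a : Fin 2, (Polynomial.X : Polynomial ℂ) ^ (a : ℕ) := by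
          simp [Fin.sum_univ_two]
      _ = _ := by
          rw [Finset.prod_univ_sum, Fintype.piFinset_univ]
          simp [Finset.prod_pow_eq_pow_sum]
  have := congrArg (fun P => Polynomial.coeff P j) h
  simp only [Polynomial.coeff_one_add_X_pow, Polynomial.finsetSum_coeff, Polynomial.coeff_X_pow] at this
  rw [this]
  exact Finset.sum_congr rfl fun f _ => if_congr eq_comm rfl rfl

theorem sqrt_choose_ne (q : ℕ) (k : Fin (q + 1)) :
    ((Real.sqrt (q.choose k : ℝ) : ℝ) : ℂ) ≠ 0 := by
  rw [Complex.ofReal_ne_zero]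
  have := Nat.choose_pos (Nat.lt_succ_iff.1 k.2)
  positivity

theorem sqrt_choose_mul_self (q : ℕ) (k : ℕ) :
    ((Real.sqrt (q.choose k : ℝ) : ℝ) : ℂ) * ((Real.sqrt (q.choose k : ℝ) : ℝ) : ℂ) =
      q.choose k := by
  rw [← Complex.ofReal_mul, Real.mul_self_sqrt (by positivity)]
  simp

/-- The coherent vector represents the tensor power of `z` in the orthonormal basis, so the tensor
power of `W` acts on it through `z`; the square roots cancel against the number of words of each
content. -/
theorem symPower_mulVec (q : ℕ) (W : Matrix (Fin 2) (Fin 2) ℂ) (z : Fin 2 → ℂ) :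
    symPower q W *ᵥ symVec q z = symVec q (W *ᵥ z) := by
  funext j
  rw [Matrix.mulVec, dotProduct]
  have e1 : ∀ k : Fin (q + 1), symPower q W j k * symVec q z k =
      ((Real.sqrt (q.choose j : ℝ) : ℝ) : ℂ)⁻¹ * ∑ f : Fin q → Fin 2,
        if ∑ i, (f i : ℕ) = (j : ℕ) then ∑ g : Fin q → Fin 2,
          (if ∑ i, (g i : ℕ) = (k : ℕ) then ∏ i, (W (f i) (g i) * z (g i)) else 0) else 0 := by
    intro k
    have hk := sqrt_choose_ne q k
    rw [symPower, Matrix.of_apply, symVec, Real.sqrt_mul (by positivity), Complex.ofReal_mul, mul_inv]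
    rw [show ∀ a b c d e : ℂ, a * b * c * (d * e) = a * ((b * d) * (c * e)) by intros; ring,
      inv_mul_cancel₀ hk, one_mul, Finset.sum_mul]
    congr 1
    refine Finset.sum_congr rfl fun f _ => ?_
    rw [Finset.sum_mul]
    split_ifs with hf
    · refine Finset.sum_congr rfl fun g _ => ?_
      by_cases hg : ∑ i, (g i : ℕ) = (k : ℕ)
      · rw [if_pos ⟨hf, hg⟩, if_pos hg, Finset.prod_mul_distrib, prod_word, hg]
      · rw [if_neg fun h => hg h.2, if_neg hg, zero_mul]
    · refine Finset.sum_eq_zero fun g _ => ?_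
      rw [if_neg fun h => hf h.1, zero_mul]
  rw [Finset.sum_congr rfl fun k _ => e1 k, ← Finset.mul_sum, Finset.sum_comm]
  have e2 : ∀ f : Fin q → Fin 2, ∑ k : Fin (q + 1), (if ∑ i, (f i : ℕ) = (j : ℕ) then
      ∑ g : Fin q → Fin 2, (if ∑ i, (g i : ℕ) = (k : ℕ) then ∏ i, (W (f i) (g i) * z (g i)) else 0)
      else 0) = (if ∑ i, (f i : ℕ) = (j : ℕ) then 1 else 0) *
        ((W *ᵥ z) 0 ^ (q - (j : ℕ)) * (W *ᵥ z) 1 ^ (j : ℕ)) := by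
    intro f
    split_ifs with hf
    · rw [one_mul, ← hf, ← prod_word, Finset.sum_comm]
      have e3 : ∀ i, (W *ᵥ z) (f i) = ∑ a, W (f i) a * z a := fun i => rfl
      simp only [e3]
      rw [Finset.prod_univ_sum, Fintype.piFinset_univ]
      refine Finset.sum_congr rfl fun g _ => ?_
      rw [Finset.sum_eq_single (⟨∑ i, (g i : ℕ), Nat.lt_succ_iff.2 (content_le g)⟩ : Fin (q + 1))]
      · rw [if_pos rfl]
      · intro k _ hk
        rw [if_neg fun h => hk (Fin.ext h.symm)]
      · simp
    · simp
  rw [Finset.sum_congr rfl fun f _ => e2 f, ← Finset.sum_mul, card_content, symVec, ← mul_assoc]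
  congr 1
  rw [← sqrt_choose_mul_self, inv_mul_cancel_left₀ (sqrt_choose_ne q j)]

/-- Along `z = (1, t)` the components are distinct powers of `t` with nonzero coefficients, so a
matrix is determined by its action on coherent vectors. -/
theorem ext_symVec {q : ℕ} {X Y : Matrix (Fin (q + 1)) (Fin (q + 1)) ℂ}
    (h : ∀ z, X *ᵥ symVec q z = Y *ᵥ symVec q z) : X = Y := by
  ext i k
  let P : Polynomial ℂ := ∑ k : Fin (q + 1),
    Polynomial.monomial (k : ℕ) ((X i k - Y i k) * ((Real.sqrt (q.choose k : ℝ) : ℝ) : ℂ))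
  have hP : P = 0 := by
    refine Polynomial.funext fun t => ?_
    have := congrFun (h ![1, t]) i
    rw [Matrix.mulVec, Matrix.mulVec, dotProduct, dotProduct, ← sub_eq_zero,
      ← Finset.sum_sub_distrib] at this
    rw [Polynomial.eval_zero, ← this, Polynomial.eval_finsetSum]
    refine Finset.sum_congr rfl fun k _ => ?_
    simp [symVec]
    ring
  have hc := congrArg (fun P => Polynomial.coeff P (k : ℕ)) hP
  simp only [P, Polynomial.finsetSum_coeff, Polynomial.coeff_monomial, Polynomial.coeff_zero,
    Fin.val_inj, Finset.sum_ite_eq', Finset.mem_univ, if_true] at hc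
  exact sub_eq_zero.1 ((mul_eq_zero.1 hc).resolve_right (sqrt_choose_ne q k))

theorem symPower_mul (q : ℕ) (W W' : Matrix (Fin 2) (Fin 2) ℂ) :
    symPower q (W * W') = symPower q W * symPower q W' :=
  ext_symVec fun z => by
    rw [symPower_mulVec, ← Matrix.mulVec_mulVec, ← Matrix.mulVec_mulVec, symPower_mulVec,
      symPower_mulVec]

theorem symPower_one (q : ℕ) : symPower q 1 = 1 :=
  ext_symVec fun z => by rw [symPower_mulVec, Matrix.one_mulVec, Matrix.one_mulVec]

theorem hasDerivAt_symVec (q : ℕ) (z w : Fin 2 → ℂ) :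
    HasDerivAt (fun t : ℂ => symVec q (z + t • w)) (∑ l, w l • symVecDeriv q l z) 0 := by
  rw [hasDerivAt_pi]
  intro k
  have h0 : ∀ i, HasDerivAt (fun t : ℂ => (z + t • w) i) (w i) 0 := by
    intro i
    simpa using ((hasDerivAt_id (0 : ℂ)).mul_const (w i)).const_add (z i)
  have := (((h0 0).pow (q - (k : ℕ))).mul ((h0 1).pow (k : ℕ))).const_mul
    ((Real.sqrt (q.choose k : ℝ) : ℝ) : ℂ)
  refine this.congr_deriv ?_
  simp [symVecDeriv, Fin.sum_univ_two]
  ring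

/-- `symPower_mulVec` differentiated in the direction of a basis vector. -/
theorem symPower_mulVec_deriv (q : ℕ) (W : Matrix (Fin 2) (Fin 2) ℂ) (z : Fin 2 → ℂ) (j : Fin 2) :
    symPower q W *ᵥ symVecDeriv q j z = ∑ l, W l j • symVecDeriv q l (W *ᵥ z) := by
  have h1 := hasDerivAt_symVec q z (Pi.single j 1)
  have e1 : ∑ l, (Pi.single j 1 : Fin 2 → ℂ) l • symVecDeriv q l z = symVecDeriv q j z := by
    rw [Finset.sum_eq_single j] <;> simp +contextual
  rw [e1] at h1
  have h2 := hasDerivAt_symVec q (W *ᵥ z) (W *ᵥ Pi.single j 1)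
  have h3 := (LinearMap.toContinuousLinearMap (Matrix.mulVecLin (symPower q W))).hasFDerivAt.comp_hasDerivAt
    (0 : ℂ) h1
  have e2 : (fun t : ℂ => symVec q (W *ᵥ z + t • (W *ᵥ Pi.single j 1))) =
      (LinearMap.toContinuousLinearMap (Matrix.mulVecLin (symPower q W))) ∘
        fun t : ℂ => symVec q (z + t • Pi.single j 1) := by
    funext t
    simp only [Function.comp_apply, LinearMap.coe_toContinuousLinearMap', Matrix.mulVecLin_apply]
    rw [symPower_mulVec, Matrix.mulVec_add, Matrix.mulVec_smul]
  rw [← e2] at h3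
  have := h3.unique h2
  simpa using this

theorem sqrt_mul_choose {q k : ℕ} (hk : k < q) :
    ((Real.sqrt ((((k + 1 : ℕ) : ℕ) : ℝ) * ((q : ℝ) + 1 - ((k + 1 : ℕ) : ℝ))) : ℝ) : ℂ) *
        ((Real.sqrt (q.choose k : ℝ) : ℝ) : ℂ) =
      ((k + 1 : ℕ) : ℂ) * ((Real.sqrt (q.choose (k + 1) : ℝ) : ℝ) : ℂ) ∧
    ((Real.sqrt ((((k + 1 : ℕ) : ℕ) : ℝ) * ((q : ℝ) + 1 - ((k + 1 : ℕ) : ℝ))) : ℝ) : ℂ) *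
        ((Real.sqrt (q.choose (k + 1) : ℝ) : ℝ) : ℂ) =
      ((q - k : ℕ) : ℂ) * ((Real.sqrt (q.choose k : ℝ) : ℝ) : ℂ) := by
  have h1 : (q.choose (k + 1) : ℝ) * ((k + 1 : ℕ) : ℝ) = q.choose k * ((q - k : ℕ) : ℝ) := by
    exact_mod_cast Nat.choose_succ_right_eq q k
  have h2 : (q : ℝ) + 1 - ((k + 1 : ℕ) : ℝ) = ((q - k : ℕ) : ℝ) := by
    push_cast [hk.le]; ring
  rw [h2, ← Complex.ofReal_mul, ← Complex.ofReal_mul, ← Real.sqrt_mul (by positivity),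
    ← Real.sqrt_mul (by positivity)]
  constructor
  · rw [show ((k + 1 : ℕ) : ℝ) * ((q - k : ℕ) : ℝ) * (q.choose k : ℝ) =
      ((k + 1 : ℕ) : ℝ) ^ 2 * (q.choose (k + 1) : ℝ) by linear_combination -((k + 1 : ℕ) : ℝ) * h1,
      Real.sqrt_mul (by positivity), Real.sqrt_sq (by positivity)]
    push_cast; ring
  · rw [show ((k + 1 : ℕ) : ℝ) * ((q - k : ℕ) : ℝ) * (q.choose (k + 1) : ℝ) =
      ((q - k : ℕ) : ℝ) ^ 2 * (q.choose k : ℝ) by linear_combination ((q - k : ℕ) : ℝ) * h1,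
      Real.sqrt_mul (by positivity), Real.sqrt_sq (by positivity)]
    push_cast; ring

theorem natCast_mul_pow_pred (n : ℕ) (x : ℂ) : x * ((n : ℂ) * x ^ (n - 1)) = n * x ^ n := by
  cases n with
  | zero => simp
  | succ n => rw [Nat.add_sub_cancel]; ring

/-- On coherent vectors the spin operators are the first-order operators `z_i ∂_j - δ_ij q / 2`.
Truncated exponents in the derivatives occur only with coefficient zero. -/
theorem spinMat_mulVec (q : ℕ) (i j : Fin 2) (z : Fin 2 → ℂ) :
    spinMat q i j *ᵥ symVec q z =
      z i • symVecDeriv q j z - ((if i = j then (1 : ℂ) else 0) * ((q : ℂ) / 2)) • symVec q z := by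
  funext k
  have hkq := Nat.lt_succ_iff.1 k.2
  have e0 := natCast_mul_pow_pred (q - (k : ℕ)) (z 0)
  have e1 := natCast_mul_pow_pred (k : ℕ) (z 1)
  have ec : ((q - (k : ℕ) : ℕ) : ℂ) = q - (k : ℕ) := by push_cast [hkq]; ring
  fin_cases i <;> fin_cases j
  · simp [spinMat, spinZ, Matrix.mulVec_diagonal, symVec, symVecDeriv]
    rw [ec] at e0 ⊢
    linear_combination
      (-((Real.sqrt (q.choose k : ℝ) : ℝ) : ℂ) * z 1 ^ (k : ℕ)) * e0
  · simp only [spinMat, Fin.zero_eta, Fin.mk_one, Matrix.of_apply, Matrix.cons_val_zero,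
      Matrix.cons_val_one, spinMinus]
    rw [Matrix.mulVec, dotProduct]
    simp only [Matrix.transpose_apply, spinPlus, Matrix.of_apply]
    rcases Nat.eq_zero_or_pos (k : ℕ) with hk | hk
    · rw [Finset.sum_eq_zero (fun l _ => by rw [if_neg (by omega), zero_mul])]
      simp [symVecDeriv, hk]
    · obtain ⟨m, hm⟩ : ∃ m, (k : ℕ) = m + 1 := ⟨k - 1, by omega⟩
      rw [Finset.sum_eq_single ⟨m, by omega⟩]
      · rw [if_pos hm.symm, hm, symVec]
        have := (sqrt_mul_choose (q := q) (k := m) (by omega)).1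
        change _ * (((Real.sqrt (q.choose m : ℝ) : ℝ) : ℂ) * (z 0 ^ (q - m) * z 1 ^ m)) = _
        rw [← mul_assoc, this, show q - m = q - (m + 1) + 1 by omega]
        simp [symVecDeriv, hm]
        ring
      · intro l _ hl
        rw [if_neg, zero_mul]
        intro h
        exact hl (Fin.ext (by simp; omega))
      · simp
  · simp only [spinMat, Fin.zero_eta, Fin.mk_one, Matrix.of_apply, Matrix.cons_val_zero,
      Matrix.cons_val_one]
    rw [Matrix.mulVec, dotProduct]
    simp only [spinPlus, Matrix.of_apply]
    rcases hkq.eq_or_lt with hk | hk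
    · rw [Finset.sum_eq_zero (fun l _ => by rw [if_neg (by omega), zero_mul])]
      simp [symVecDeriv, hk]
    · rw [Finset.sum_eq_single ⟨k + 1, by omega⟩]
      · rw [if_pos rfl, symVec]
        have := (sqrt_mul_choose hk).2
        rw [← mul_assoc, this, show q - ((k : ℕ) + 1) = q - k - 1 by omega]
        simp [symVecDeriv]
        ring
      · intro l _ hl
        rw [if_neg, zero_mul]
        intro h
        exact hl (Fin.ext h.symm)
      · simp
  · simp [spinMat, spinZ, Matrix.mulVec_diagonal, symVec, symVecDeriv]
    linear_combination
      (-((Real.sqrt (q.choose k : ℝ) : ℝ) : ℂ) * z 0 ^ (q - (k : ℕ))) * e1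

/-- Equivariance of the spin matrix, obtained from the chain rule for `z_i ∂_j` under a linear
substitution. Having `W` on both sides avoids an inverse. -/
theorem symPower_spinMat (q : ℕ) (W : Matrix (Fin 2) (Fin 2) ℂ) (i j : Fin 2) :
    symPower q W * (∑ k, W i k • spinMat q k j) = (∑ l, W l j • spinMat q i l) * symPower q W := by
  refine ext_symVec fun z => ?_
  simp only [← Matrix.mulVec_mulVec, Matrix.sum_mulVec, Matrix.smul_mulVec, symPower_mulVec,
    spinMat_mulVec, Matrix.mulVec_sum, Matrix.mulVec_smul, Matrix.mulVec_sub, symPower_mulVec_deriv]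
  have : (W *ᵥ z) i = W i 0 * z 0 + W i 1 * z 1 := by
    rw [Matrix.mulVec, dotProduct, Fin.sum_univ_two]
  simp only [Fin.sum_univ_two, this]
  fin_cases i <;> fin_cases j <;> simp <;> module

end SymPower
-- Covariance under `GL_2` and the change of twist.
section Conjugation

/-- Conjugation by an invertible matrix as a homomorphism of algebras. -/
noncomputable def conjHom {m : Type*} [Fintype m] [DecidableEq m] (P : Matrix m m ℂ)
    (hP : P⁻¹ * P = 1) : Matrix m m ℂ →ₐ[ℂ] Matrix m m ℂ :=
  AlgHom.ofLinearMap
    { toFun := fun X => P * X * P⁻¹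
      map_add' := fun X Y => by rw [Matrix.mul_add, Matrix.add_mul]
      map_smul' := fun c X => by simp }
    (by
      change P * 1 * P⁻¹ = 1
      rw [Matrix.mul_one]
      exact mul_eq_one_comm.1 hP)
    (fun X Y => by
      change P * (X * Y) * P⁻¹ = P * X * P⁻¹ * (P * Y * P⁻¹)
      rw [show P * X * P⁻¹ * (P * Y * P⁻¹) = P * X * (P⁻¹ * P) * Y * P⁻¹ by noncomm_ring, hP]
      noncomm_ring)

section
variable {m : Type*} [Fintype m] [DecidableEq m] {P : Matrix m m ℂ} (hP : P⁻¹ * P = 1)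

theorem conjHom_apply (X : Matrix m m ℂ) : conjHom P hP X = P * X * P⁻¹ := rfl

theorem conjHom_inv (X : Matrix m m ℂ) : conjHom P hP X⁻¹ = (conjHom P hP X)⁻¹ := by
  have hu : IsUnit P.det := (Matrix.isUnit_iff_isUnit_det _).1 (IsUnit.of_mul_eq_one _
    (mul_eq_one_comm.1 hP))
  rw [conjHom_apply, conjHom_apply, Matrix.mul_inv_rev, Matrix.mul_inv_rev,
    Matrix.nonsing_inv_nonsing_inv _ hu, Matrix.mul_assoc]

end

variable {N : ℕ} (p : Fin N → ℕ)

theorem globalPower_mul (W W' : Matrix (Fin 2) (Fin 2) ℂ) :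
    globalPower p (W * W') = globalPower p W * globalPower p W' := by
  ext h h'
  simp only [globalPower, Matrix.of_apply, Matrix.mul_apply, symPower_mul]
  rw [Finset.prod_univ_sum, Fintype.piFinset_univ]
  exact Finset.sum_congr rfl fun f _ => Finset.prod_mul_distrib

theorem globalPower_one : globalPower p 1 = 1 := by
  ext h h'
  simp only [globalPower, Matrix.of_apply, symPower_one]
  by_cases hh : h = h'
  · subst hh; simp
  · obtain ⟨n, hn⟩ := Function.ne_iff.1 hh
    rw [Matrix.one_apply_ne hh]
    exact Finset.prod_eq_zero (Finset.mem_univ n) (Matrix.one_apply_ne hn)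

theorem globalPower_inv_mul {W : Matrix (Fin 2) (Fin 2) ℂ} (hW : IsUnit W) :
    (globalPower p W)⁻¹ * globalPower p W = 1 := by
  have hd := (Matrix.isUnit_iff_isUnit_det _).1 hW
  have : globalPower p W⁻¹ * globalPower p W = 1 := by
    rw [← globalPower_mul, Matrix.nonsing_inv_mul _ hd, globalPower_one]
  rwa [Matrix.inv_eq_left_inv this]

theorem globalPower_mul_siteOp {W : Matrix (Fin 2) (Fin 2) ℂ} {n : Fin N}
    {X Y : Matrix (Fin (p n + 1)) (Fin (p n + 1)) ℂ}
    (h : symPower (p n) W * X = Y * symPower (p n) W) :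
    globalPower p W * siteOp p n X = siteOp p n Y * globalPower p W := by
  ext i j
  rw [siteOp_mul_apply, Matrix.mul_apply]
  have e1 : ∑ k, Y (i n) k * globalPower p W (Function.update i n k) j =
      (Y * symPower (p n) W) (i n) (j n) *
        ∏ m ∈ Finset.univ.erase n, symPower (p m) W (i m) (j m) := by
    rw [Matrix.mul_apply, Finset.sum_mul]
    refine Finset.sum_congr rfl fun k _ => ?_
    rw [globalPower, Matrix.of_apply, ← Finset.mul_prod_erase _ _ (Finset.mem_univ n),
      Function.update_self, mul_assoc]
    congr 2
    exact Finset.prod_congr rfl fun m hm => by rw [Function.update_of_ne (Finset.ne_of_mem_erase hm)]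
  rw [e1, ← h, Matrix.mul_apply, Finset.sum_mul]
  symm
  refine Finset.sum_of_injOn (fun k => Function.update j n k)
    (fun a _ b _ hab => by simpa using congrFun hab n) (by simp) ?_ ?_
  · intro k _ hk
    rw [siteOp_apply, if_neg, mul_zero]
    intro hm
    refine hk ⟨k n, by simp, funext fun m => ?_⟩
    by_cases hmn : m = n
    · subst hmn; simp
    · simp [hmn, hm m hmn]
  · intro k _
    have e2 : ∏ m ∈ Finset.univ.erase n, symPower (p m) W (i m) (Function.update j n k m) =
        ∏ m ∈ Finset.univ.erase n, symPower (p m) W (i m) (j m) :=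
      Finset.prod_congr rfl fun m hm => by rw [Function.update_of_ne (Finset.ne_of_mem_erase hm)]
    rw [siteOp_apply, if_pos (fun m hm => by simp [hm]), globalPower, Matrix.of_apply,
      ← Finset.mul_prod_erase _ _ (Finset.mem_univ n), e2, Function.update_self]
    ring

variable (η : ℂ) (ξ : Fin N → ℂ)

theorem auxMat_mul (A B : Matrix (Fin 2) (Fin 2) ℂ) : auxMat p (A * B) = auxMat p A * auxMat p B :=
  Matrix.map_mul

theorem auxMat_one : auxMat p 1 = 1 := by
  rw [auxMat, Matrix.map_one _ (map_zero _) (map_one _)]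

theorem auxMat_map (A : Matrix (Fin 2) (Fin 2) ℂ) (φ : Op p →ₐ[ℂ] Op p) :
    (auxMat p A).map φ = auxMat p A := by
  ext1 i j
  simp only [auxMat, Matrix.map_apply, AlgHom.commutes]

theorem trace_auxMat_mul (A : Matrix (Fin 2) (Fin 2) ℂ) (X : Matrix (Fin 2) (Fin 2) (Op p)) :
    (auxMat p A * X).trace = (X * auxMat p A).trace := by
  simp only [Matrix.trace, Matrix.diag_apply, Matrix.mul_apply]
  rw [Finset.sum_comm]
  refine Finset.sum_congr rfl fun i _ => Finset.sum_congr rfl fun j _ => ?_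
  exact Algebra.commutes (A j i) (X i j)

variable {W : Matrix (Fin 2) (Fin 2) ℂ} (hW : IsUnit W)

/-- The Lax operator is invariant under the simultaneous action of `GL_2` on both spaces, so
conjugation in the quantum space can be traded for conjugation in the auxiliary space. -/
theorem conj_siteLax (n : Fin N) (x : ℂ) :
    (siteLax p η ξ n x).map (conjHom _ (globalPower_inv_mul p hW)) =
      auxMat p W⁻¹ * siteLax p η ξ n x * auxMat p W := by
  have hd := (Matrix.isUnit_iff_isUnit_det _).1 hW
  set ψ := conjHom _ (globalPower_inv_mul p hW) with hψ
  have key : auxMat p W * (siteLax p η ξ n x).map ψ = siteLax p η ξ n x * auxMat p W := by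
    ext1 i j
    have h1 : symPower (p n) W * (∑ k, W i k • lax η (p n) (x - ξ n) k j) =
        (∑ l, W l j • lax η (p n) (x - ξ n) i l) * symPower (p n) W := by
      -- Only the spin part of the Lax operator needs the equivariance; its scalar part commutes
      -- with the symmetric power.
      have h2 := symPower_spinMat (p n) W i j
      simp only [lax_apply, Fin.sum_univ_two] at h2 ⊢
      rw [show ∀ a b c d : Matrix (Fin (p n + 1)) (Fin (p n + 1)) ℂ, W i 0 • (a + η • b) +
        W i 1 • (c + η • d) = (W i 0 • a + W i 1 • c) + η • (W i 0 • b + W i 1 • d) by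
          intros; module,
        show ∀ a b c d : Matrix (Fin (p n + 1)) (Fin (p n + 1)) ℂ, W 0 j • (a + η • b) +
        W 1 j • (c + η • d) = (W 0 j • a + W 1 j • c) + η • (W 0 j • b + W 1 j • d) by
          intros; module, Matrix.mul_add, Matrix.add_mul, Matrix.mul_smul, Matrix.smul_mul, h2]
      congr 1
      fin_cases i <;> fin_cases j <;> simp
    have h3 := globalPower_mul_siteOp p h1
    have h4 : conjHom _ (globalPower_inv_mul p hW)
        (siteOp p n (∑ k, W i k • lax η (p n) (x - ξ n) k j)) =
        siteOp p n (∑ l, W l j • lax η (p n) (x - ξ n) i l) := by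
      rw [conjHom_apply, h3, Matrix.mul_assoc, mul_eq_one_comm.1 (globalPower_inv_mul p hW),
        Matrix.mul_one]
    simp only [← siteHom_apply, map_sum, map_smul] at h4
    simp only [Matrix.mul_apply, auxMat, siteLax, Matrix.map_apply, ← Algebra.smul_def,
      ← Algebra.commutes, ← siteHom_apply]
    exact h4
  rw [Matrix.mul_assoc, ← key, ← Matrix.mul_assoc, ← auxMat_mul, Matrix.nonsing_inv_mul _ hd,
    auxMat_one, Matrix.one_mul]

theorem conj_siteLax_prod (L : List (Fin N)) (x : ℂ) :
    ((L.map fun n => siteLax p η ξ n x).prod).map (conjHom _ (globalPower_inv_mul p hW)) =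
      auxMat p W⁻¹ * (L.map fun n => siteLax p η ξ n x).prod * auxMat p W := by
  have hd := (Matrix.isUnit_iff_isUnit_det _).1 hW
  induction L with
  | nil =>
    rw [List.map_nil, List.prod_nil, Matrix.mul_one, ← auxMat_mul, Matrix.nonsing_inv_mul _ hd,
      auxMat_one, Matrix.map_one _ (map_zero _) (map_one _)]
  | cons n L ih =>
    rw [List.map_cons, List.prod_cons, Matrix.map_mul, ih, conj_siteLax p η ξ hW]
    have : auxMat p W * auxMat p W⁻¹ = 1 := by
      rw [← auxMat_mul, Matrix.mul_nonsing_inv _ hd, auxMat_one]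
    generalize (L.map fun n => siteLax p η ξ n x).prod = Y
    generalize siteLax p η ξ n x = X
    calc _ = auxMat p W⁻¹ * X * (auxMat p W * auxMat p W⁻¹) * Y * auxMat p W := by
          simp only [Matrix.mul_assoc]
      _ = _ := by rw [this]; simp only [Matrix.mul_assoc, Matrix.one_mul]

/-- The auxiliary factor produced by the chain cancels against the right factor of the conjugated
twist, which leaves the original twist between `W⁻¹` and `W`. -/
theorem conj_monodromy (K : Matrix (Fin 2) (Fin 2) ℂ) (x : ℂ) :
    (monodromy p η ξ (W⁻¹ * K * W) x).map (conjHom _ (globalPower_inv_mul p hW)) =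
      auxMat p W⁻¹ * monodromy p η ξ K x * auxMat p W := by
  have hd := (Matrix.isUnit_iff_isUnit_det _).1 hW
  have : auxMat p W * auxMat p W⁻¹ = 1 := by
    rw [← auxMat_mul, Matrix.mul_nonsing_inv _ hd, auxMat_one]
  rw [monodromy_eq, monodromy_eq, Matrix.map_mul, conj_siteLax_prod p η ξ hW, auxMat_map,
    auxMat_mul, auxMat_mul]
  generalize ((sites N).map fun n => siteLax p η ξ n x).prod = Y
  calc _ = auxMat p W⁻¹ * auxMat p K * (auxMat p W * auxMat p W⁻¹) * Y * auxMat p W := by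
        simp only [Matrix.mul_assoc]
    _ = _ := by rw [this]; simp only [Matrix.mul_assoc, Matrix.one_mul]

theorem trace_auxMat_conj (E : Matrix (Fin 2) (Fin 2) ℂ) (X : Matrix (Fin 2) (Fin 2) (Op p)) :
    (auxMat p (W * E * W⁻¹) * X).trace =
      (auxMat p E * (auxMat p W⁻¹ * X * auxMat p W)).trace := by
  rw [auxMat_mul, auxMat_mul, Matrix.mul_assoc, Matrix.mul_assoc, trace_auxMat_mul]
  simp only [Matrix.mul_assoc]

theorem conj_opA (K : Matrix (Fin 2) (Fin 2) ℂ) (x : ℂ) :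
    conjHom _ (globalPower_inv_mul p hW) (opA p η ξ (W⁻¹ * K * W) x) = opATilde p η ξ K W x := by
  rw [opATilde, trace_auxMat_conj, ← conj_monodromy p η ξ hW]
  simp [Matrix.trace_fin_two, Matrix.mul_apply, auxMat, opA]

theorem conj_opB (K : Matrix (Fin 2) (Fin 2) ℂ) (x : ℂ) :
    conjHom _ (globalPower_inv_mul p hW) (opB p η ξ (W⁻¹ * K * W) x) = opBTilde p η ξ K W x := by
  rw [opBTilde, trace_auxMat_conj, ← conj_monodromy p η ξ hW]
  simp [Matrix.trace_fin_two, Matrix.mul_apply, auxMat, opB]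

theorem conj_transfer (K : Matrix (Fin 2) (Fin 2) ℂ) (x : ℂ) :
    conjHom _ (globalPower_inv_mul p hW) (transfer p η ξ (W⁻¹ * K * W) x) =
      transfer p η ξ K x := by
  have hd := (Matrix.isUnit_iff_isUnit_det _).1 hW
  have h := congrArg Matrix.trace (conj_monodromy p η ξ hW K x)
  rw [Matrix.mul_assoc (auxMat p W⁻¹), trace_auxMat_mul, Matrix.mul_assoc (monodromy p η ξ K x), ← auxMat_mul,
    Matrix.mul_nonsing_inv _ hd, auxMat_one, Matrix.mul_one] at h
  rw [transfer, transfer, ← h, Matrix.trace_fin_two, Matrix.trace_fin_two, map_add]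
  rfl

variable {η}

/-- The fusion recursion reduces this to the transfer matrix, since the determinant of the twist is
invariant; the symmetrizers need not be considered. -/
theorem conj_fusedTransfer (hη : η ≠ 0) (K : Matrix (Fin 2) (Fin 2) ℂ) (l : ℕ) (x : ℂ) :
    conjHom _ (globalPower_inv_mul p hW) (fusedTransfer p η ξ (W⁻¹ * K * W) l x) =
      fusedTransfer p η ξ K l x := by
  have hd := (Matrix.isUnit_iff_isUnit_det _).1 hW
  have hdet : (W⁻¹ * K * W).det = K.det := by
    rw [Matrix.det_mul, Matrix.det_mul, mul_right_comm, ← Matrix.det_mul,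
      Matrix.nonsing_inv_mul _ hd, Matrix.det_one, one_mul]
  induction l using Nat.twoStepInduction with
  | zero => rw [fusedTransfer_zero p η ξ hη, fusedTransfer_zero p η ξ hη, map_one]
  | one => rw [fusedTransfer_one p η ξ hη, fusedTransfer_one p η ξ hη, conj_transfer p η ξ hW]
  | more l h0 h1 =>
    rw [fusedTransfer_succ_succ p η ξ hη, fusedTransfer_succ_succ p η ξ hη, map_sub, map_mul,
      map_smul, h0, h1, conj_transfer p η ξ hW, hdet]

theorem conj_qVal (hη : η ≠ 0) (K : Matrix (Fin 2) (Fin 2) ℂ) (k₂ : ℂ) (a : Fin N) (h : ℕ) :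
    conjHom _ (globalPower_inv_mul p hW) (qVal p η ξ (W⁻¹ * K * W) k₂ a h) =
      qVal p η ξ K k₂ a h := by
  rw [qVal, qVal, map_smul, conj_fusedTransfer p ξ hW hη]

theorem map_opDet (φ : Op p →ₐ[ℂ] Op p) (M : Matrix (Fin N) (Fin N) (Op p)) :
    φ (opDet p M) = opDet p (M.map φ) := by
  rw [opDet, opDet, map_sum]
  refine Finset.sum_congr rfl fun σ _ => ?_
  rw [map_zsmul, map_list_prod, List.map_ofFn]
  rfl

theorem conj_interpCoeff (hη : η ≠ 0) (K : Matrix (Fin 2) (Fin 2) ℂ) (k₂ ζ : ℂ) (b : Fin N)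
    (x : ℂ) :
    conjHom _ (globalPower_inv_mul p hW) (interpCoeff p η ξ (W⁻¹ * K * W) k₂ ζ b x) =
      interpCoeff p η ξ K k₂ ζ b x := by
  simp only [interpCoeff, map_sum, map_smul, conj_qVal p ξ hW hη]

theorem conj_matC (hη : η ≠ 0) (K : Matrix (Fin 2) (Fin 2) ℂ) (k₂ ζ : ℂ) :
    (matC p η ξ (W⁻¹ * K * W) k₂ ζ).map (conjHom _ (globalPower_inv_mul p hW)) =
      matC p η ξ K k₂ ζ := by
  ext1 a b
  rw [Matrix.map_apply, matC, matC, Matrix.of_apply, Matrix.of_apply, map_add,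
    conj_interpCoeff p ξ hW hη]
  split_ifs
  · rw [map_neg, conj_qVal p ξ hW hη]
  · rw [map_zero]

theorem conj_matCRepl (hη : η ≠ 0) (K : Matrix (Fin 2) (Fin 2) ℂ) (k₂ ζ : ℂ) (j : Fin N) :
    (matCRepl p η ξ (W⁻¹ * K * W) k₂ ζ j).map (conjHom _ (globalPower_inv_mul p hW)) =
      matCRepl p η ξ K k₂ ζ j := by
  rw [matCRepl, matCRepl, Matrix.map_updateCol, conj_matC p ξ hW hη]
  congr 1
  funext a
  rw [Function.comp_apply, map_neg, map_smul, map_one]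

theorem conj_opQ (hη : η ≠ 0) (K : Matrix (Fin 2) (Fin 2) ℂ) (k₂ ζ x : ℂ) :
    conjHom _ (globalPower_inv_mul p hW) (opQ p η ξ (W⁻¹ * K * W) k₂ ζ x) =
      opQ p η ξ K k₂ ζ x := by
  simp only [opQ, map_add, map_sum, map_mul, map_smul, map_one, conjHom_inv, map_opDet,
    conj_interpCoeff p ξ hW hη, conj_matC p ξ hW hη, conj_matCRepl p ξ hW hη]

theorem QDefined.of_conj (hη : η ≠ 0) {p : Fin N → ℕ} {ξ : Fin N → ℂ}
    {K W : Matrix (Fin 2) (Fin 2) ℂ} {k₂ ζ : ℂ} (hW : IsUnit W)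
    (h : QDefined p η ξ (W⁻¹ * K * W) k₂ ζ) : QDefined p η ξ K k₂ ζ := by
  refine ⟨h.1, ?_, fun n => ?_⟩
  · have := h.2.1.map (conjHom _ (globalPower_inv_mul p hW))
    rwa [map_opDet, conj_matC p ξ hW hη] at this
  · have := (h.2.2 n).map (conjHom _ (globalPower_inv_mul p hW))
    rwa [conj_opQ p ξ hW hη] at this

theorem QDefined.conj (hη : η ≠ 0) {p : Fin N → ℕ} {ξ : Fin N → ℂ}
    {K W : Matrix (Fin 2) (Fin 2) ℂ} {k₂ ζ : ℂ} (hW : IsUnit W)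
    (h : QDefined p η ξ K k₂ ζ) : QDefined p η ξ (W⁻¹ * K * W) k₂ ζ := by
  have hd := (Matrix.isUnit_iff_isUnit_det _).1 hW
  have hW' : IsUnit W⁻¹ := (Matrix.isUnit_nonsing_inv_iff).2 hW
  refine QDefined.of_conj hη hW' ?_
  have : W⁻¹⁻¹ * (W⁻¹ * K * W) * W⁻¹ = K := by
    rw [Matrix.nonsing_inv_nonsing_inv _ hd,
      show W * (W⁻¹ * K * W) * W⁻¹ = (W * W⁻¹) * K * (W * W⁻¹) by noncomm_ring,
      Matrix.mul_nonsing_inv _ hd, Matrix.one_mul, Matrix.mul_one]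
  rwa [this]

theorem IsRegularTwist.conj {K W : Matrix (Fin 2) (Fin 2) ℂ} {k₁ k₂ : ℂ} (hW : IsUnit W)
    (h : IsRegularTwist K k₁ k₂) : IsRegularTwist (W⁻¹ * K * W) k₁ k₂ := by
  obtain ⟨u, rfl⟩ := hW
  refine ⟨?_, h.2⟩
  rw [← h.1, ← Matrix.charpoly_units_conj' u]
  simp

variable {p ξ} {K : Matrix (Fin 2) (Fin 2) ℂ} {k₁ k₂ ζ : ℂ}

theorem vecMul_conjHom {m : Type*} [Fintype m] [DecidableEq m] {P : Matrix m m ℂ}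
    (hP : P⁻¹ * P = 1) (v : m → ℂ) (X Y Z : Matrix m m ℂ) :
    (v ᵥ* (P⁻¹ * conjHom P hP X * conjHom P hP Y)) ᵥ* conjHom P hP Z =
      (v ᵥ* (X * Y) ᵥ* Z) ᵥ* P⁻¹ := by
  simp only [Matrix.vecMul_vecMul]
  rw [Matrix.mul_assoc P⁻¹, ← map_mul, Matrix.mul_assoc, ← map_mul, conjHom_apply,
    ← Matrix.mul_assoc, ← Matrix.mul_assoc, hP, Matrix.one_mul]

variable (η ξ) in
theorem conj_raising (K : Matrix (Fin 2) (Fin 2) ℂ) (k₁ : ℂ) (h : Idx p) :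
    conjHom _ (globalPower_inv_mul p hW) (raising p η ξ (opA p η ξ (W⁻¹ * K * W)) k₁ h) =
      raising p η ξ (opATilde p η ξ K W) k₁ h := by
  simp only [raising, map_list_prod, List.map_ofFn, List.map_map, Function.comp_def, map_smul,
    conj_opA p η ξ hW]

theorem conj_qInvProd (hη : η ≠ 0) (K : Matrix (Fin 2) (Fin 2) ℂ) (k₂ ζ : ℂ) :
    conjHom _ (globalPower_inv_mul p hW) (qInvProd p η ξ (W⁻¹ * K * W) k₂ ζ) =
      qInvProd p η ξ K k₂ ζ := by
  simp only [qInvProd, map_list_prod, List.map_ofFn, Function.comp_def, conjHom_inv,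
    conj_opQ p ξ hW hη]

theorem conj_qProd (hη : η ≠ 0) (K : Matrix (Fin 2) (Fin 2) ℂ) (k₂ ζ : ℂ) (h : Idx p) :
    conjHom _ (globalPower_inv_mul p hW) (qProd p η ξ (W⁻¹ * K * W) k₂ ζ h) =
      qProd p η ξ K k₂ ζ h := by
  simp only [qProd, map_list_prod, List.map_ofFn, Function.comp_def, conj_opQ p ξ hW hη]

theorem skCovectorTilde_eq (K W : Matrix (Fin 2) (Fin 2) ℂ) (k₁ : ℂ) (h : Idx p) :
    skCovectorTilde p η ξ K W k₁ h =
      skCovector p η ξ (W⁻¹ * K * W) k₁ h ᵥ* (globalPower p W)⁻¹ := by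
  rw [skCovectorTilde, skCovector, Matrix.smul_vecMul, Matrix.vecMul_vecMul]

/-- The image under conjugation of `covL_qProd` for the twist `W⁻¹ * K * W`; all its ingredients,
including the Q-operator, are covariant. -/
theorem covLTilde_qProd (hη : η ≠ 0) (hK : IsRegularTwist K k₁ k₂) (hs : SovCondition p η ξ)
    (hQ : QDefined p η ξ K k₂ ζ) (hW : IsDressing K W) (h : Idx p) :
    covLTilde p η ξ K W k₁ k₂ ζ ᵥ* qProd p η ξ K k₂ ζ h = skCovectorTilde p η ξ K W k₁ h := by
  rw [skCovectorTilde_eq, ← covL_qProd hη (hK.conj hW.1) hs (hQ.conj hη hW.1) hW.2.1 h, covLTilde,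
    covL, ← conj_raising η ξ hW.1, ← conj_qInvProd hW.1 hη, ← conj_qProd hW.1 hη]
  simp only [Matrix.smul_vecMul]
  rw [vecMul_conjHom]

theorem skCovectorTilde_isSovEigenbasis (hη : η ≠ 0) (hK : IsRegularTwist K k₁ k₂)
    (hs : SovCondition p η ξ) (hW : IsDressing K W) :
    IsSovEigenbasis p η ξ (skCovectorTilde p η ξ K W k₁) (opBTilde p η ξ K W)
      ((W⁻¹ * K * W) 0 1) := by
  have hb := skCovector_isSovEigenbasis hη (hK.conj hW.1) hs hW.2.1
  have e4 := skCovectorTilde_eq (p := p) (η := η) (ξ := ξ) K W k₁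
  refine isSovEigenbasis_of_eigen hη hs hW.2.1 (fun h h0 => ?_) (fun h x => ?_)
  · refine hb.1.ne_zero h ?_
    have := congrArg (· ᵥ* globalPower p W) ((e4 h).symm.trans h0)
    simpa only [Matrix.vecMul_vecMul, globalPower_inv_mul p hW.1, Matrix.vecMul_one,
      Matrix.zero_vecMul] using this
  · rw [e4, ← conj_opB p η ξ hW.1, conjHom_apply, Matrix.vecMul_vecMul, ← Matrix.mul_assoc,
      ← Matrix.mul_assoc, globalPower_inv_mul p hW.1, Matrix.one_mul, ← Matrix.vecMul_vecMul,
      hb.2.2.1, Matrix.smul_vecMul]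
    rfl

theorem exists_isDressing (hK : IsRegularTwist K k₁ k₂) (h01 : K 0 1 = 0) :
    ∃ W, IsDressing K W := by
  have htr := hK.1
  have hne : K 0 0 - K 1 1 ≠ 0 := by
    intro h0
    have h1 := congrArg (Polynomial.eval k₁) htr
    have h2 := congrArg (Polynomial.eval k₂) htr
    simp only [Matrix.charpoly_fin_two, Matrix.trace_fin_two, Matrix.det_fin_two, h01,
      Polynomial.eval_add, Polynomial.eval_sub, Polynomial.eval_mul, Polynomial.eval_pow,
      Polynomial.eval_X, Polynomial.eval_C, sub_self, zero_mul, mul_zero, sub_zero] at h1 h2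
    have e : K 0 0 = K 1 1 := sub_eq_zero.1 h0
    rw [e] at h1 h2
    have h1' : (k₁ - K 1 1) ^ 2 = 0 := by linear_combination h1
    have h2' : (k₂ - K 1 1) ^ 2 = 0 := by linear_combination h2
    have h1'' := pow_eq_zero_iff two_ne_zero |>.1 h1'
    have h2'' := pow_eq_zero_iff two_ne_zero |>.1 h2'
    exact hK.2.1 (by linear_combination h1'' - h2'')
  -- The lower triangular `K` has the eigenvectors `(1, u)` and `(0, 1)`. The columns of `W` are
  -- their difference and their sum, so both off-diagonal entries of the conjugate are `(K 0 0 - K 1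
  -- 1) / 2`.
  set u := K 1 0 / (K 0 0 - K 1 1) with hu
  have hu' : K 1 0 = u * (K 0 0 - K 1 1) := by rw [hu, div_mul_cancel₀ _ hne]
  have hinv : !![(u + 1) / 2, -1 / 2; -(u - 1) / 2, 1 / 2] * !![1, 1; u - 1, u + 1] =
      (1 : Matrix (Fin 2) (Fin 2) ℂ) := by
    rw [Matrix.mul_fin_two, Matrix.one_fin_two]
    congr 3 <;> ring_nf
  have hK' : K = !![K 0 0, 0; u * (K 0 0 - K 1 1), K 1 1] := by
    rw [← hu', ← h01]
    exact Matrix.eta_fin_two K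
  refine ⟨!![1, 1; u - 1, u + 1], IsUnit.of_mul_eq_one _ (mul_eq_one_comm.1 hinv), ?_, ?_⟩
  all_goals
    rw [Matrix.inv_eq_left_inv hinv, hK', Matrix.mul_fin_two, Matrix.mul_fin_two]
    simp only [Matrix.of_apply, Matrix.cons_val_zero, Matrix.cons_val_one]
    intro h0
    apply hne
  · linear_combination 2 * h0
  · linear_combination 2 * h0

end Conjugation
end HigherSpin

namespace HigherSpin

/-! ### The scalar functional equation. -/

section Numeric

/-- `f` is a polynomial function of degree at most `d`. -/
def IsPolyLE (d : ℕ) (f : ℂ → ℂ) : Prop :=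
  ∃ P : Polynomial ℂ, P.natDegree ≤ d ∧ ∀ x, P.eval x = f x

namespace IsPolyLE

variable {d : ℕ} {f g : ℂ → ℂ}

theorem add (hf : IsPolyLE d f) (hg : IsPolyLE d g) : IsPolyLE d fun x => f x + g x := by
  obtain ⟨P, hP, hPf⟩ := hf
  obtain ⟨Q, hQ, hQg⟩ := hg
  exact ⟨P + Q, Polynomial.natDegree_add_le_of_degree_le hP hQ, fun x => by simp [hPf, hQg]⟩

theorem const_mul (hf : IsPolyLE d f) (c : ℂ) : IsPolyLE d fun x => c * f x := by
  obtain ⟨P, hP, hPf⟩ := hf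
  exact ⟨Polynomial.C c * P, (Polynomial.natDegree_C_mul_le _ _).trans hP, fun x => by simp [hPf]⟩

theorem sum {ι : Type*} (s : Finset ι) {f : ι → ℂ → ℂ} (hf : ∀ i ∈ s, IsPolyLE d (f i)) :
    IsPolyLE d fun x => ∑ i ∈ s, f i x := by
  classical
  induction s using Finset.induction_on with
  | empty => exact ⟨0, by simp, fun x => by simp⟩
  | insert i s hi ih =>
    simp only [Finset.sum_insert hi]
    exact (hf i (by simp)).add (ih fun j hj => hf j (by simp [hj]))

theorem mul {e : ℕ} (hf : IsPolyLE d f) (hg : IsPolyLE e g) :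
    IsPolyLE (d + e) fun x => f x * g x := by
  obtain ⟨P, hP, hPf⟩ := hf
  obtain ⟨Q, hQ, hQg⟩ := hg
  exact ⟨P * Q, Polynomial.natDegree_mul_le_of_le hP hQ, fun x => by simp [hPf, hQg]⟩

theorem mono {e : ℕ} (hf : IsPolyLE d f) (h : d ≤ e) : IsPolyLE e f := by
  obtain ⟨P, hP, hPf⟩ := hf
  exact ⟨P, hP.trans h, hPf⟩

theorem X_sub (c : ℂ) : IsPolyLE 1 fun x => x - c :=
  ⟨Polynomial.X - Polynomial.C c, by simp, fun x => by simp⟩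

theorem one : IsPolyLE 0 fun _ => 1 := ⟨1, by simp, fun x => by simp⟩

theorem prod {ι : Type*} (s : Finset ι) {e : ι → ℕ} {f : ι → ℂ → ℂ}
    (hf : ∀ i ∈ s, IsPolyLE (e i) (f i)) :
    IsPolyLE (∑ i ∈ s, e i) fun x => ∏ i ∈ s, f i x := by
  classical
  induction s using Finset.induction_on with
  | empty => exact one
  | insert i s hi ih =>
    simp only [Finset.prod_insert hi, Finset.sum_insert hi]
    exact (hf i (by simp)).mul (ih fun j hj => hf j (by simp [hj]))

/-- A polynomial function with more zeros than its degree vanishes. -/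
theorem eq_zero (hf : IsPolyLE d f) (s : Finset ℂ) (hs : d < s.card) (h : ∀ x ∈ s, f x = 0) (x : ℂ) :
    f x = 0 := by
  obtain ⟨P, hP, hPf⟩ := hf
  have : P = 0 := Polynomial.eq_zero_of_natDegree_lt_card_of_eval_eq_zero' P s
    (fun y hy => by rw [hPf, h y hy]) (hP.trans_lt hs)
  rw [← hPf, this, Polynomial.eval_zero]

/-- A polynomial function of degree at most `d` with `d` coinciding values at points `x` and `x + η`
is constant. -/
theorem const_of_shift (hf : IsPolyLE d f) {η : ℂ} (hη : η ≠ 0) (s : Finset ℂ) (hs : d ≤ s.card)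
    (h : ∀ x ∈ s, f (x + η) = f x) (x y : ℂ) : f x = f y := by
  obtain ⟨P, hP, hPf⟩ := hf
  -- Subtracting `P` from its shift cancels the leading term, so the difference has smaller degree
  -- and `d` zeros suffice to kill it.
  have key : P.comp (Polynomial.X + Polynomial.C η) - P = 0 := by
    by_cases h0 : P.natDegree = 0
    · obtain ⟨c, rfl⟩ := Polynomial.natDegree_eq_zero.1 h0
      simp
    have hdeg : (P.comp (Polynomial.X + Polynomial.C η)).natDegree = P.natDegree := by
      rw [Polynomial.natDegree_comp, Polynomial.natDegree_X_add_C, mul_one]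
    have hlt : (P.comp (Polynomial.X + Polynomial.C η) - P).natDegree < P.natDegree := by
      have hc0 : P.comp (Polynomial.X + Polynomial.C η) ≠ 0 := by
        intro hc; rw [hc] at hdeg; exact h0 (by rw [← hdeg]; simp)
      have hP0 : P ≠ 0 := by rintro rfl; simp at h0
      have := Polynomial.degree_sub_lt_left (p := P.comp (Polynomial.X + Polynomial.C η)) (q := P)
        (by rw [Polynomial.degree_eq_natDegree hc0, Polynomial.degree_eq_natDegree hP0, hdeg]) hc0
        (by rw [Polynomial.leadingCoeff_comp (by simp)]; simp)
      rw [← hdeg] at h0 ⊢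
      rcases eq_or_ne (P.comp (Polynomial.X + Polynomial.C η) - P) 0 with h | h
      · rw [h, Polynomial.natDegree_zero]
        omega
      · exact Polynomial.natDegree_lt_natDegree h this
    refine Polynomial.eq_zero_of_natDegree_lt_card_of_eval_eq_zero' _ s (fun y hy => ?_) (by omega)
    simp [hPf, h y hy]
  have hper : ∀ y, f (y + η) = f y := by
    intro y
    have := congrArg (Polynomial.eval y) key
    simpa [hPf, sub_eq_zero] using this
  have hper' : ∀ (y : ℂ) (n : ℕ), f (y + n * η) = f y := by
    intro y n
    induction n with
    | zero => simp
    | succ n ih => rw [← ih, ← hper (y + n * η)]; congr 1; push_cast; ring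
  have : P = Polynomial.C (f y) := by
    refine Polynomial.eq_of_infinite_eval_eq _ _
      ((Set.infinite_range_of_injective (f := fun n : ℕ => y + n * η) fun a b hab => ?_).mono ?_)
    · have := mul_right_cancel₀ hη (add_left_cancel hab)
      exact_mod_cast this
    · rintro _ ⟨n, rfl⟩
      simp [hPf, hper']
  rw [← hPf, this, Polynomial.eval_C]

end IsPolyLE

variable {N : ℕ} (p : Fin N → ℕ) (η : ℂ) (ξ : Fin N → ℂ) {ζ : ℂ}

/-- The polynomial `∏_n ∏_{i < g_n} (x - ξ_n^{(i)})`. -/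
noncomputable def lowerProd (g : Fin N → ℕ) (x : ℂ) : ℂ :=
  ∏ n, ∏ i ∈ Finset.range (g n), (x - pt p η ξ n i)

/-- After the shift the product over the string `n` runs over the indices from 1 to `g n`, and `fd`
supplies the index 0. Thus `lowerProd` solves the functional equation with the eigenvalue of the
label `g`. -/
theorem lowerProd_shift (g : Fin N → ℕ) (x : ℂ) :
    lowerProd p η ξ g (x + η) * fd p η ξ x =
      (∏ n, (x - pt p η ξ n (g n))) * lowerProd p η ξ g x := by
  rw [fd_eq, lowerProd, lowerProd, ← Finset.prod_mul_distrib, ← Finset.prod_mul_distrib]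
  refine Finset.prod_congr rfl fun n _ => ?_
  have : ∀ i, x + η - pt p η ξ n i = x - pt p η ξ n (i + 1) := by
    intro i; rw [← pt_sub]; ring
  simp only [this]
  rw [← Finset.prod_range_succ' (fun i => x - pt p η ξ n i), Finset.prod_range_succ, mul_comm]

theorem isPolyLE_lowerProd (g : Fin N → ℕ) : IsPolyLE (∑ n, g n) (lowerProd p η ξ g) := by
  have := IsPolyLE.prod Finset.univ (f := fun n x => ∏ i ∈ Finset.range (g n), (x - pt p η ξ n i))
    fun n _ => IsPolyLE.prod (Finset.range (g n)) fun i _ => IsPolyLE.X_sub (pt p η ξ n i)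
  simp only [Finset.sum_const, smul_eq_mul, mul_one, Finset.card_range] at this
  exact this

theorem isPolyLE_nodeProd : IsPolyLE (∑ n, p n) (nodeProd p η ξ) := by
  have := IsPolyLE.prod Finset.univ (f := fun n x => ∏ i ∈ Finset.Icc 1 (p n), (x - pt p η ξ n i))
    fun n _ => IsPolyLE.prod (Finset.Icc 1 (p n)) fun i _ => IsPolyLE.X_sub (pt p η ξ n i)
  simp only [Finset.sum_const, smul_eq_mul, mul_one, Nat.card_Icc, Nat.add_sub_cancel] at this
  exact this

theorem isPolyLE_nodeProdErase {b : Fin N} {h : ℕ} (h1 : 1 ≤ h) (hh : h ≤ p b) :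
    IsPolyLE (∑ n, p n - 1) (nodeProdErase p η ξ b h) := by
  have key : ∀ c k, IsPolyLE (if c = b ∧ k = h then 0 else 1)
      fun x => if c = b ∧ k = h then 1 else x - pt p η ξ c k := by
    intro c k
    split_ifs
    · exact IsPolyLE.one
    · exact IsPolyLE.X_sub _
  have := IsPolyLE.prod Finset.univ fun c _ =>
    IsPolyLE.prod (Finset.Icc 1 (p c)) fun k _ => key c k
  refine this.mono ?_
  have e : ∑ c, ∑ k ∈ Finset.Icc 1 (p c), (if c = b ∧ k = h then 0 else 1) +
      ∑ c, ∑ k ∈ Finset.Icc 1 (p c), (if c = b ∧ k = h then 1 else 0) = ∑ c, p c := by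
    rw [← Finset.sum_add_distrib]
    refine Finset.sum_congr rfl fun c _ => ?_
    rw [← Finset.sum_add_distrib]
    calc _ = ∑ k ∈ Finset.Icc 1 (p c), 1 := Finset.sum_congr rfl fun k _ => by split_ifs <;> rfl
      _ = p c := by simp
  have e2 : ∑ c, ∑ k ∈ Finset.Icc 1 (p c), (if c = b ∧ k = h then 1 else 0) = 1 := by
    rw [Finset.sum_eq_single b, Finset.sum_eq_single h]
    · simp
    · intro k _ hk; simp [hk]
    · intro h0; exact absurd (Finset.mem_Icc.2 ⟨h1, hh⟩) h0
    · intro c _ hc; simp [hc]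
    · simp
  omega

theorem isPolyLE_interp (q : Fin N → ℕ → ℂ) (b : Fin N) :
    IsPolyLE (∑ n, p n) (interp p η ξ ζ q b) := by
  refine IsPolyLE.sum _ fun h hh => ?_
  obtain ⟨h1, hh⟩ := Finset.mem_Icc.1 hh
  have hb : 1 ≤ ∑ n, p n :=
    (h1.trans hh).trans (Finset.single_le_sum (f := p) (fun _ _ => Nat.zero_le _) (Finset.mem_univ b))
  have := ((IsPolyLE.X_sub ζ).mul (isPolyLE_nodeProdErase p η ξ h1 hh)).const_mul
    (q b h * ((pt p η ξ b h - ζ)⁻¹ * (nodeProdErase p η ξ b h (pt p η ξ b h))⁻¹))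
  rw [Nat.add_sub_cancel' hb] at this
  obtain ⟨P, hP, hPf⟩ := this
  refine ⟨P, hP, fun x => ?_⟩
  simp only [hPf, smul_eq_mul, div_eq_mul_inv]
  ring

theorem isPolyLE_interpQ (q : Fin N → ℕ → ℂ) (d : Fin N → ℂ) :
    IsPolyLE (∑ n, p n) (interpQ p η ξ ζ q d) := by
  have := (IsPolyLE.sum Finset.univ fun b _ => (isPolyLE_interp (ζ := ζ) p η ξ q b).const_mul (d b)).add
    ((isPolyLE_nodeProd p η ξ).const_mul (nodeProd p η ξ ζ)⁻¹)
  obtain ⟨P, hP, hPf⟩ := this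
  refine ⟨P, hP, fun x => ?_⟩
  rw [hPf, interpQ, smul_eq_mul, mul_one, div_eq_mul_inv, mul_comm (nodeProd p η ξ x)]
  refine congrArg₂ (· + ·) ?_ rfl
  exact Finset.sum_congr rfl fun b _ => mul_comm (d b) (interp p η ξ ζ q b x)

variable {p η ξ}

/-- The points with the labels from a family of ranges, as a finite set. -/
theorem exists_pts (hη : η ≠ 0) (hs : SovCondition p η ξ) (r : Fin N → Finset ℕ)
    (hr : ∀ n, ∀ k ∈ r n, k ≤ p n) :
    ∃ s : Finset ℂ, s.card = ∑ n, (r n).card ∧ ∀ x, x ∈ s ↔ ∃ n, ∃ k ∈ r n, x = pt p η ξ n k := by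
  classical
  refine ⟨(Finset.univ.sigma r).image fun i => pt p η ξ i.1 i.2, ?_, fun x => ?_⟩
  · rw [Finset.card_image_of_injOn, Finset.card_sigma]
    rintro ⟨a, h⟩ ha ⟨b, k⟩ hb hab
    simp only [Finset.coe_sigma, Set.mem_sigma_iff, Finset.mem_coe] at ha hb
    have h1 := hr a h ha.2
    have h2 := hr b k hb.2
    by_cases e : a = b
    · subst e
      have := pt_injective hη a hab
      simp only at this
      rw [this]
    · exact absurd hab (hs a b e h h1 k h2)
  · simp only [Finset.mem_image, Finset.mem_sigma, Finset.mem_univ, true_and, Sigma.exists]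
    constructor
    · rintro ⟨n, k, hk, rfl⟩; exact ⟨n, k, hk, rfl⟩
    · rintro ⟨n, k, hk, rfl⟩; exact ⟨n, k, hk, rfl⟩

/-- The prescribed zeros are pairwise distinct, so their linear factors are coprime and the product
of all of them divides. -/
theorem IsPolyLE.exists_factor {d : ℕ} {f : ℂ → ℂ} (hη : η ≠ 0) (hs : SovCondition p η ξ)
    (g : Fin N → ℕ) (hg : ∀ n, g n ≤ p n) (hf : IsPolyLE (∑ n, g n + d) f)
    (h0 : ∀ n, ∀ k < g n, f (pt p η ξ n k) = 0) :
    ∃ r, IsPolyLE d r ∧ ∀ x, f x = lowerProd p η ξ g x * r x := by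
  classical
  obtain ⟨P, hP, hPf⟩ := hf
  let M : Polynomial ℂ := ∏ i ∈ Finset.univ.sigma fun n => Finset.range (g n),
    (Polynomial.X - Polynomial.C (pt p η ξ i.1 i.2))
  have hM : M ∣ P := by
    refine Finset.prod_dvd_of_coprime ?_ ?_
    · rintro ⟨a, h⟩ ha ⟨b, k⟩ hb hab
      simp only [Finset.coe_sigma, Set.mem_sigma_iff, Finset.mem_coe, Finset.mem_range] at ha hb
      refine Polynomial.isCoprime_X_sub_C_of_isUnit_sub ?_
      rw [isUnit_iff_ne_zero]
      refine hs.pt_ne hη (ha.2.le.trans (hg a)) (hb.2.le.trans (hg b)) ?_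
      by_contra hc
      push Not at hc
      obtain ⟨rfl, rfl⟩ := hc
      exact hab rfl
    · rintro ⟨a, h⟩ ha
      simp only [Finset.mem_sigma, Finset.mem_univ, true_and, Finset.mem_range] at ha
      rw [Polynomial.dvd_iff_isRoot, Polynomial.IsRoot, hPf]
      exact h0 a h ha
  have hMdeg : M.natDegree = ∑ n, g n := by
    rw [Polynomial.natDegree_prod_of_monic _ _ fun i _ => Polynomial.monic_X_sub_C _]
    simp
  have hMmon : M.Monic := Polynomial.monic_prod_of_monic _ _ fun i _ => Polynomial.monic_X_sub_C _
  have hMe : ∀ x, M.eval x = lowerProd p η ξ g x := by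
    intro x
    simp only [M, Polynomial.eval_prod, lowerProd, Finset.prod_sigma]
    simp
  obtain ⟨R, rfl⟩ := hM
  refine ⟨fun x => R.eval x, ⟨R, ?_, fun x => rfl⟩, fun x => ?_⟩
  · rcases eq_or_ne R 0 with rfl | hR
    · simp
    · rw [hMmon.natDegree_mul' hR, hMdeg] at hP
      omega
  · rw [← hPf, Polynomial.eval_mul, hMe]

/-- The values of `q` satisfy the functional equation with the eigenvalue `∏_n (x - ξ_n^{(g_n)})`. -/
def IsString (p : Fin N → ℕ) (η : ℂ) (ξ : Fin N → ℂ) (g : Fin N → ℕ) (q : Fin N → ℕ → ℂ) : Prop :=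
  (∀ a, q a (p a) = 1) ∧ ∀ a, ∀ j < p a,
    q a j * fd p η ξ (pt p η ξ a (j + 1)) =
      (∏ n, (pt p η ξ a (j + 1) - pt p η ξ n (g n))) * q a (j + 1)

variable {g : Fin N → ℕ} {q : Fin N → ℕ → ℂ}

/-- The eigenvalue vanishes at the point with index `g a`, which forces the preceding value to be
zero; the recursion carries this back to the start of the string. -/
theorem IsString.eq_zero (hq : IsString p η ξ g q) (hη : η ≠ 0) (hs : SovCondition p η ξ)
    (hg : ∀ n, g n ≤ p n) {a : Fin N} {j : ℕ} (hj : j < g a) : q a j = 0 := by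
  have hga := hg a
  have step : ∀ j < p a, (j + 1 = g a ∨ q a (j + 1) = 0) → q a j = 0 := by
    intro j hj h
    have e := hq.2 a j hj
    have : (∏ n, (pt p η ξ a (j + 1) - pt p η ξ n (g n))) * q a (j + 1) = 0 := by
      rcases h with h | h
      · rw [Finset.prod_eq_zero (Finset.mem_univ a) (by rw [h, sub_self]), zero_mul]
      · rw [h, mul_zero]
    rw [this] at e
    exact (mul_eq_zero.1 e).resolve_right (hs.fd_ne hη (by omega) (by omega))
  obtain ⟨m, hm⟩ : ∃ m, g a = j + 1 + m := ⟨g a - (j + 1), by omega⟩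
  induction m generalizing j with
  | zero => exact step j (by omega) (Or.inl (by omega))
  | succ m ih => exact step j (by omega) (Or.inr (ih (by omega) (by omega)))

theorem lowerProd_ne (hη : η ≠ 0) (hs : SovCondition p η ξ) (hg : ∀ n, g n ≤ p n) {a : Fin N}
    {j : ℕ} (hj : g a ≤ j) (hjp : j ≤ p a) : lowerProd p η ξ g (pt p η ξ a j) ≠ 0 := by
  refine Finset.prod_ne_zero_iff.2 fun n _ => Finset.prod_ne_zero_iff.2 fun i hi => ?_
  rw [Finset.mem_range] at hi
  refine hs.pt_ne hη hjp (hi.le.trans (hg n)) ?_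
  by_cases e : a = n
  · subst e; right; omega
  · exact Or.inl e

/-- By `IsString.eq_zero` the polynomial is divisible by `lowerProd`. At the points past the label
both satisfy the same recursion, so the quotient agrees at `y` and `y + η` for as many `y` as its
degree bound. It is therefore constant, and the zero at `ζ` makes it zero. -/
theorem IsString.unique (hq : IsString p η ξ g q) (hη : η ≠ 0) (hs : SovCondition p η ξ)
    (hg : ∀ n, g n ≤ p n) (hζ : ∀ n, ∀ k ≤ p n, ζ ≠ pt p η ξ n k) {f : ℂ → ℂ}
    (hf : IsPolyLE (∑ n, p n) f) (hfζ : f ζ = 0) {d : Fin N → ℂ}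
    (hd : ∀ a, ∀ j ≤ p a, f (pt p η ξ a j) = q a j * d a) (x : ℂ) : f x = 0 := by
  have hsum : ∑ n, p n = ∑ n, g n + ∑ n, (p n - g n) := by
    rw [← Finset.sum_add_distrib]
    exact Finset.sum_congr rfl fun n _ => by have := hg n; omega
  rw [hsum] at hf
  obtain ⟨r, hr, hfr⟩ := hf.exists_factor hη hs g hg fun n k hk => by
    rw [hd n k (hk.le.trans (hg n)), hq.eq_zero hη hs hg hk, zero_mul]
  obtain ⟨s, hsc, hsm⟩ := exists_pts hη hs (fun n => Finset.Icc (g n + 1) (p n))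
    fun n k hk => (Finset.mem_Icc.1 hk).2
  have hconst := hr.const_of_shift hη s (by rw [hsc]; simp) fun y hy => by
    obtain ⟨a, k, hk, rfl⟩ := (hsm y).1 hy
    obtain ⟨h1, h2⟩ := Finset.mem_Icc.1 hk
    obtain ⟨j, rfl⟩ : ∃ j, k = j + 1 := ⟨k - 1, by omega⟩
    have e1 := hq.2 a j (by omega)
    have e2 := lowerProd_shift p η ξ g (pt p η ξ a (j + 1))
    have ej : pt p η ξ a (j + 1) + η = pt p η ξ a j := by rw [← pt_sub]; ring
    rw [ej] at e2 ⊢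
    have e3 := hd a j (by omega)
    have e4 := hd a (j + 1) h2
    rw [hfr] at e3 e4
    have n1 := lowerProd_ne hη hs hg (a := a) (j := j) (by omega) (by omega)
    have n2 := hs.fd_ne hη h2 (by omega)
    refine mul_left_cancel₀ (mul_ne_zero n1 n2) ?_
    linear_combination (fd p η ξ (pt p η ξ a (j + 1))) * e3 + d a * e1
      - (∏ n, (pt p η ξ a (j + 1) - pt p η ξ n (g n))) * e4 - r (pt p η ξ a (j + 1)) * e2
  have hζ0 : lowerProd p η ξ g ζ ≠ 0 :=
    Finset.prod_ne_zero_iff.2 fun n _ => Finset.prod_ne_zero_iff.2 fun i hi =>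
      sub_ne_zero.2 (hζ n i ((Finset.mem_range.1 hi).le.trans (hg n)))
  rw [hfr] at hfζ
  rw [hfr, hconst x ζ, (mul_eq_zero.1 hfζ).resolve_left hζ0, mul_zero]

theorem interp_base (b : Fin N) : interp p η ξ ζ q b ζ = 0 := by
  rw [interp]
  exact Finset.sum_eq_zero fun h _ => by rw [sub_self, zero_div, zero_mul, zero_smul]

/-- A kernel vector yields an interpolant that vanishes at `ζ` and is proportional to `q` on every
string. It is zero by uniqueness, and its values at the last points are the components of the
vector. -/
theorem IsString.det_ne_zero (hq : IsString p η ξ g q) (hη : η ≠ 0) (hs : SovCondition p η ξ)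
    (hg : ∀ n, g n ≤ p n) (hζ : ∀ n, ∀ k ≤ p n, ζ ≠ pt p η ξ n k) :
    (interpMat p η ξ ζ q).det ≠ 0 := by
  intro hdet
  obtain ⟨v, hv0, hv⟩ := Matrix.exists_mulVec_eq_zero_iff.2 hdet
  have hζ' : ∀ n, ∀ k, 1 ≤ k → k ≤ p n → ζ ≠ pt p η ξ n k := fun n k _ hk => hζ n k hk
  have hf : IsPolyLE (∑ n, p n) fun x => ∑ b, v b * interp p η ξ ζ q b x :=
    IsPolyLE.sum _ fun b _ => (isPolyLE_interp p η ξ q b).const_mul _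
  have hd : ∀ a, ∀ j ≤ p a, ∑ b, v b * interp p η ξ ζ q b (pt p η ξ a j) = q a j * v a := by
    intro a j hj
    rcases Nat.eq_zero_or_pos j with rfl | h1
    · have h := congrFun hv a
      rw [Matrix.mulVec, dotProduct] at h
      simp only [interpMat, Matrix.of_apply, add_mul, Finset.sum_add_distrib, ite_mul, zero_mul,
        Finset.sum_ite_eq, Finset.mem_univ, if_true, Pi.zero_apply] at h
      simp only [mul_comm (v _)]
      linear_combination h
    · simp only [interp_node q hη hs hζ' _ h1 hj]
      simp [mul_comm]
  have h0 := hq.unique hη hs hg hζ hf (by simp [interp_base]) hd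
  refine hv0 (funext fun a => ?_)
  have := hd a (p a) le_rfl
  rw [hq.1, one_mul] at this
  rw [← this]
  exact h0 _

/-- Normalized at `ζ`, `lowerProd` solves the linear system explicitly, with nonzero values at the
last points. Cramer's vector is this solution times the determinant. -/
theorem IsString.cramer_ne_zero (hq : IsString p η ξ g q) (hη : η ≠ 0) (hs : SovCondition p η ξ)
    (hg : ∀ n, g n ≤ p n) (hζ : ∀ n, ∀ k ≤ p n, ζ ≠ pt p η ξ n k) (b : Fin N) :
    (interpMat p η ξ ζ q).cramer (interpRhs p η ξ ζ ℂ) b ≠ 0 := by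
  have hζ' : ∀ n, ∀ k, 1 ≤ k → k ≤ p n → ζ ≠ pt p η ξ n k := fun n k _ hk => hζ n k hk
  have hζ0 : lowerProd p η ξ g ζ ≠ 0 :=
    Finset.prod_ne_zero_iff.2 fun n _ => Finset.prod_ne_zero_iff.2 fun i hi =>
      sub_ne_zero.2 (hζ n i ((Finset.mem_range.1 hi).le.trans (hg n)))
  set f : ℂ → ℂ := fun x => (lowerProd p η ξ g ζ)⁻¹ * lowerProd p η ξ g x with hf
  set d : Fin N → ℂ := fun a => f (pt p η ξ a (p a)) with hd
  have hval : ∀ a, ∀ j ≤ p a, f (pt p η ξ a j) = q a j * d a := by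
    intro a j hj
    obtain ⟨m, hm⟩ : ∃ m, p a = j + m := ⟨p a - j, by omega⟩
    induction m generalizing j with
    | zero => rw [show j = p a by omega, hq.1, one_mul]
    | succ m ih =>
      have e := ih (j + 1) (by omega) (by omega)
      have e1 := hq.2 a j (by omega)
      have e2 := lowerProd_shift p η ξ g (pt p η ξ a (j + 1))
      have ej : pt p η ξ a (j + 1) + η = pt p η ξ a j := by rw [← pt_sub]; ring
      rw [ej] at e2
      refine mul_right_cancel₀ (hs.fd_ne hη (n := a) (k := j + 1) (by omega) (by omega)) ?_
      simp only [hf] at e ⊢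
      linear_combination (lowerProd p η ξ g ζ)⁻¹ * e2 - d a * e1
        + (∏ n, (pt p η ξ a (j + 1) - pt p η ξ n (g n))) * e
  have hdiff : ∀ x, f x + -1 * interpQ p η ξ ζ q d x = 0 := by
    have hpoly : IsPolyLE (∑ n, p n) fun x => f x + -1 * interpQ p η ξ ζ q d x :=
      (((isPolyLE_lowerProd p η ξ g).mono (Finset.sum_le_sum fun n _ => hg n)).const_mul _).add
        ((isPolyLE_interpQ p η ξ q d).const_mul _)
    obtain ⟨s, hsc, hsm⟩ := exists_pts hη hs (fun n => Finset.Icc 1 (p n))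
      fun n k hk => (Finset.mem_Icc.1 hk).2
    have hns : ζ ∉ s := by
      intro h
      obtain ⟨n, k, hk, e⟩ := (hsm ζ).1 h
      exact hζ n k (Finset.mem_Icc.1 hk).2 e
    -- Agreement at `ζ` and at all nodes is agreement at one point more than the degree bound.
    refine hpoly.eq_zero (insert ζ s) ?_ ?_
    · rw [Finset.card_insert_of_notMem hns, hsc]
      simp
    · intro x hx
      rcases Finset.mem_insert.1 hx with rfl | hx
      · rw [interpQ]
        simp only [interp_base, zero_mul, Finset.sum_const_zero, zero_add, hf]
        rw [inv_mul_cancel₀ hζ0, div_self (nodeProd_ne_zero hζ')]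
        simp
      · obtain ⟨n, k, hk, rfl⟩ := (hsm x).1 hx
        obtain ⟨h1, h2⟩ := Finset.mem_Icc.1 hk
        rw [interpQ_node q hη hs hζ' d h1 h2, hval n k h2]
        ring
  have hsol : interpMat p η ξ ζ q *ᵥ d = interpRhs p η ξ ζ ℂ := by
    funext a
    rw [Matrix.mulVec, dotProduct]
    simp only [interpMat, Matrix.of_apply, add_mul, Finset.sum_add_distrib, ite_mul, zero_mul,
      Finset.sum_ite_eq, Finset.mem_univ, if_true, interpRhs]
    have e1 := hdiff (pt p η ξ a 0)
    rw [hval a 0 (Nat.zero_le _), interpQ] at e1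
    linear_combination -e1
  rw [← hsol, Matrix.cramer_eq_adjugate_mulVec, Matrix.mulVec_mulVec, Matrix.adjugate_mul,
    Matrix.smul_mulVec, Matrix.one_mulVec]
  refine mul_ne_zero (hq.det_ne_zero hη hs hg hζ) ?_
  exact mul_ne_zero (inv_ne_zero hζ0) (lowerProd_ne hη hs hg (hg b) le_rfl)

end Numeric
end HigherSpin

namespace HigherSpin

/-! ### Triangularity at the degenerate twist. -/

section Triangular

variable {N : ℕ} {p : Fin N → ℕ}

/-- The weight `∑_n n h_n` of a label. -/
def labelWeight (h : Idx p) : ℕ := ∑ n : Fin N, (n : ℕ) * (h n : ℕ)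

theorem labelWeight_eq_add {h h' : Idx p} {n : Fin N} (ho : ∀ m, m ≠ n → h m = h' m)
    (hn : (h' n : ℕ) = h n + 1) : labelWeight h' = labelWeight h + n := by
  have e : ∑ m ∈ Finset.univ.erase n, ((m : Fin N) : ℕ) * (h' m : ℕ) =
      ∑ m ∈ Finset.univ.erase n, ((m : Fin N) : ℕ) * (h m : ℕ) :=
    Finset.sum_congr rfl fun m hm => by rw [ho m (Finset.ne_of_mem_erase hm)]
  rw [labelWeight, labelWeight, ← Finset.add_sum_erase _ _ (Finset.mem_univ n), e,
    ← Finset.add_sum_erase Finset.univ (fun m : Fin N => (m : ℕ) * (h m : ℕ)) (Finset.mem_univ n), hn]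
  ring

/-- `X` is triangular with respect to the weight, with the diagonal `f`. -/
def IsTriangular (X : Op p) (f : Idx p → ℂ) : Prop :=
  (∀ h h', X h h' ≠ 0 → h = h' ∨ labelWeight h < labelWeight h') ∧ ∀ h, X h h = f h

namespace IsTriangular

variable {X Y : Op p} {f g : Idx p → ℂ}

theorem congr (hX : IsTriangular X f) (h : ∀ i, f i = g i) : IsTriangular X g :=
  ⟨hX.1, fun i => (hX.2 i).trans (h i)⟩

theorem smul_one (c : ℂ) : IsTriangular (p := p) (c • 1) fun _ => c :=
  ⟨fun h h' hh => Or.inl (by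
    by_contra hc
    exact hh (by rw [Matrix.smul_apply, Matrix.one_apply_ne hc, smul_zero])),
    fun h => by simp⟩

theorem one : IsTriangular (p := p) 1 fun _ => 1 := by
  have := smul_one (p := p) 1
  rwa [one_smul] at this

theorem zero : IsTriangular (p := p) 0 fun _ => 0 := by
  have := smul_one (p := p) 0
  rwa [zero_smul] at this

theorem add (hX : IsTriangular X f) (hY : IsTriangular Y g) :
    IsTriangular (X + Y) fun h => f h + g h := by
  refine ⟨fun h h' hh => ?_, fun h => by rw [Matrix.add_apply, hX.2, hY.2]⟩
  by_cases hx : X h h' = 0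
  · exact hY.1 h h' fun hy => hh (by rw [Matrix.add_apply, hx, hy, add_zero])
  · exact hX.1 h h' hx

theorem mul (hX : IsTriangular X f) (hY : IsTriangular Y g) :
    IsTriangular (X * Y) fun h => f h * g h := by
  refine ⟨fun h h' hh => ?_, fun h => ?_⟩
  · rw [Matrix.mul_apply] at hh
    obtain ⟨j, -, hj⟩ := Finset.exists_ne_zero_of_sum_ne_zero hh
    rcases hX.1 h j (left_ne_zero_of_mul hj) with rfl | h1 <;>
      rcases hY.1 _ h' (right_ne_zero_of_mul hj) with rfl | h2
    · exact Or.inl rfl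
    · exact Or.inr h2
    · exact Or.inr h1
    · exact Or.inr (h1.trans h2)
  · rw [Matrix.mul_apply, Finset.sum_eq_single h, hX.2, hY.2]
    · intro j _ hj
      by_contra hc
      rcases hX.1 h j (left_ne_zero_of_mul hc) with rfl | h1
      · exact hj rfl
      rcases hY.1 j h (right_ne_zero_of_mul hc) with rfl | h2
      · exact hj rfl
      omega
    · simp

theorem smul (hX : IsTriangular X f) (c : ℂ) : IsTriangular (c • X) fun h => c * f h := by
  have := (smul_one (p := p) c).mul hX
  rwa [smul_mul_assoc, one_mul] at this

theorem zsmul (hX : IsTriangular X f) (c : ℤ) : IsTriangular (c • X) fun h => c • f h := by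
  have := hX.smul (c : ℂ)
  rw [Int.cast_smul_eq_zsmul] at this
  exact this.congr fun h => by rw [zsmul_eq_mul]

theorem neg (hX : IsTriangular X f) : IsTriangular (-X) fun h => -f h := by
  have := hX.smul (-1)
  rw [neg_one_smul] at this
  exact this.congr fun h => by ring

theorem sum {ι : Type*} (s : Finset ι) {X : ι → Op p} {f : ι → Idx p → ℂ}
    (hX : ∀ i ∈ s, IsTriangular (X i) (f i)) :
    IsTriangular (∑ i ∈ s, X i) fun h => ∑ i ∈ s, f i h := by
  classical
  induction s using Finset.induction_on with
  | empty => simpa using zero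
  | insert i s hi ih =>
    simp only [Finset.sum_insert hi]
    exact (hX i (by simp)).add (ih fun j hj => hX j (by simp [hj]))

theorem list_prod {k : ℕ} {X : Fin k → Op p} {f : Fin k → Idx p → ℂ}
    (hX : ∀ i, IsTriangular (X i) (f i)) :
    IsTriangular (List.ofFn X).prod fun h => ∏ i, f i h := by
  induction k with
  | zero => simpa using one
  | succ k ih =>
    rw [List.ofFn_succ, List.prod_cons]
    exact ((hX 0).mul (ih fun i => hX i.succ)).congr fun h => by rw [Fin.prod_univ_succ]

/-- Diagonals of triangular operators add and multiply, so the Leibniz formula passes to the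
diagonal entries without any commutativity of the operators. -/
theorem opDet {M : Matrix (Fin N) (Fin N) (Op p)} {m : Idx p → Matrix (Fin N) (Fin N) ℂ}
    (hM : ∀ a b, IsTriangular (M a b) fun h => m h a b) :
    IsTriangular (opDet p M) fun h => (m h).det := by
  refine (IsTriangular.sum Finset.univ fun σ _ =>
    (IsTriangular.list_prod fun i => hM (σ i) i).zsmul (Equiv.Perm.sign σ : ℤˣ)).congr fun h => ?_
  rw [Matrix.det_apply]
  rfl

/-- Sorted by weight the operator is block triangular, and its diagonal blocks are diagonal matrices
because distinct labels of equal weight are not connected. -/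
theorem isUnit (hX : IsTriangular X f) (hf : ∀ h, f h ≠ 0) : IsUnit X := by
  rw [Matrix.isUnit_iff_isUnit_det, isUnit_iff_ne_zero]
  have hb : X.BlockTriangular labelWeight := fun i j hij => by
    by_contra hc
    rcases hX.1 i j hc with rfl | h
    · exact lt_irrefl _ hij
    · omega
  rw [hb.det]
  refine Finset.prod_ne_zero_iff.2 fun a _ => ?_
  have : X.toSquareBlock labelWeight a = Matrix.diagonal fun i => f i.1 := by
    ext i j
    rw [Matrix.toSquareBlock_def, Matrix.of_apply]
    by_cases hij : i = j
    · subst hij; rw [Matrix.diagonal_apply_eq, hX.2]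
    · rw [Matrix.diagonal_apply_ne _ hij]
      by_contra hc
      rcases hX.1 _ _ hc with h | h
      · exact hij (Subtype.ext h)
      · rw [i.2, j.2] at h
        exact lt_irrefl _ h
  rw [this, Matrix.det_diagonal]
  exact Finset.prod_ne_zero_iff.2 fun i _ => hf i.1

end IsTriangular

variable (η : ℂ) (ξ : Fin N → ℂ) {ζ : ℂ}

theorem siteLax_diag_ne {n : Fin N} {x : ℂ} {i : Fin 2} {h h' : Idx p}
    (hh : siteLax p η ξ n x i i h h' ≠ 0) : h = h' := by
  rw [siteLax, Matrix.map_apply, siteOp_apply] at hh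
  have ho : ∀ m, m ≠ n → h m = h' m := by
    by_contra hc; rw [if_neg hc] at hh; exact hh rfl
  rw [if_pos ho] at hh
  funext m
  by_cases hm : m = n
  · subst hm
    by_contra hc
    refine hh ?_
    rw [lax_apply]
    fin_cases i <;> simp [spinMat, spinZ, hc]
  · exact ho m hm

theorem siteLax_one_one (n : Fin N) (x : ℂ) (h : Idx p) :
    siteLax p η ξ n x 1 1 h h = x - pt p η ξ n (h n) := by
  rw [siteLax, Matrix.map_apply, siteOp_apply, if_pos fun _ _ => rfl, lax_apply]
  simp [spinMat, spinZ, pt]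
  ring

theorem siteLax_one_zero_ne {n : Fin N} {x : ℂ} {h h' : Idx p}
    (hh : siteLax p η ξ n x 1 0 h h' ≠ 0) : labelWeight h' = labelWeight h + n := by
  rw [siteLax, Matrix.map_apply, siteOp_apply] at hh
  have ho : ∀ m, m ≠ n → h m = h' m := by
    by_contra hc; rw [if_neg hc] at hh; exact hh rfl
  rw [if_pos ho] at hh
  refine labelWeight_eq_add ho ?_
  by_contra hc
  refine hh ?_
  rw [lax_apply]
  simp [spinMat, spinPlus, Ne.symm hc]

theorem siteLax_zero_one_ne {n : Fin N} {x : ℂ} {h h' : Idx p}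
    (hh : siteLax p η ξ n x 0 1 h h' ≠ 0) : labelWeight h = labelWeight h' + n := by
  rw [siteLax, Matrix.map_apply, siteOp_apply] at hh
  have ho : ∀ m, m ≠ n → h m = h' m := by
    by_contra hc; rw [if_neg hc] at hh; exact hh rfl
  rw [if_pos ho] at hh
  refine labelWeight_eq_add (fun m hm => (ho m hm).symm) ?_
  by_contra hc
  refine hh ?_
  rw [lax_apply]
  simp [spinMat, spinMinus, spinPlus, Ne.symm hc]

/-- Sites enter in decreasing order. An auxiliary path that leaves 1 at the site `n` raises the
label there, and it returns to 1 at a site `m < n`, lowering the label there: the weight grows by `n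
- m`. The bound `M` controls the paths that start in 0 and have yet to return. -/
theorem siteLax_prod_triangular (x : ℂ) (L : List (Fin N)) (hL : L.Pairwise (· > ·)) (M : ℕ)
    (hM : ∀ n ∈ L, (n : ℕ) < M) :
    IsTriangular ((L.map fun n => siteLax p η ξ n x).prod 1 1)
        (fun h => (L.map fun n => x - pt p η ξ n (h n)).prod) ∧
      ∀ h h', (L.map fun n => siteLax p η ξ n x).prod 0 1 h h' ≠ 0 →
        labelWeight h < labelWeight h' + M := by
  induction L generalizing M with
  | nil =>
    simp only [List.map_nil, List.prod_nil, Matrix.one_apply_eq]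
    refine ⟨IsTriangular.one, fun h h' hh => ?_⟩
    simp at hh
  | cons n L ih =>
    rw [List.pairwise_cons] at hL
    obtain ⟨h11, h01⟩ := ih hL.2 n fun m hm => hL.1 m hm
    have hn : (n : ℕ) < M := hM n (by simp)
    simp only [List.map_cons, List.prod_cons, Matrix.mul_apply, Fin.sum_univ_two]
    set Y := (L.map fun n => siteLax p η ξ n x).prod
    refine ⟨?_, fun h h' hh => ?_⟩
    · have t1 : IsTriangular (siteLax p η ξ n x 1 0 * Y 0 1) fun _ => 0 := by
        have key : ∀ h h', (siteLax p η ξ n x 1 0 * Y 0 1) h h' ≠ 0 →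
            labelWeight h < labelWeight h' := by
          intro h h' hh
          rw [Matrix.mul_apply] at hh
          obtain ⟨j, -, hj⟩ := Finset.exists_ne_zero_of_sum_ne_zero hh
          have e1 := siteLax_one_zero_ne η ξ (left_ne_zero_of_mul hj)
          have e2 := h01 _ _ (right_ne_zero_of_mul hj)
          omega
        refine ⟨fun h h' hh => Or.inr (key h h' hh), fun h => ?_⟩
        by_contra hc
        exact lt_irrefl _ (key h h hc)
      have t2 : IsTriangular (siteLax p η ξ n x 1 1) fun h => x - pt p η ξ n (h n) :=
        ⟨fun h h' hh => Or.inl (siteLax_diag_ne η ξ hh), siteLax_one_one η ξ n x⟩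
      exact (t1.add (t2.mul h11)).congr fun h => zero_add _
    · rw [Matrix.add_apply] at hh
      by_cases hx : (siteLax p η ξ n x 0 0 * Y 0 1) h h' = 0
      · rw [hx, zero_add, Matrix.mul_apply] at hh
        obtain ⟨j, -, hj⟩ := Finset.exists_ne_zero_of_sum_ne_zero hh
        have e1 := siteLax_zero_one_ne η ξ (left_ne_zero_of_mul hj)
        rcases h11.1 _ _ (right_ne_zero_of_mul hj) with rfl | e2 <;> omega
      · rw [Matrix.mul_apply] at hx
        obtain ⟨j, -, hj⟩ := Finset.exists_ne_zero_of_sum_ne_zero hx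
        obtain rfl := siteLax_diag_ne η ξ (left_ne_zero_of_mul hj)
        have e2 := h01 _ _ (right_ne_zero_of_mul hj)
        omega

theorem sites_pairwise : (sites N).Pairwise (· > ·) := by
  rw [sites, List.pairwise_ofFn]
  exact fun i j hij => Fin.rev_lt_rev.2 hij

theorem transfer_degenerate (x : ℂ) :
    IsTriangular (transfer p η ξ !![0, 0; 0, 1] x) fun h => ∏ n, (x - pt p η ξ n (h n)) := by
  have e : transfer p η ξ !![0, 0; 0, 1] x = ((sites N).map fun n => siteLax p η ξ n x).prod 1 1 := by
    rw [transfer, monodromy_eq, Matrix.trace_fin_two, Matrix.mul_apply, Matrix.mul_apply]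
    simp [auxMat]
  rw [e]
  exact (siteLax_prod_triangular η ξ x (sites N) sites_pairwise N fun n _ => n.2).1.congr fun h =>
    prod_sites _

/-- The degenerate twist has determinant zero, so the fusion recursion loses its second term and
fusion is a plain product of transfer matrices. -/
theorem fusedTransfer_degenerate {η : ℂ} (hη : η ≠ 0) (l : ℕ) (x : ℂ) :
    IsTriangular (fusedTransfer p η ξ !![0, 0; 0, 1] l x)
      fun h => ∏ i ∈ Finset.range l, ∏ n, (x + i * η - pt p η ξ n (h n)) := by
  have key : ∀ l : ℕ, fusedTransfer p η ξ !![0, 0; 0, 1] (l + 1) x =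
      transfer p η ξ !![0, 0; 0, 1] (x + l * η) * fusedTransfer p η ξ !![0, 0; 0, 1] l x := by
    rintro (_ | l)
    · rw [zero_add, fusedTransfer_one p η ξ hη, fusedTransfer_zero p η ξ hη]
      simp
    · rw [fusedTransfer_succ_succ p η ξ hη]
      simp [Matrix.det_fin_two]
  induction l with
  | zero =>
    rw [fusedTransfer_zero p η ξ hη]
    simpa using IsTriangular.one
  | succ l ih =>
    rw [key]
    exact ((transfer_degenerate η ξ _).mul ih).congr fun h => by
      rw [Finset.prod_range_succ, mul_comm]

/-- The diagonal entries of the operators `qVal` for the degenerate twist. -/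
noncomputable def degenerateString (p : Fin N → ℕ) (η : ℂ) (ξ : Fin N → ℂ) (g : Fin N → ℕ)
    (a : Fin N) (j : ℕ) : ℂ :=
  ∏ i ∈ Finset.range (p a - j),
    (∏ n, (pt p η ξ a (p a - i) - pt p η ξ n (g n))) / fd p η ξ (pt p η ξ a (p a - i))

variable {η ξ}

theorem qVal_degenerate (hη : η ≠ 0) (a : Fin N) (j : ℕ) :
    IsTriangular (qVal p η ξ !![0, 0; 0, 1] 1 a j)
      fun h => degenerateString p η ξ (fun n => h n) a j := by
  refine ((fusedTransfer_degenerate ξ hη _ _).smul _).congr fun h => ?_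
  rw [degenerateString, Finset.prod_div_distrib, one_pow, one_mul, div_eq_inv_mul]
  congr 1
  refine Finset.prod_congr rfl fun i hi => ?_
  rw [Finset.mem_range] at hi
  rw [pt_add p η ξ a (by omega)]

theorem isString_degenerate (hη : η ≠ 0) (hs : SovCondition p η ξ) (g : Fin N → ℕ) :
    IsString p η ξ g (degenerateString p η ξ g) := by
  refine ⟨fun a => by simp [degenerateString], fun a j hj => ?_⟩
  have e : p a - j = p a - (j + 1) + 1 := by omega
  have e' : p a - (p a - (j + 1)) = j + 1 := by omega
  have hd := hs.fd_ne hη (n := a) (k := j + 1) (by omega) (by omega)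
  rw [degenerateString, e, Finset.prod_range_succ, e', degenerateString]
  field_simp

theorem interpCoeff_degenerate (hη : η ≠ 0) (b : Fin N) (x : ℂ) :
    IsTriangular (interpCoeff p η ξ !![0, 0; 0, 1] 1 ζ b x)
      fun h => interp p η ξ ζ (degenerateString p η ξ fun n => h n) b x :=
  IsTriangular.sum _ fun _ _ => (qVal_degenerate hη b _).smul _

theorem matC_degenerate (hη : η ≠ 0) (a b : Fin N) :
    IsTriangular (matC p η ξ !![0, 0; 0, 1] 1 ζ a b)
      fun h => interpMat p η ξ ζ (degenerateString p η ξ fun n => h n) a b := by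
  simp only [matC, interpMat, Matrix.of_apply]
  refine IsTriangular.add ?_ (interpCoeff_degenerate hη b _)
  split_ifs
  · exact (qVal_degenerate hη a 0).neg
  · exact IsTriangular.zero

/-- The diagonal entry at a label is the scalar determinant for the string solution of that label.
-/
theorem isUnit_opDet_matC_degenerate (hη : η ≠ 0) (hs : SovCondition p η ξ)
    (hζ : ∀ n, ∀ k ≤ p n, ζ ≠ pt p η ξ n k) :
    IsUnit (opDet p (matC p η ξ !![0, 0; 0, 1] 1 ζ)) :=
  (IsTriangular.opDet (matC_degenerate hη)).isUnit fun h =>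
    (isString_degenerate hη hs _).det_ne_zero hη hs (fun n => Nat.lt_succ_iff.1 (h n).2) hζ

theorem isUnit_opDet_matCRepl_degenerate (hη : η ≠ 0) (hs : SovCondition p η ξ)
    (hζ : ∀ n, ∀ k ≤ p n, ζ ≠ pt p η ξ n k) (b : Fin N) :
    IsUnit (opDet p (matCRepl p η ξ !![0, 0; 0, 1] 1 ζ b)) := by
  refine (IsTriangular.opDet (m := fun h => (interpMat p η ξ ζ
    (degenerateString p η ξ fun n => h n)).updateCol b (interpRhs p η ξ ζ ℂ))
    fun a c => ?_).isUnit fun h => ?_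
  · simp only [matCRepl, Matrix.updateCol_apply]
    split_ifs
    · refine (IsTriangular.smul_one (nodeProd p η ξ (pt p η ξ a 0) / nodeProd p η ξ ζ)).neg.congr
        fun h => ?_
      rw [interpRhs, smul_eq_mul, mul_one]
    · exact matC_degenerate hη a c
  · rw [← Matrix.cramer_apply]
    exact (isString_degenerate hη hs _).cramer_ne_zero hη hs
      (fun n => Nat.lt_succ_iff.1 (h n).2) hζ b

end Triangular
end HigherSpin

namespace HigherSpin

/-! ### Rational functions of the parameters. -/

section Rational

variable {σ : Type*} {G : Set (σ → ℂ)}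

/-- `f` coincides on `G` with a rational function without poles in `G`. -/
def IsRat (G : Set (σ → ℂ)) (f : (σ → ℂ) → ℂ) : Prop :=
  ∃ P D : MvPolynomial σ ℂ, ∀ v ∈ G,
    MvPolynomial.eval v D ≠ 0 ∧ f v * MvPolynomial.eval v D = MvPolynomial.eval v P

namespace IsRat

variable {f g : (σ → ℂ) → ℂ}

theorem const (c : ℂ) : IsRat G fun _ => c :=
  ⟨MvPolynomial.C c, 1, fun v _ => by simp⟩

theorem coord (i : σ) : IsRat G fun v => v i :=
  ⟨MvPolynomial.X i, 1, fun v _ => by simp⟩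

theorem add (hf : IsRat G f) (hg : IsRat G g) : IsRat G fun v => f v + g v := by
  obtain ⟨P, D, h⟩ := hf
  obtain ⟨Q, E, k⟩ := hg
  refine ⟨P * E + Q * D, D * E, fun v hv => ⟨?_, ?_⟩⟩
  · rw [map_mul]
    exact mul_ne_zero (h v hv).1 (k v hv).1
  · rw [map_mul, map_add, map_mul, map_mul, ← (h v hv).2, ← (k v hv).2]
    ring

theorem mul (hf : IsRat G f) (hg : IsRat G g) : IsRat G fun v => f v * g v := by
  obtain ⟨P, D, h⟩ := hf
  obtain ⟨Q, E, k⟩ := hg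
  refine ⟨P * Q, D * E, fun v hv => ⟨?_, ?_⟩⟩
  · rw [map_mul]
    exact mul_ne_zero (h v hv).1 (k v hv).1
  · rw [map_mul, map_mul, ← (h v hv).2, ← (k v hv).2]
    ring

theorem neg (hf : IsRat G f) : IsRat G fun v => -f v := by
  simpa using (const (-1)).mul hf

theorem sub (hf : IsRat G f) (hg : IsRat G g) : IsRat G fun v => f v - g v := by
  simpa [sub_eq_add_neg] using hf.add hg.neg

theorem inv (hf : IsRat G f) (h0 : ∀ v ∈ G, f v ≠ 0) : IsRat G fun v => (f v)⁻¹ := by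
  obtain ⟨P, D, h⟩ := hf
  refine ⟨D, P, fun v hv => ?_⟩
  rw [← (h v hv).2]
  exact ⟨mul_ne_zero (h0 v hv) (h v hv).1, inv_mul_cancel_left₀ (h0 v hv) _⟩

theorem div (hf : IsRat G f) (hg : IsRat G g) (h0 : ∀ v ∈ G, g v ≠ 0) :
    IsRat G fun v => f v / g v := by
  simpa [div_eq_mul_inv] using hf.mul (hg.inv h0)

theorem sum {ι : Type*} (s : Finset ι) {f : ι → (σ → ℂ) → ℂ} (hf : ∀ i ∈ s, IsRat G (f i)) :
    IsRat G fun v => ∑ i ∈ s, f i v := by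
  classical
  induction s using Finset.induction_on with
  | empty => simpa using const 0
  | insert i s hi ih =>
    simp only [Finset.sum_insert hi]
    exact (hf i (by simp)).add (ih fun j hj => hf j (by simp [hj]))

theorem prod {ι : Type*} (s : Finset ι) {f : ι → (σ → ℂ) → ℂ} (hf : ∀ i ∈ s, IsRat G (f i)) :
    IsRat G fun v => ∏ i ∈ s, f i v := by
  classical
  induction s using Finset.induction_on with
  | empty => simpa using const 1
  | insert i s hi ih =>
    simp only [Finset.prod_insert hi]
    exact (hf i (by simp)).mul (ih fun j hj => hf j (by simp [hj]))

theorem pow (hf : IsRat G f) (k : ℕ) : IsRat G fun v => f v ^ k := by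
  simpa using prod (Finset.range k) fun _ _ => hf

theorem exists_polynomial (hf : IsRat G f) :
    ∃ P : MvPolynomial σ ℂ, ∀ v ∈ G, MvPolynomial.eval v P ≠ 0 ↔ f v ≠ 0 := by
  obtain ⟨P, D, h⟩ := hf
  refine ⟨P, fun v hv => ?_⟩
  rw [← (h v hv).2, mul_ne_zero_iff, and_iff_left (h v hv).1]

end IsRat

/-- A family of matrices with rational entries. -/
def IsMatRat {m : Type*} (G : Set (σ → ℂ)) (X : (σ → ℂ) → Matrix m m ℂ) : Prop :=
  ∀ i j, IsRat G fun v => X v i j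

namespace IsMatRat

variable {m : Type*} [Fintype m] [DecidableEq m] {X Y : (σ → ℂ) → Matrix m m ℂ}

omit [Fintype m] in
theorem one : IsMatRat G fun _ => (1 : Matrix m m ℂ) := fun i j => IsRat.const ((1 : Matrix m m ℂ) i j)

omit [Fintype m] [DecidableEq m] in
theorem zero : IsMatRat G fun _ => (0 : Matrix m m ℂ) := fun _ _ => IsRat.const 0

omit [Fintype m] [DecidableEq m] in
theorem add (hX : IsMatRat G X) (hY : IsMatRat G Y) : IsMatRat G fun v => X v + Y v :=
  fun i j => (hX i j).add (hY i j)

omit [Fintype m] [DecidableEq m] in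
theorem sub (hX : IsMatRat G X) (hY : IsMatRat G Y) : IsMatRat G fun v => X v - Y v :=
  fun i j => (hX i j).sub (hY i j)

omit [Fintype m] [DecidableEq m] in
theorem neg (hX : IsMatRat G X) : IsMatRat G fun v => -X v := fun i j => (hX i j).neg

omit [Fintype m] [DecidableEq m] in
theorem smul {c : (σ → ℂ) → ℂ} (hc : IsRat G c) (hX : IsMatRat G X) :
    IsMatRat G fun v => c v • X v := fun i j => hc.mul (hX i j)

omit [DecidableEq m] in
theorem mul (hX : IsMatRat G X) (hY : IsMatRat G Y) : IsMatRat G fun v => X v * Y v :=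
  fun i j => by
    simp only [Matrix.mul_apply]
    exact IsRat.sum _ fun k _ => (hX i k).mul (hY k j)

omit [Fintype m] [DecidableEq m] in
theorem sum {ι : Type*} (s : Finset ι) {X : ι → (σ → ℂ) → Matrix m m ℂ}
    (hX : ∀ i ∈ s, IsMatRat G (X i)) : IsMatRat G fun v => ∑ i ∈ s, X i v := fun i j => by
  simp only [Matrix.sum_apply]
  exact IsRat.sum s fun k hk => hX k hk i j

theorem list_prod {k : ℕ} {X : Fin k → (σ → ℂ) → Matrix m m ℂ} (hX : ∀ i, IsMatRat G (X i)) :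
    IsMatRat G fun v => (List.ofFn fun i => X i v).prod := by
  induction k with
  | zero => simpa using one
  | succ k ih =>
    simp only [List.ofFn_succ, List.prod_cons]
    exact (hX 0).mul (ih fun i => hX i.succ)

theorem det (hX : IsMatRat G X) : IsRat G fun v => (X v).det := by
  simp only [Matrix.det_apply, Units.smul_def, zsmul_eq_mul]
  exact IsRat.sum _ fun π _ => (IsRat.const _).mul (IsRat.prod _ fun i _ => hX _ _)

end IsMatRat

end Rational

/-! ### Genericity of the conditions on the Q-operator. -/

section Chain

variable {N : ℕ} {p : Fin N → ℕ} {η : ℂ}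

/-- The parameters `ξ_1, …, ξ_N, k₁, k₂`. -/
abbrev Params (N : ℕ) : Type := Fin N ⊕ Fin 2 → ℂ

/-- The inhomogeneities. -/
def paramXi (v : Params N) : Fin N → ℂ := fun n => v (Sum.inl n)

/-- The diagonal twist matrix with the given eigenvalues. -/
def paramTwist (v : Params N) : Matrix (Fin 2) (Fin 2) ℂ :=
  !![v (Sum.inr 0), 0; 0, v (Sum.inr 1)]

variable {G : Set (Params N)} {x : Params N → ℂ}

theorem isRat_pt (n : Fin N) (k : ℕ) : IsRat G fun v => pt p η (paramXi v) n k :=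
  ((IsRat.coord (Sum.inl n)).sub (IsRat.const _)).add (IsRat.const _)

theorem isRat_fd (hx : IsRat G x) : IsRat G fun v => fd p η (paramXi v) (x v) := by
  simp only [fd_eq]
  exact IsRat.prod _ fun n _ => hx.sub (isRat_pt n _)

theorem isRat_fa (hx : IsRat G x) : IsRat G fun v => fa p η (paramXi v) (x v) := by
  simp only [fa_eq]
  exact IsRat.prod _ fun n _ => hx.sub (isRat_pt n _)

theorem isRat_nodeProd (hx : IsRat G x) : IsRat G fun v => nodeProd p η (paramXi v) (x v) :=
  IsRat.prod _ fun n _ => IsRat.prod _ fun k _ => hx.sub (isRat_pt n k)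

theorem isRat_nodeProdErase (b : Fin N) (h : ℕ) (hx : IsRat G x) :
    IsRat G fun v => nodeProdErase p η (paramXi v) b h (x v) :=
  IsRat.prod _ fun n _ => IsRat.prod _ fun k _ => by
    split_ifs
    · exact IsRat.const 1
    · exact hx.sub (isRat_pt n k)

theorem isMatRat_siteLax (n : Fin N) (hx : IsRat G x) (i j : Fin 2) :
    IsMatRat G fun v => siteLax p η (paramXi v) n (x v) i j := fun h h' => by
  simp only [siteLax, Matrix.map_apply, siteOp_apply, lax_apply]
  by_cases ho : ∀ m, m ≠ n → h m = h' m
  · simp only [if_pos ho]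
    simp only [Matrix.add_apply, Matrix.smul_apply, smul_eq_mul]
    exact ((((hx.sub (IsRat.coord (Sum.inl n))).add (IsRat.const _)).mul (IsRat.const _)).mul
      (IsRat.const _)).add (IsRat.const _)
  · simp only [if_neg ho]
    exact IsRat.const 0

theorem isMatRat_siteLax_prod (L : List (Fin N)) (hx : IsRat G x) (i j : Fin 2) :
    IsMatRat G fun v => (L.map fun n => siteLax p η (paramXi v) n (x v)).prod i j := by
  induction L generalizing i j with
  | nil =>
    simp only [List.map_nil, List.prod_nil, Matrix.one_apply]
    split_ifs
    · exact IsMatRat.one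
    · exact IsMatRat.zero
  | cons n L ih =>
    simp only [List.map_cons, List.prod_cons, Matrix.mul_apply]
    exact IsMatRat.sum _ fun k _ => (isMatRat_siteLax n hx i k).mul (ih k j)

theorem isRat_twist (i j : Fin 2) : IsRat G fun v : Params N => paramTwist v i j := by
  fin_cases i <;> fin_cases j
  · exact IsRat.coord (Sum.inr 0)
  · exact IsRat.const 0
  · exact IsRat.const 0
  · exact IsRat.coord (Sum.inr 1)

theorem isMatRat_transfer (hx : IsRat G x) :
    IsMatRat G fun v => transfer p η (paramXi v) (paramTwist v) (x v) := by
  simp only [transfer, monodromy_eq, Matrix.trace, Matrix.diag, Matrix.mul_apply, auxMat,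
    Matrix.map_apply, Algebra.algebraMap_eq_smul_one, smul_mul_assoc, one_mul]
  exact IsMatRat.sum _ fun i _ => IsMatRat.sum _ fun k _ =>
    (isMatRat_siteLax_prod _ hx k i).smul (isRat_twist i k)

theorem isMatRat_fusedTransfer (hη : η ≠ 0) (l : ℕ) (hx : IsRat G x) :
    IsMatRat G fun v => fusedTransfer p η (paramXi v) (paramTwist v) l (x v) := by
  induction l using Nat.twoStepInduction with
  | zero =>
    simp only [fusedTransfer_zero p η _ hη]
    exact IsMatRat.one
  | one =>
    simp only [fusedTransfer_one p η _ hη]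
    exact isMatRat_transfer hx
  | more l h0 h1 =>
    simp only [fusedTransfer_succ_succ p η _ hη]
    refine ((isMatRat_transfer (hx.add (IsRat.const _))).mul h1).sub (h0.smul ?_)
    exact (IsMatRat.det isRat_twist).mul
      ((isRat_fa (hx.add (IsRat.const _))).mul (isRat_fd (hx.add (IsRat.const _))))

/-- The factors whose zeros have to be avoided for the definition of the matrix `C_ζ`. -/
noncomputable def regularFactor (p : Fin N → ℕ) (η ζ : ℂ) (v : Params N) : ℂ :=
  v (Sum.inr 1) * (∏ n, ∏ k ∈ Finset.range (p n + 1), (ζ - pt p η (paramXi v) n k)) *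
    ∏ a, ∏ b ∈ Finset.univ.erase a, ∏ h ∈ Finset.range (p a + 1), ∏ k ∈ Finset.range (p b + 1),
      (pt p η (paramXi v) a h - pt p η (paramXi v) b k)

theorem isRat_regularFactor (ζ : ℂ) : IsRat G (regularFactor p η ζ) :=
  ((IsRat.coord _).mul (IsRat.prod _ fun n _ => IsRat.prod _ fun k _ =>
    (IsRat.const ζ).sub (isRat_pt n k))).mul
    (IsRat.prod _ fun a _ => IsRat.prod _ fun b _ => IsRat.prod _ fun h _ => IsRat.prod _ fun k _ =>
      (isRat_pt a h).sub (isRat_pt b k))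

theorem regularFactor_ne_zero_iff {ζ : ℂ} {v : Params N} :
    regularFactor p η ζ v ≠ 0 ↔ v (Sum.inr 1) ≠ 0 ∧ (∀ n, ∀ k ≤ p n, ζ ≠ pt p η (paramXi v) n k) ∧
      SovCondition p η (paramXi v) := by
  simp only [regularFactor, mul_ne_zero_iff, Finset.prod_ne_zero_iff, Finset.mem_univ, true_imp_iff,
    Finset.mem_range, Finset.mem_erase, and_true, sub_ne_zero, SovCondition, Nat.lt_succ_iff, and_assoc]
  exact and_congr_right fun _ => and_congr_right fun _ =>
    ⟨fun h a b hab => h a b hab.symm, fun h a b hab => h a b hab.symm⟩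

variable {ζ : ℂ}

theorem isMatRat_qVal (hη : η ≠ 0) (hG : ∀ v ∈ G, regularFactor p η ζ v ≠ 0) (a : Fin N) (h : ℕ) :
    IsMatRat G fun v => qVal p η (paramXi v) (paramTwist v) (v (Sum.inr 1)) a h := by
  refine (isMatRat_fusedTransfer hη _ (isRat_pt a _)).smul (IsRat.inv ?_ fun v hv => ?_)
  · exact ((IsRat.coord _).pow _).mul (IsRat.prod _ fun k _ => isRat_fd (isRat_pt a _))
  · obtain ⟨h1, -, hs⟩ := regularFactor_ne_zero_iff.1 (hG v hv)
    exact hs.qDen_ne hη h1 (Nat.sub_le _ _)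

theorem isMatRat_interpCoeff (hη : η ≠ 0) (hG : ∀ v ∈ G, regularFactor p η ζ v ≠ 0) (b : Fin N)
    (hx : IsRat G x) :
    IsMatRat G fun v => interpCoeff p η (paramXi v) (paramTwist v) (v (Sum.inr 1)) ζ b (x v) := by
  refine IsMatRat.sum _ fun h hh => (isMatRat_qVal hη hG b h).smul ?_
  obtain ⟨h1, hh⟩ := Finset.mem_Icc.1 hh
  refine ((hx.sub (IsRat.const ζ)).div ((isRat_pt b h).sub (IsRat.const ζ)) fun v hv => ?_).mul
    ((isRat_nodeProdErase b h hx).div (isRat_nodeProdErase b h (isRat_pt b h)) fun v hv => ?_)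
  · exact sub_ne_zero.2 ((regularFactor_ne_zero_iff.1 (hG v hv)).2.1 b h hh).symm
  · exact (regularFactor_ne_zero_iff.1 (hG v hv)).2.2.nodeProdErase_ne hη hh

theorem isMatRat_matC (hη : η ≠ 0) (hG : ∀ v ∈ G, regularFactor p η ζ v ≠ 0) (a b : Fin N) :
    IsMatRat G fun v => matC p η (paramXi v) (paramTwist v) (v (Sum.inr 1)) ζ a b := by
  simp only [matC, Matrix.of_apply]
  refine IsMatRat.add ?_ (isMatRat_interpCoeff hη hG b (isRat_pt a 0))
  split_ifs
  · exact (isMatRat_qVal hη hG a 0).neg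
  · exact IsMatRat.zero

theorem isMatRat_matCRepl (hη : η ≠ 0) (hG : ∀ v ∈ G, regularFactor p η ζ v ≠ 0) (j a b : Fin N) :
    IsMatRat G fun v => matCRepl p η (paramXi v) (paramTwist v) (v (Sum.inr 1)) ζ j a b := by
  simp only [matCRepl, Matrix.updateCol_apply]
  split_ifs
  · refine (IsMatRat.one.smul ((isRat_nodeProd (isRat_pt a 0)).div (isRat_nodeProd (IsRat.const ζ))
      fun v hv => ?_)).neg
    exact nodeProd_ne_zero fun n k _ hk => (regularFactor_ne_zero_iff.1 (hG v hv)).2.1 n k hk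
  · exact isMatRat_matC hη hG a b

theorem isMatRat_opDet {M : Params N → Matrix (Fin N) (Fin N) (Op p)}
    (hM : ∀ a b, IsMatRat G fun v => M v a b) : IsMatRat G fun v => opDet p (M v) := by
  refine IsMatRat.sum _ fun π _ => ?_
  simp only [← Int.cast_smul_eq_zsmul ℂ]
  exact (IsMatRat.list_prod fun i => hM (π i) i).smul (IsRat.const _)

/-- Because `p n` is positive the last point of the string is a node, and the value of Q there is
the quotient of the two determinants. -/
theorem qDefined_of_isUnit (hp : ∀ n, 1 ≤ p n) (hη : η ≠ 0) {ξ : Fin N → ℂ}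
    {K : Matrix (Fin 2) (Fin 2) ℂ} {k₂ : ℂ} (hs : SovCondition p η ξ)
    (hζ : ∀ n, ∀ k ≤ p n, ζ ≠ pt p η ξ n k) (hC : IsUnit (opDet p (matC p η ξ K k₂ ζ)))
    (hR : ∀ b, IsUnit (opDet p (matCRepl p η ξ K k₂ ζ b))) : QDefined p η ξ K k₂ ζ := by
  have hζ' : ∀ n, ∀ k, 1 ≤ k → k ≤ p n → ζ ≠ pt p η ξ n k := fun n k _ hk => hζ n k hk
  refine ⟨hζ', hC, fun n => ?_⟩
  obtain ⟨A, _, _, φ, q, hq, hu, h1⟩ := exists_lift hη p ξ K k₂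
  rw [opDet_matC hq] at hC
  obtain ⟨e, he⟩ := (hu _ hC).exists_right_inv
  have hr := hR n
  rw [opDet_matCRepl hq] at hr
  rw [opQ_eq hq he, interpQ_node q hη hs hζ' _ (hp n) le_rfl, h1, one_mul, map_mul]
  exact hr.mul (φ.isUnit_map (IsUnit.of_mul_eq_one _ ((mul_comm _ _).trans he)))

theorem exists_regular_point (p : Fin N → ℕ) (hη : η ≠ 0) (ζ : ℂ) :
    ∃ ξ : Fin N → ℂ, (∀ n, ∀ k ≤ p n, ζ ≠ pt p η ξ n k) ∧ SovCondition p η ξ := by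
  obtain ⟨M, hM⟩ : ∃ M : ℕ, ∀ n, p n < M :=
    ⟨∑ n, p n + 1, fun n => Nat.lt_succ_of_le
      (Finset.single_le_sum (f := p) (fun _ _ => Nat.zero_le _) (Finset.mem_univ n))⟩
  -- In units of `η` the strings consist of half-integers relative to `ζ`, so they avoid `ζ`; the
  -- spacing `M`, larger than every `p n`, keeps them apart.
  let ξ : Fin N → ℂ := fun n => ζ + η / 2 - (p n : ℂ) / 2 * η + η * (1 / 2 + M * (n : ℕ))
  have hpt : ∀ n k, pt p η ξ n k =
      ζ + η * (1 / 2 + M * (n : ℕ) - k) := by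
    intro n k; simp only [pt, ξ]; ring
  refine ⟨ξ, fun n k hk => ?_, fun a b hab h hh k hk => ?_⟩
  · rw [hpt]
    intro h
    have h2 : (1 / 2 + M * (n : ℕ) - k : ℂ) = 0 := by
      refine (mul_eq_zero.1 ?_).resolve_left hη
      linear_combination -h
    have h3 : ((1 + 2 * (M * n) : ℕ) : ℂ) = ((2 * k : ℕ) : ℂ) := by
      push_cast; linear_combination 2 * h2
    have h4 : 1 + 2 * (M * (n : ℕ)) = 2 * k := by exact_mod_cast h3
    omega
  · rw [hpt, hpt]
    intro e
    have h2 := mul_left_cancel₀ hη (add_left_cancel e)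
    have h3 : ((M * a + k : ℕ) : ℂ) = ((M * b + h : ℕ) : ℂ) := by
      push_cast; linear_combination h2
    have h4 : M * (a : ℕ) + k = M * b + h := by exact_mod_cast h3
    have ha := hM a
    have hb := hM b
    rcases Nat.lt_or_gt_of_ne (Fin.val_ne_of_ne hab) with hlt | hlt
    · nlinarith [Nat.mul_le_mul_left M (Nat.succ_le_of_lt hlt)]
    · nlinarith [Nat.mul_le_mul_left M (Nat.succ_le_of_lt hlt)]

theorem IsRegularTwist.exists_diagonal {K : Matrix (Fin 2) (Fin 2) ℂ} {k₁ k₂ : ℂ}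
    (hK : IsRegularTwist K k₁ k₂) :
    ∃ W : Matrix (Fin 2) (Fin 2) ℂ, IsUnit W ∧ W⁻¹ * K * W = !![k₁, 0; 0, k₂] := by
  have hev : ∀ c, (c = k₁ ∨ c = k₂) → ∃ v : Fin 2 → ℂ, v ≠ 0 ∧ K *ᵥ v = c • v := by
    intro c hc
    have hdet : (Matrix.scalar (Fin 2) c - K).det = 0 := by
      rw [← Matrix.eval_charpoly, hK.1]
      rcases hc with rfl | rfl <;> simp
    obtain ⟨v, hv, h⟩ := Matrix.exists_mulVec_eq_zero_iff.2 hdet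
    refine ⟨v, hv, ?_⟩
    rw [Matrix.sub_mulVec, sub_eq_zero, Matrix.scalar_apply, ← Matrix.smul_one_eq_diagonal,
      Matrix.smul_mulVec, Matrix.one_mulVec] at h
    exact h.symm
  obtain ⟨u, hu, hKu⟩ := hev k₁ (Or.inl rfl)
  obtain ⟨w, hw, hKw⟩ := hev k₂ (Or.inr rfl)
  have hne := sub_ne_zero.2 hK.2.1
  have u0 := congrFun hKu 0
  have u1 := congrFun hKu 1
  have w0 := congrFun hKw 0
  have w1 := congrFun hKw 1
  simp only [Matrix.mulVec, dotProduct, Fin.sum_univ_two, Pi.smul_apply, smul_eq_mul] at u0 u1 w0 w1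
  have hKW : K * !![u 0, w 0; u 1, w 1] = !![u 0, w 0; u 1, w 1] * !![k₁, 0; 0, k₂] := by
    ext i j
    rw [Matrix.mul_apply, Matrix.mul_apply, Fin.sum_univ_two, Fin.sum_univ_two]
    fin_cases i <;> fin_cases j <;> simp
    · linear_combination u0
    · linear_combination w0
    · linear_combination u1
    · linear_combination w1
  have hW : IsUnit !![u 0, w 0; u 1, w 1] := by
    rw [Matrix.isUnit_iff_isUnit_det, isUnit_iff_ne_zero]
    intro h
    obtain ⟨c, hc, h⟩ := Matrix.exists_mulVec_eq_zero_iff.2 h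
    have h2 := congrArg (fun y => K *ᵥ y) h
    simp only [Matrix.mulVec_mulVec, Matrix.mulVec_zero, hKW] at h2
    have e0 := congrFun h 0
    have e1 := congrFun h 1
    have g0 := congrFun h2 0
    have g1 := congrFun h2 1
    simp [Matrix.mulVec, dotProduct, Fin.sum_univ_two] at e0 e1 g0 g1
    have c0 : c 0 = 0 := by
      by_contra hc0
      refine hu (funext fun i => ?_)
      fin_cases i
      · refine (mul_eq_zero.1 ?_).resolve_left (mul_ne_zero hne hc0)
        simp only [Fin.zero_eta, Fin.isValue]
        linear_combination g0 - k₂ * e0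
      · refine (mul_eq_zero.1 ?_).resolve_left (mul_ne_zero hne hc0)
        simp only [Fin.mk_one, Fin.isValue]
        linear_combination g1 - k₂ * e1
    have c1 : c 1 = 0 := by
      by_contra hc1
      rw [c0] at e0 e1
      refine hw (funext fun i => ?_)
      fin_cases i
      · simpa [hc1] using e0
      · simpa [hc1] using e1
    exact hc (funext fun i => by fin_cases i <;> simp [c0, c1])
  refine ⟨_, hW, ?_⟩
  rw [Matrix.mul_assoc, hKW, ← Matrix.mul_assoc,
    Matrix.nonsing_inv_mul _ ((Matrix.isUnit_iff_isUnit_det _).1 hW), Matrix.one_mul]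

/-- After diagonalization of the twist, the determinants are rational wherever `regularFactor` does
not vanish. Their denominators involve `k₂` but not `k₁`, so the polynomials may be tested at `k₁ =
0`, `k₂ = 1`, although this twist is not itself regular. -/
theorem exists_polynomial_qDefined (hp : ∀ n, 1 ≤ p n) (hη : η ≠ 0) (ζ : ℂ) :
    ∃ P : MvPolynomial (Fin N ⊕ Fin 2) ℂ, P ≠ 0 ∧
      ∀ (ξ : Fin N → ℂ) (K : Matrix (Fin 2) (Fin 2) ℂ) (k₁ k₂ : ℂ), IsRegularTwist K k₁ k₂ →
        MvPolynomial.eval (Sum.elim ξ ![k₁, k₂]) P ≠ 0 →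
          SovCondition p η ξ ∧ QDefined p η ξ K k₂ ζ := by
  set G : Set (Params N) := {v | regularFactor p η ζ v ≠ 0} with hGdef
  have hG : ∀ v ∈ G, regularFactor p η ζ v ≠ 0 := fun v hv => hv
  obtain ⟨P₀, h₀⟩ := (isRat_regularFactor (G := Set.univ) (p := p) (η := η) ζ).exists_polynomial
  obtain ⟨P₁, h₁⟩ := (isMatRat_opDet (isMatRat_matC hη hG)).det.exists_polynomial
  choose P₂ h₂ using fun b =>
    (isMatRat_opDet (isMatRat_matCRepl hη hG b)).det.exists_polynomial
  have key : ∀ v : Params N, MvPolynomial.eval v (P₀ * P₁ * ∏ b, P₂ b) ≠ 0 ↔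
      regularFactor p η ζ v ≠ 0 ∧
      IsUnit (opDet p (matC p η (paramXi v) (paramTwist v) (v (Sum.inr 1)) ζ)) ∧
      ∀ b, IsUnit (opDet p (matCRepl p η (paramXi v) (paramTwist v) (v (Sum.inr 1)) ζ b)) := by
    intro v
    simp only [map_mul, map_prod, mul_ne_zero_iff, Finset.prod_ne_zero_iff, Finset.mem_univ,
      true_imp_iff, and_assoc]
    rw [h₀ v (Set.mem_univ v)]
    refine and_congr_right fun hv => ?_
    simp only [Matrix.isUnit_iff_isUnit_det, isUnit_iff_ne_zero]
    exact and_congr (h₁ v hv) (forall_congr' fun b => h₂ b v hv)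
  refine ⟨P₀ * P₁ * ∏ b, P₂ b, ?_, fun ξ K k₁ k₂ hK hP => ?_⟩
  · obtain ⟨ξ, hζ, hs⟩ := exists_regular_point p hη ζ
    have h := (key (Sum.elim ξ ![0, 1])).2 ⟨regularFactor_ne_zero_iff.2 ⟨one_ne_zero, hζ, hs⟩,
      isUnit_opDet_matC_degenerate hη hs hζ, isUnit_opDet_matCRepl_degenerate hη hs hζ⟩
    rintro h0
    rw [h0, map_zero] at h
    exact h rfl
  · obtain ⟨hr, hC, hR⟩ := (key _).1 hP
    obtain ⟨-, hζ, hs⟩ := regularFactor_ne_zero_iff.1 hr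
    refine ⟨hs, ?_⟩
    obtain ⟨W, hW, hd⟩ := hK.exists_diagonal
    refine QDefined.of_conj hη hW ?_
    rw [hd]
    exact qDefined_of_isUnit hp hη hs hζ hC hR

end Chain
end HigherSpin

theorem corollary5p3 (N : ℕ) (p : Fin N → ℕ) (hp : ∀ n, 1 ≤ p n) (η : ℂ) (hη : η ≠ 0) (ζ : ℂ) :
    -- for almost all parameters the `Q`-operator exists and `Q(ξ_n^{(2 s_n)})` is invertible
    (∃ P : MvPolynomial (Fin N ⊕ Fin 2) ℂ, P ≠ 0 ∧
      ∀ (ξ : Fin N → ℂ) (K : Matrix (Fin 2) (Fin 2) ℂ) (k₁ k₂ : ℂ),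
        HigherSpin.IsRegularTwist K k₁ k₂ →
        MvPolynomial.eval (Sum.elim ξ ![k₁, k₂]) P ≠ 0 →
          HigherSpin.SovCondition p η ξ ∧ HigherSpin.QDefined p η ξ K k₂ ζ) ∧
    -- whenever it does, it generates the basis
    (∀ (ξ : Fin N → ℂ) (K : Matrix (Fin 2) (Fin 2) ℂ) (k₁ k₂ : ℂ),
      HigherSpin.IsRegularTwist K k₁ k₂ →
      HigherSpin.SovCondition p η ξ → HigherSpin.QDefined p η ξ K k₂ ζ →
        (∀ x : ℂ, (∀ n, ∀ k, 1 ≤ k → k ≤ p n → x ≠ HigherSpin.pt p η ξ n k) →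
          HigherSpin.opQ p η ξ K k₂ ζ x = HigherSpin.opQDet p η ξ K k₂ ζ x) ∧
        (K 0 1 ≠ 0 →
          (∀ h : HigherSpin.Idx p,
            Matrix.vecMul (HigherSpin.covL p η ξ K k₁ k₂ ζ) (HigherSpin.qProd p η ξ K k₂ ζ h) =
              HigherSpin.skCovector p η ξ K k₁ h) ∧
          HigherSpin.IsSovEigenbasis p η ξ (HigherSpin.skCovector p η ξ K k₁)
            (HigherSpin.opB p η ξ K) (K 0 1)) ∧
        (K 0 1 = 0 →
          (∃ W, HigherSpin.IsDressing K W) ∧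
          ∀ W : Matrix (Fin 2) (Fin 2) ℂ, HigherSpin.IsDressing K W →
            (∀ h : HigherSpin.Idx p,
              Matrix.vecMul (HigherSpin.covLTilde p η ξ K W k₁ k₂ ζ)
                  (HigherSpin.qProd p η ξ K k₂ ζ h) =
                HigherSpin.skCovectorTilde p η ξ K W k₁ h) ∧
            HigherSpin.IsSovEigenbasis p η ξ (HigherSpin.skCovectorTilde p η ξ K W k₁)
              (HigherSpin.opBTilde p η ξ K W) ((W⁻¹ * K * W) 0 1))) := by
  refine ⟨HigherSpin.exists_polynomial_qDefined hp hη ζ, fun ξ K k₁ k₂ hK hs hQ => ⟨fun x hx =>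
    HigherSpin.opQ_eq_opQDet hη hQ hx, fun hb => ⟨fun h => HigherSpin.covL_qProd hη hK hs hQ hb h,
    HigherSpin.skCovector_isSovEigenbasis hη hK hs hb⟩, fun h01 =>
    ⟨HigherSpin.exists_isDressing hK h01, fun W hW =>
      ⟨fun h => HigherSpin.covLTilde_qProd hη hK hs hQ hW h,
        HigherSpin.skCovectorTilde_isSovEigenbasis hη hK hs hW⟩⟩⟩⟩
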